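/- Let $t\in\mathbb C$ with $|t|<1$, let $\sqrt t$ be a square root of $t$, and let $\alpha,\beta\in\mathbb C$. A partition with $N$ parts is $\lambda=(\lambda_1\ge\dots\ge\lambda_N\ge 0)$, zero parts allowed and counted (so zero parts count as even parts); $m_i(\lambda)$ is the number of $j$ with $\lambda_j=i$ $(i\ge 0)$. Put $\phi_r(t)=\prod_{j=1}^r(1-t^j)$, $[m]!=\phi_m(t)/(1-t)^m$, $v_\lambda(t)=\prod_{i\ge0}[m_i(\lambda)]!$, let $$P_\lambda(x_1,\dots,x_N;t)=\frac1{v_\lambda(t)}\sum_{w\in S_N}w\Big(x_1^{\lambda_1}\cdots x_N^{\lambda_N}\prod_{1\le i<j\le N}\frac{x_i-tx_j}{x_i-x_j}\Big)$$ be the Hall–Littlewood polynomial and $H_m(z;t)=\sum_{i=0}^m z^i\frac{[m]!}{[m-i]!\,[i]!}$ the Rogers–Szegő polynomial. Let $$\tilde\Delta_K^{(n)}(a,b,c,d)=\frac1{2^nn!}\prod_{i=1}^n\frac{1-x_i^{\pm2}}{(1-ax_i^{\pm1})(1-bx_i^{\pm1})(1-cx_i^{\pm1})(1-dx_i^{\pm1})}\prod_{1\le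 i<j\le n}\frac{1-x_i^{\pm1}x_j^{\pm1}}{1-tx_i^{\pm1}x_j^{\pm1}},$$ where an expression with $\pm$ signs stands for the product over all choices of signs, and $\pm a$ in an argument list of $\tilde\Delta_K$ means the two parameters $a,-a$. Integrals are over the torus $|x_1|=\dots=|x_k|=1$ ($k$ the number of variables) with $dT=\prod_j\frac{dx_j}{2\pi\sqrt{-1}\,x_j}$, and $Z$ denotes in each case the integral of the density $\tilde\Delta_K$ appearing there. For $\alpha\ne0$ write $$A_\lambda=\Big(\prod_{i\ge0}H_{m_{2i}(\lambda)}(\alpha\beta;t)\prod_{i\ge0}H_{m_{2i+1}(\lambda)}(\beta/\alpha;t)\Big)(-\alpha)^{\#\text{ of odd parts of }\lambda},$$ $$B_\lambda=\Big(\prod_{i\ge0}H_{m_{2i+1}(\lambda)}(\alpha\beta;t)\prod_{i\ge0}H_{m_{2i}(\lambda)}(\beta/\alpha;t)\Big)(-\alpha)^{\#\text{ of even parts of }\lambda};$$ these are polynomials in $\alpha$, and for $\alpha=0$ they denote the values of those polynomials, $A_\lambda=(-\beta)^{\#\text{ of odd parts}}$ and $B_\lambda=(-\beta)^{\#\text{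 of even parts}}$. Then in each case the integrand below is integrable, $Z\ne0$, and: (i) ($O^+(2n)$, $n\ge1$) for $\lambda$ with $2n$ parts, $$\frac1Z\int P_\lambda(x_1^{\pm1},\dots,x_n^{\pm1};t)\,\tilde\Delta_K^{(n)}(\pm1,\pm\sqrt t)\prod_{i=1}^n(1-\alpha x_i^{\pm1})(1-\beta x_i^{\pm1})\,dT=\frac{\phi_{2n}(t)}{v_\lambda(t)(1-t)^{2n}}\,[A_\lambda+B_\lambda];$$ (ii) ($O^-(2n)$, $n\ge1$) for $\lambda$ with $2n$ parts, $$\frac{(1-\alpha^2)(1-\beta^2)}Z\int P_\lambda(x_1^{\pm1},\dots,x_{n-1}^{\pm1},1,-1;t)\,\tilde\Delta_K^{(n-1)}(\pm t,\pm\sqrt t)\prod_{i=1}^{n-1}(1-\alpha x_i^{\pm1})(1-\beta x_i^{\pm1})\,dT=\frac{\phi_{2n}(t)}{v_\lambda(t)(1-t)^{2n}}\,[A_\lambda-B_\lambda];$$ (iii) ($O^+(2n+1)$, $n\ge0$) for $\lambda$ with $2n+1$ parts, $$\frac{(1-\alpha)(1-\beta)}Z\int P_\lambda(x_1^{\pm1},\dots,x_n^{\pm1},1;t)\,\tilde\Delta_K^{(n)}(t,-1,\pm\sqrt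 t)\prod_{i=1}^n(1-\alpha x_i^{\pm1})(1-\beta x_i^{\pm1})\,dT=\frac{\phi_{2n+1}(t)}{v_\lambda(t)(1-t)^{2n+1}}\,[A_\lambda+B_\lambda];$$ (iv) ($O^-(2n+1)$, $n\ge0$) for $\lambda$ with $2n+1$ parts, $$\frac{(1+\alpha)(1+\beta)}Z\int P_\lambda(x_1^{\pm1},\dots,x_n^{\pm1},-1;t)\,\tilde\Delta_K^{(n)}(1,-t,\pm\sqrt t)\prod_{i=1}^n(1-\alpha x_i^{\pm1})(1-\beta x_i^{\pm1})\,dT=\frac{\phi_{2n+1}(t)}{v_\lambda(t)(1-t)^{2n+1}}\,[A_\lambda-B_\lambda].$$ -/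

import Mathlib

/-! ### The Hall--Littlewood polynomial -/

/-- The symmetrization `∑_w w (x^lam ∏_{i<j} (x_i - t x_j) / (x_i - x_j))` over all permutations `w`
of the variables, formed in a field containing `t` and the (distinct) elements `x_i`. -/
noncomputable def hlSum {K : Type*} [Field K] {N : ℕ} (t : K) (lam : Fin N → ℕ) (x : Fin N → K) :
    K :=
  ∑ w : Equiv.Perm (Fin N), (∏ i, x (w i) ^ lam i) *
    ∏ i, ∏ j ∈ Finset.Ioi i, (x (w i) - t * x (w j)) / (x (w i) - x (w j))

/-- The alternating numerator of `hlSum` over the common denominator `∏_{i<j} (x_i - x_j)`. -/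
def hlNum {A : Type*} [CommRing A] {N : ℕ} (t : A) (lam : Fin N → ℕ) (x : Fin N → A) : A :=
  ∑ w : Equiv.Perm (Fin N), ((Equiv.Perm.sign w : ℤ) : A) * ((∏ i, x (w i) ^ lam i) *
    ∏ i, ∏ j ∈ Finset.Ioi i, (x (w i) - t * x (w j)))

theorem prod_sub_perm {A : Type*} [CommRing A] {N : ℕ} (x : Fin N → A) (w : Equiv.Perm (Fin N)) :
    ∏ i, ∏ j ∈ Finset.Ioi i, (x (w i) - x (w j)) =
      ((Equiv.Perm.sign w : ℤ) : A) * ∏ i, ∏ j ∈ Finset.Ioi i, (x i - x j) := by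
  have h1 := Matrix.det_vandermonde (fun i => - x i)
  have h2 := Matrix.det_vandermonde (fun i => - x (w i))
  have h3 := Matrix.det_permute w (Matrix.vandermonde (fun i => - x i))
  have e : (Matrix.vandermonde (fun i => - x i)).submatrix w id
      = Matrix.vandermonde (fun i => - x (w i)) := by
    ext i j; simp [Matrix.vandermonde]
  rw [e, h1, h2] at h3
  simpa only [neg_sub_neg] using h3

theorem hlSum_mul {K : Type*} [Field K] {N : ℕ} (t : K) (lam : Fin N → ℕ) (x : Fin N → K)
    (hx : Function.Injective x) :
    hlSum t lam x * ∏ i, ∏ j ∈ Finset.Ioi i, (x i - x j) = hlNum t lam x := by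
  unfold hlSum hlNum
  rw [Finset.sum_mul]
  refine Finset.sum_congr rfl fun w _ => ?_
  have hs : ((Equiv.Perm.sign w : ℤ) : K) * ((Equiv.Perm.sign w : ℤ) : K) = 1 := by
    rw [← Int.cast_mul, Int.units_coe_mul_self, Int.cast_one]
  have hD : ∏ i, ∏ j ∈ Finset.Ioi i, (x i - x j) = ((Equiv.Perm.sign w : ℤ) : K) *
      ∏ i, ∏ j ∈ Finset.Ioi i, (x (w i) - x (w j)) := by
    rw [prod_sub_perm, ← mul_assoc, hs, one_mul]
  have hne : ∏ i, ∏ j ∈ Finset.Ioi i, (x (w i) - x (w j)) ≠ 0 := by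
    refine Finset.prod_ne_zero_iff.2 fun i _ => Finset.prod_ne_zero_iff.2 fun j hj => ?_
    have hij : i ≠ j := ne_of_lt (Finset.mem_Ioi.1 hj)
    exact sub_ne_zero.2 fun h => hij (w.injective (hx h))
  rw [hD]
  simp only [Finset.prod_div_distrib]
  field_simp

theorem hlNum_eq_zero {A : Type*} [CommRing A] {N : ℕ} (t : A) (lam : Fin N → ℕ) (x : Fin N → A)
    {a b : Fin N} (hab : a ≠ b) (h : x a = x b) : hlNum t lam x = 0 := by
  have hx : ∀ i, x (Equiv.swap a b i) = x i := by
    intro i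
    rcases eq_or_ne i a with rfl | hia
    · simp [h]
    rcases eq_or_ne i b with rfl | hib
    · simp [h]
    rw [Equiv.swap_apply_of_ne_of_ne hia hib]
  unfold hlNum
  refine Finset.sum_involution (fun w _ => Equiv.swap a b * w) ?_ ?_ ?_ ?_
  · intro w _
    simp [hx, Equiv.Perm.sign_mul, Equiv.Perm.sign_swap hab]
  · intro w _ _ hw
    have : Equiv.swap a b = 1 := by simpa using hw
    exact hab (Equiv.swap_eq_one_iff.1 this)
  · intro w _
    exact Finset.mem_univ _
  · intro w _
    simp [← mul_assoc]

theorem map_hlNum {A B : Type*} [CommRing A] [CommRing B] (f : A →+* B) {N : ℕ} (t : A)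
    (lam : Fin N → ℕ) (x : Fin N → A) :
    f (hlNum t lam x) = hlNum (f t) lam (fun i => f (x i)) := by
  simp [hlNum, map_sum, map_prod]

theorem sub_dvd_hlNum {N : ℕ} (t : ℂ) (lam : Fin N → ℕ) {a b : Fin N} (hab : a ≠ b) :
    (MvPolynomial.X a - MvPolynomial.X b : MvPolynomial (Fin N) ℂ) ∣
      hlNum (MvPolynomial.C t) lam MvPolynomial.X := by
  rw [← Ideal.mem_span_singleton, ← Ideal.Quotient.eq_zero_iff_mem, map_hlNum]
  refine hlNum_eq_zero _ _ _ hab ?_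
  exact Ideal.Quotient.eq.2 (Ideal.mem_span_singleton_self _)

theorem X_sub_X_irreducible {N : ℕ} {a b : Fin N} (hab : a ≠ b) :
    Irreducible (MvPolynomial.X a - MvPolynomial.X b : MvPolynomial (Fin N) ℂ) := by
  have hc : (MvPolynomial.X a - MvPolynomial.X b : MvPolynomial (Fin N) ℂ).coeff
      (Finsupp.single a 1) = 1 := by
    simp [MvPolynomial.coeff_X, Finsupp.single_left_inj, hab.symm]
  refine MvPolynomial.irreducible_of_totalDegree_eq_one (le_antisymm ?_ ?_) fun y hy => ?_
  · exact (MvPolynomial.totalDegree_sub _ _).trans (by simp)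
  · have := MvPolynomial.le_totalDegree (p := (MvPolynomial.X a - MvPolynomial.X b :
      MvPolynomial (Fin N) ℂ)) (s := Finsupp.single a 1) (by
        rw [MvPolynomial.mem_support_iff, hc]; exact one_ne_zero)
    simpa using this
  · exact isUnit_of_dvd_one (hc ▸ hy (Finsupp.single a 1))

theorem exists_hl {N : ℕ} (t : ℂ) (lam : Fin N → ℕ) :
    ∃ R : MvPolynomial (Fin N) ℂ,
      hlNum (MvPolynomial.C t) lam MvPolynomial.X =
        (∏ i, ∏ j ∈ Finset.Ioi i, (MvPolynomial.X i - MvPolynomial.X j)) * R := by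
  have key : (∏ p ∈ (Finset.univ : Finset (Fin N)).sigma fun i => Finset.Ioi i,
      (MvPolynomial.X p.1 - MvPolynomial.X p.2 : MvPolynomial (Fin N) ℂ)) ∣
      hlNum (MvPolynomial.C t) lam MvPolynomial.X := by
    refine Finset.prod_dvd_of_isRelPrime ?_ ?_
    · rintro ⟨a, b⟩ hp ⟨c, d⟩ hq hne
      simp only [Finset.coe_sigma, Finset.coe_univ, Set.mem_sigma_iff, Set.mem_univ, true_and,
        Finset.coe_Ioi, Set.mem_Ioi] at hp hq
      refine (X_sub_X_irreducible hp.ne).isRelPrime_iff_not_dvd.2 fun h => ?_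
      have h0 := map_dvd (MvPolynomial.eval
        (fun i : Fin N => if i = a ∨ i = b then (0 : ℂ) else (i : ℕ) + 1)) h
      simp only [map_sub, MvPolynomial.eval_X, true_or, or_true, if_true, sub_self,
        zero_dvd_iff, sub_eq_zero] at h0
      have hcd : (c : ℕ) ≠ d := fun h => hq.ne (Fin.ext h)
      split_ifs at h0 with h1 h2 h2
      · refine hne ?_
        have : c = a ∧ d = b := by
          rcases h1 with rfl | rfl <;> rcases h2 with rfl | rfl
          · exact absurd hq (lt_irrefl _)
          · exact ⟨rfl, rfl⟩
          · exact absurd hq hp.asymm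
          · exact absurd hq (lt_irrefl _)
        rw [this.1, this.2]
      · exact Nat.cast_add_one_ne_zero _ h0.symm
      · exact Nat.cast_add_one_ne_zero _ h0
      · exact hcd (by exact_mod_cast add_right_cancel h0)
    · rintro ⟨a, b⟩ hp
      simp only [Finset.mem_sigma, Finset.mem_univ, true_and, Finset.mem_Ioi] at hp
      exact sub_dvd_hlNum t lam hp.ne
  rw [Finset.prod_sigma] at key
  exact key

/-- The symmetrization `hlSum` is a polynomial in `x_1, …, x_N`. -/
theorem exists_hlR {N : ℕ} (t : ℂ) (lam : Fin N → ℕ) :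
    ∃ R : MvPolynomial (Fin N) ℂ,
      ∀ x : Fin N → ℂ, Function.Injective x → MvPolynomial.eval x R = hlSum t lam x := by
  obtain ⟨R, hR⟩ := exists_hl t lam
  refine ⟨R, fun x hx => ?_⟩
  have h := congrArg (MvPolynomial.eval x) hR
  rw [map_hlNum] at h
  simp only [MvPolynomial.eval_C, MvPolynomial.eval_X, map_mul, map_prod, map_sub] at h
  rw [← hlSum_mul t lam x hx, mul_comm] at h
  refine (mul_left_cancel₀ ?_ h).symm
  refine Finset.prod_ne_zero_iff.2 fun i _ => Finset.prod_ne_zero_iff.2 fun j hj => ?_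
  exact sub_ne_zero.2 fun h => (Finset.mem_Ioi.1 hj).ne (hx h)

/-- The polynomial `R_lam(x_1, …, x_N; t)`: the unique polynomial whose value at every point with
pairwise distinct coordinates is `∑_w w (x^lam ∏_{i<j} (x_i - t x_j) / (x_i - x_j))`. -/
noncomputable def hallLittlewoodR {N : ℕ} (t : ℂ) (lam : Fin N → ℕ) : MvPolynomial (Fin N) ℂ :=
  (exists_hlR t lam).choose

theorem eval_hallLittlewoodR {N : ℕ} (t : ℂ) (lam : Fin N → ℕ) (x : Fin N → ℂ)
    (hx : Function.Injective x) : MvPolynomial.eval x (hallLittlewoodR t lam) = hlSum t lam x :=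
  (exists_hlR t lam).choose_spec x hx

/-- The number `m_k(lam)` of parts equal to `k`. -/
def partMult {N : ℕ} (lam : Fin N → ℕ) (k : ℕ) : ℕ :=
  (Finset.univ.filter fun j => lam j = k).card

/-- The number of odd parts. -/
def oddParts {N : ℕ} (lam : Fin N → ℕ) : ℕ :=
  (Finset.univ.filter fun j => Odd (lam j)).card

/-- The number of even parts; zero parts are counted. -/
def evenParts {N : ℕ} (lam : Fin N → ℕ) : ℕ :=
  (Finset.univ.filter fun j => Even (lam j)).card

/-- `φ_r(t) = (1 - t)(1 - t^2) ⋯ (1 - t^r)`. -/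
def phiT (r : ℕ) (t : ℂ) : ℂ := ∏ j ∈ Finset.Icc 1 r, (1 - t ^ j)

/-- The `t`-factorial `[m]! = [m][m-1] ⋯ [1]` with `[j] = (1 - t^j) / (1 - t)`. -/
noncomputable def tFactorial (t : ℂ) (m : ℕ) : ℂ := ∏ j ∈ Finset.Icc 1 m, (1 - t ^ j) / (1 - t)

/-- `v_lam(t) = ∏_{i ≥ 0} [m_i(lam)]!`; all but finitely many factors are `1`. -/
noncomputable def vT {N : ℕ} (t : ℂ) (lam : Fin N → ℕ) : ℂ :=
  ∏ᶠ i : ℕ, tFactorial t (partMult lam i)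

/-- The Hall--Littlewood polynomial `P_lam(x_1, …, x_N; t)`. -/
noncomputable def hallLittlewood {N : ℕ} (t : ℂ) (lam : Fin N → ℕ) : MvPolynomial (Fin N) ℂ :=
  MvPolynomial.C (1 / vT t lam) * hallLittlewoodR t lam

/-! ### Rogers--Szegő polynomials -/

/-- The `t`-binomial coefficient. -/
noncomputable def tBinomial (t : ℂ) (m i : ℕ) : ℂ :=
  if i ≤ m then tFactorial t m / (tFactorial t (m - i) * tFactorial t i) else 0

/-- The Rogers--Szegő polynomial `H_m(z; t) = ∑_{i=0}^m z^i [m choose i]_t`. -/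
noncomputable def rogersSzego (m : ℕ) (z t : ℂ) : ℂ :=
  ∑ i ∈ Finset.range (m + 1), z ^ i * tBinomial t m i

/-- `∏_i H_{m_{2i}}(αβ; t) · ∏_i H_{m_{2i+1}}(β/α; t) · (-α)^{# odd parts}`, for `α ≠ 0`. -/
noncomputable def oddTerm {N : ℕ} (α β t : ℂ) (lam : Fin N → ℕ) : ℂ :=
  ((∏ᶠ i : ℕ, rogersSzego (partMult lam (2 * i)) (α * β) t) *
    ∏ᶠ i : ℕ, rogersSzego (partMult lam (2 * i + 1)) (β / α) t) * (-α) ^ oddParts lam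

/-- `∏_i H_{m_{2i+1}}(αβ; t) · ∏_i H_{m_{2i}}(β/α; t) · (-α)^{# even parts}`, for `α ≠ 0`. -/
noncomputable def evenTerm {N : ℕ} (α β t : ℂ) (lam : Fin N → ℕ) : ℂ :=
  ((∏ᶠ i : ℕ, rogersSzego (partMult lam (2 * i + 1)) (α * β) t) *
    ∏ᶠ i : ℕ, rogersSzego (partMult lam (2 * i)) (β / α) t) * (-α) ^ evenParts lam

/-- The prefactor `φ_N(t) / (v_lam(t) (1 - t)^N)`, where `N` is the number of parts. -/
noncomputable def prefactor {N : ℕ} (t : ℂ) (lam : Fin N → ℕ) : ℂ :=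
  phiT N t / (vT t lam * (1 - t) ^ N)

/-! ### Densities and integrals over the torus -/

/-- The symmetric Koornwinder density `Δ_K^{(n)}(x; a, b, c, d; t)`. -/
noncomputable def koornwinder {n : ℕ} (a b c d t : ℂ) (x : Fin n → ℂ) : ℂ :=
  1 / (2 ^ n * (n.factorial : ℂ)) *
    (∏ i, ((1 - x i ^ 2) * (1 - (x i)⁻¹ ^ 2)) /
      (((1 - a * x i) * (1 - a * (x i)⁻¹)) * ((1 - b * x i) * (1 - b * (x i)⁻¹)) *
        ((1 - c * x i) * (1 - c * (x i)⁻¹)) * ((1 - d * x i) * (1 - d * (x i)⁻¹)))) *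
    ∏ i, ∏ j ∈ Finset.Ioi i,
      ((1 - x i * x j) * (1 - (x i)⁻¹ * (x j)⁻¹) * (1 - (x i)⁻¹ * x j) * (1 - x i * (x j)⁻¹)) /
      ((1 - t * (x i * x j)) * (1 - t * ((x i)⁻¹ * (x j)⁻¹)) * (1 - t * ((x i)⁻¹ * x j)) *
        (1 - t * (x i * (x j)⁻¹)))

/-- `∏_i (1 - α x_i)(1 - α / x_i)(1 - β x_i)(1 - β / x_i)`. -/
noncomputable def alphaBeta {n : ℕ} (α β : ℂ) (x : Fin n → ℂ) : ℂ :=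
  ∏ i, ((1 - α * x i) * (1 - α * (x i)⁻¹)) * ((1 - β * x i) * (1 - β * (x i)⁻¹))

/-- `∫_T f dT` over the torus `|x_1| = ⋯ = |x_n| = 1`, with `dT = ∏_j dx_j / (2 π √-1 x_j)`. -/
noncomputable def intT {n : ℕ} (f : (Fin n → ℂ) → ℂ) : ℂ :=
  torusIntegral (fun x => (∏ j, 1 / (2 * (Real.pi : ℂ) * Complex.I * x j)) * f x) 0 (fun _ => 1)

/-- Integrability on the torus `|x_1| = ⋯ = |x_n| = 1`. -/
def IntegrableT {n : ℕ} (f : (Fin n → ℂ) → ℂ) : Prop := TorusIntegrable f 0 (fun _ => 1)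

/-- The point `(x_1^{±1}, …, x_n^{±1})`. -/
noncomputable def ptEvenPlus {n : ℕ} (x : Fin n → ℂ) : Fin (n + n) → ℂ := Fin.append x x⁻¹

/-- The point `(x_1^{±1}, …, x_n^{±1}, 1, -1)`. -/
noncomputable def ptEvenMinus {n : ℕ} (x : Fin n → ℂ) : Fin (n + n + 2) → ℂ :=
  Fin.append (Fin.append x x⁻¹) ![1, -1]

/-- The point `(x_1^{±1}, …, x_n^{±1}, e)`. -/
noncomputable def ptOdd {n : ℕ} (e : ℂ) (x : Fin n → ℂ) : Fin (n + n + 1) → ℂ :=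
  Fin.append (Fin.append x x⁻¹) ![e]

/-- The integrand `P_lam(pt(x); t) · w(x) · ∏_i (1 - α x_i^{±1})(1 - β x_i^{±1})`. -/
noncomputable def integrand {n N : ℕ} (pt : (Fin n → ℂ) → Fin N → ℂ) (w : (Fin n → ℂ) → ℂ)
    (α β t : ℂ) (lam : Fin N → ℕ) (x : Fin n → ℂ) : ℂ :=
  MvPolynomial.eval (pt x) (hallLittlewood t lam) * w x * alphaBeta α β x

/-!
The polynomial `P_lam` is a symmetrized word: up to a constant it is the sum over all orderings
`z_1, …, z_N` of the variables of `∏ f_p(z_p) ∏_{p < q} (z_p - t z_q) / (z_p - z_q)`, with letters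
`f_p(z) = z^{lam_p}`. The factors `(1 - α z)(1 - β z)` can be absorbed into the letters, so each of
the four identities is about the integral of a symmetrized word in the symbols `x_i^{±1}`, together
with some of the signs `1`, `-1`, against the Koornwinder density.

*Integration.* A single term of the symmetrization has poles at `x_i = x_j^{±1}` and `x_i = ±1`, on
the unit torus itself. The full integrand has none of them, so the torus is first replaced by the
mean of circles of radii `r_i` and `r_i⁻¹`, with distinct `r_i < 1` close to `1`
(`integral_torus_eq_circPair`). In a term whose first symbol is `v = x_i^{±1}`, the symbol `v⁻¹`
comes in some later place `k`. The density of `x_i` cancels all poles and zeros that involve `v` and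
another symbol, except that each letter between the first and the `k`-th one acquires a factor
`kern t v` (`hlWord_first_pair`). If `z f(z) g(z⁻¹)` is holomorphic in a disc for any two letters
`f`, `g` in this order, then the integral over `v` is a residue computation that only sees the values
at `v = ±1`, the contribution of the pole on the unit circle being averaged (`integral_div_sub_inv`).
As `kern t (±1)` has the values `±1` at `±1`, the sum over `k` telescopes, and by induction the
integral of a word is a multiple of `∏ (f(1) + f(-1)) ± ∏ (f(1) - f(-1))` (`integral_hlWord`). These
two products lead to the two summands on the right hand side.

*The parameters.* The condition on pairs of letters holds for `z^a (1 - α z)` with weakly decreasing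
exponents `a`, as the factor `z` makes up for the simple pole. The factors `1 - β z` are expanded,
and raise exponents by one; words that are no longer decreasing are sorted by the straightening rule
`(…, z^a, z^{a+1}, …) = t (…, z^{a+1}, z^a, …)` (`hlWord_straighten`). For the letters with the same
exponent, this produces the recursion of the Rogers--Szegő polynomials (`raiseSum_eq`).

*Normalization.* The word with all letters equal to `1` is the constant `[N]!` (`hlWord_one`), so the
integral of the density is a special case.
-/

open MeasureTheory Metric

/-! ### Symmetrized words -/

/-- The sum, over all orderings `i₁, …, i_N` of `s`, of
`∏ p, f_p (x i_p) * ∏ p < q, (x i_p - t x i_q) / (x i_p - x i_q)`, built by choosing the first index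
and recursing. The list `[f₁, …, f_N]` is meant to have as many entries as `s` has elements. -/
noncomputable def hlWord {ι : Type*} [DecidableEq ι] (t : ℂ) (x : ι → ℂ) :
    List (ℂ → ℂ) → Finset ι → ℂ
  | [], _ => 1
  | f :: fs, s => ∑ i ∈ s, f (x i) * (∏ j ∈ s.erase i, (x i - t * x j) / (x i - x j)) *
      hlWord t x fs (s.erase i)

section Words

variable {ι : Type*} [DecidableEq ι] {t : ℂ} {x : ι → ℂ}

theorem hlWord_congr {L L' : List (ℂ → ℂ)} {s : Finset ι}
    (h : List.Forall₂ (fun f g : ℂ → ℂ => ∀ j ∈ s, f (x j) = g (x j)) L L') :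
    hlWord t x L s = hlWord t x L' s := by
  induction L generalizing L' s with
  | nil => cases h; rfl
  | cons f fs ih =>
    cases h with
    | @cons _ g _ gs h1 h2 =>
      simp only [hlWord]
      refine Finset.sum_congr rfl fun i hi => ?_
      rw [h1 i hi, ih (h2.imp fun _ _ h j hj => h j (Finset.mem_of_mem_erase hj))]

theorem hlWord_map_mul (g : ℂ → ℂ) (L : List (ℂ → ℂ)) (s : Finset ι) (h : L.length = s.card) :
    hlWord t x (L.map (· * g)) s = (∏ i ∈ s, g (x i)) * hlWord t x L s := by
  induction L generalizing s with
  | nil =>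
    have : s = ∅ := Finset.card_eq_zero.1 h.symm
    simp [hlWord, this]
  | cons f fs ih =>
    simp only [hlWord, List.map_cons, Pi.mul_apply, Finset.mul_sum]
    refine Finset.sum_congr rfl fun i hi => ?_
    rw [ih _ (by rw [Finset.card_erase_of_mem hi, ← h]; simp), ← Finset.mul_prod_erase s _ hi]
    ring

/-- Expansion of a symmetrized word according to the position `k` taken by a given index `p`. -/
theorem hlWord_insert {p : ι} (L : List (ℂ → ℂ)) (s : Finset ι) (hp : p ∉ s)
    (h : L.length = s.card + 1) :
    hlWord t x L (insert p s) = ∑ k ∈ Finset.range L.length, L.getD k 0 (x p) *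
      hlWord t x ((L.take k).map (· * fun z => (z - t * x p) / (z - x p)) ++
        (L.drop (k + 1)).map (· * fun z => (x p - t * z) / (x p - z))) s := by
  induction L generalizing s with
  | nil => simp at h
  | cons f fs ih =>
    have hl : fs.length = s.card := by simpa using h
    rw [List.length_cons, Finset.sum_range_succ']
    simp only [List.getD_cons_zero, List.take_zero, List.map_nil, List.nil_append, zero_add,
      List.drop_succ_cons, List.drop_zero, List.getD_cons_succ, List.take_succ_cons, List.map_cons,
      List.cons_append, hlWord]
    rw [Finset.sum_insert hp, hlWord_map_mul _ _ _ hl, Finset.erase_insert hp, add_comm]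
    congr 1
    · simp only [Finset.mul_sum]
      rw [Finset.sum_comm]
      refine Finset.sum_congr rfl fun i hi => ?_
      have hpi : i ≠ p := fun h => hp (h ▸ hi)
      have hps : p ∉ s.erase i := fun h => hp (Finset.mem_of_mem_erase h)
      rw [Finset.erase_insert_of_ne hpi.symm, Finset.prod_insert hps,
        ih _ hps (by rw [Finset.card_erase_add_one hi, hl]), Finset.mul_sum]
      refine Finset.sum_congr rfl fun k _ => ?_
      simp only [Pi.mul_apply]
      ring
    · ring

theorem hlWord_image {κ : Type*} [DecidableEq κ] (e : κ → ι) (he : Function.Injective e)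
    (L : List (ℂ → ℂ)) (s : Finset κ) :
    hlWord t (x ∘ e) L s = hlWord t x L (s.image e) := by
  induction L generalizing s with
  | nil => rfl
  | cons f fs ih =>
    simp only [hlWord]
    rw [Finset.sum_image he.injOn]
    refine Finset.sum_congr rfl fun i hi => ?_
    rw [ih, ← Finset.image_erase he, Finset.prod_image he.injOn]
    rfl

theorem sum_eq_mul_sum_of_symm {s : Finset ι} (c : ℂ) (a b : ι → ι → ℂ)
    (h : ∀ i ∈ s, ∀ j ∈ s, i ≠ j → a i j + a j i = c * (b i j + b j i)) :
    ∑ i ∈ s, ∑ j ∈ s.erase i, a i j = c * ∑ i ∈ s, ∑ j ∈ s.erase i, b i j := by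
  have hsw : ∀ a : ι → ι → ℂ, ∑ i ∈ s, ∑ j ∈ s.erase i, a i j =
      ∑ i ∈ s, ∑ j ∈ s.erase i, a j i := by
    intro a
    refine Finset.sum_comm' fun i j => ?_
    simp only [Finset.mem_erase]
    tauto
  have h2 : ∀ a : ι → ι → ℂ, 2 * ∑ i ∈ s, ∑ j ∈ s.erase i, a i j =
      ∑ i ∈ s, ∑ j ∈ s.erase i, (a i j + a j i) := by
    intro a
    simp only [Finset.sum_add_distrib]
    rw [← hsw a]; ring
  refine mul_left_cancel₀ (two_ne_zero (α := ℂ)) ?_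
  rw [h2, mul_left_comm, h2, Finset.mul_sum]
  refine Finset.sum_congr rfl fun i hi => ?_
  rw [Finset.mul_sum]
  refine Finset.sum_congr rfl fun j hj => ?_
  rw [Finset.mem_erase] at hj
  exact h i hi j hj.2 hj.1.symm

/-- The straightening rule for two adjacent letters that differ by a factor `z`. -/
theorem hlWord_straighten (pre post : List (ℂ → ℂ)) (g : ℂ → ℂ) (s : Finset ι)
    (hx : Set.InjOn x s) :
    hlWord t x (pre ++ g :: (fun z => z * g z) :: post) s =
      t * hlWord t x (pre ++ (fun z => z * g z) :: g :: post) s := by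
  induction pre generalizing s with
  | nil =>
    have hm := fun (i : ι) (f : ι → ℂ) (b : ℂ) => Finset.mul_sum (s.erase i) f b
    simp only [List.nil_append, hlWord, hm]
    refine sum_eq_mul_sum_of_symm t _ _ fun i hi j hj hij => ?_
    have hne : x i - x j ≠ 0 := sub_ne_zero.2 fun h => hij (hx hi hj h)
    have hne' : x j - x i ≠ 0 := sub_ne_zero.2 fun h => hij (hx hi hj h.symm)
    have hji : j ∈ s.erase i := Finset.mem_erase.2 ⟨hij.symm, hj⟩
    have hij' : i ∈ s.erase j := Finset.mem_erase.2 ⟨hij, hi⟩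
    rw [← Finset.mul_prod_erase _ _ hji, ← Finset.mul_prod_erase _ _ hij',
      Finset.erase_right_comm (a := j) (b := i)]
    generalize hlWord t x post _ = W
    generalize ∏ k ∈ (s.erase i).erase j, (x i - t * x k) / (x i - x k) = A
    generalize ∏ k ∈ (s.erase i).erase j, (x j - t * x k) / (x j - x k) = B
    have e : (x j - t * x i) / (x j - x i) = -((x j - t * x i) / (x i - x j)) := by
      rw [← div_neg, neg_sub]
    rw [e]
    field_simp
    ring
  | cons f fs ih =>
    simp only [List.cons_append, hlWord]
    rw [Finset.mul_sum]
    refine Finset.sum_congr rfl fun i hi => ?_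
    rw [ih _ (hx.mono (Finset.coe_subset.2 (Finset.erase_subset _ _)))]
    ring

theorem hlWord_linear (pre post : List (ℂ → ℂ)) (f g : ℂ → ℂ) (c : ℂ) (s : Finset ι) :
    hlWord t x (pre ++ (fun z => f z + c * g z) :: post) s =
      hlWord t x (pre ++ f :: post) s + c * hlWord t x (pre ++ g :: post) s := by
  induction pre generalizing s with
  | nil =>
    simp only [List.nil_append, hlWord]
    rw [Finset.mul_sum, ← Finset.sum_add_distrib]
    exact Finset.sum_congr rfl fun i hi => by ring
  | cons f fs ih =>
    simp only [List.cons_append, hlWord]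
    rw [Finset.mul_sum, ← Finset.sum_add_distrib]
    exact Finset.sum_congr rfl fun i hi => by rw [ih]; ring

/-- Partial fractions: `∑_i ∏_{j ≠ i} (x_i - t x_j) / (x_i - x_j) = (1 - t^N) / (1 - t)`. -/
theorem sum_prod_sub_div (ht : t ≠ 1) (s : Finset ι) (hx : Set.InjOn x s)
    (h0 : ∀ i ∈ s, x i ≠ 0) :
    ∑ i ∈ s, ∏ j ∈ s.erase i, (x i - t * x j) / (x i - x j) = (1 - t ^ s.card) / (1 - t) := by
  open Polynomial in
  rcases s.eq_empty_or_nonempty with rfl | hs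
  · simp
  have ht' : 1 - t ≠ 0 := sub_ne_zero.2 ht.symm
  set P : ℂ[X] := ∏ j ∈ s, (X - C (t * x j)) - C (t ^ s.card) * ∏ j ∈ s, (X - C (x j)) with hP
  have hP0 : P.coeff 0 = 0 := by
    rw [Polynomial.coeff_zero_eq_eval_zero]
    simp [hP, Polynomial.eval_prod, ← mul_neg, Finset.prod_mul_distrib]
  have hdeg : P.natDegree ≤ s.card := by
    refine (Polynomial.natDegree_sub_le _ _).trans (max_le ?_ ?_)
    · rw [Polynomial.natDegree_prod_of_monic _ _ fun i _ => Polynomial.monic_X_sub_C _]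
      simp only [Polynomial.natDegree_X_sub_C, Finset.sum_const, smul_eq_mul, mul_one, le_refl]
    · refine (Polynomial.natDegree_C_mul_le _ _).trans ?_
      rw [Polynomial.natDegree_prod_of_monic _ _ fun i _ => Polynomial.monic_X_sub_C _]
      simp
  have hc : ∀ y : ι → ℂ, (∏ j ∈ s, (X - C (y j))).coeff s.card = 1 := by
    intro y
    have hm : (∏ j ∈ s, (X - C (y j))).Monic :=
      Polynomial.monic_prod_of_monic _ _ fun i _ => Polynomial.monic_X_sub_C _
    have hd : (∏ j ∈ s, (X - C (y j))).natDegree = s.card := by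
      rw [Polynomial.natDegree_prod_of_monic _ _ fun i _ => Polynomial.monic_X_sub_C _]
      simp
    rw [← hd]; exact hm
  have hlead : P.coeff s.card = 1 - t ^ s.card := by
    rw [hP, Polynomial.coeff_sub, Polynomial.coeff_C_mul, hc, hc, mul_one]
  have hq : P.divX.coeff (s.card - 1) = 1 - t ^ s.card := by
    rw [Polynomial.coeff_divX, Nat.sub_add_cancel hs.card_pos, hlead]
  have hqd : P.divX.degree < s.card := by
    rw [Polynomial.degree_lt_iff_coeff_zero]
    intro m hm
    rw [Polynomial.coeff_divX]
    exact Polynomial.coeff_eq_zero_of_natDegree_lt (by omega)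
  have key := Lagrange.coeff_eq_sum hx hqd
  rw [hq] at key
  rw [key, Finset.sum_div]
  refine Finset.sum_congr rfl fun i hi => ?_
  have hev : P.divX.eval (x i) * x i = ∏ j ∈ s, (x i - t * x j) := by
    have h1 := congrArg (Polynomial.eval (x i)) (Polynomial.divX_mul_X_add P)
    rw [hP0] at h1
    simp only [Polynomial.eval_mul, Polynomial.eval_X, map_zero, add_zero] at h1
    rw [h1, hP]
    simp only [Polynomial.eval_sub, Polynomial.eval_mul, Polynomial.eval_prod, Polynomial.eval_X,
      Polynomial.eval_C]
    rw [Finset.prod_eq_zero (f := fun j => x i - x j) hi (sub_self _), mul_zero, sub_zero]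
  rw [← Finset.mul_prod_erase s _ hi] at hev
  have hxi := h0 i hi
  rw [Finset.prod_div_distrib]
  have h3 : P.divX.eval (x i) = (1 - t) * ∏ j ∈ s.erase i, (x i - t * x j) := by
    refine mul_right_cancel₀ hxi ?_
    rw [hev]; ring
  rw [h3]
  field_simp

theorem hlWord_one (ht : t ≠ 1) (s : Finset ι) (hx : Set.InjOn x s) (h0 : ∀ i ∈ s, x i ≠ 0) :
    hlWord t x (List.replicate s.card fun _ => 1) s = tFactorial t s.card := by
  generalize hN : s.card = N
  induction N generalizing s with
  | zero => simp [hlWord, tFactorial]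
  | succ N ih =>
    simp only [List.replicate_succ, hlWord, one_mul]
    have h1 := sum_prod_sub_div ht s hx h0
    rw [Finset.sum_congr rfl fun i hi => by
      rw [ih (s.erase i) (hx.mono (Finset.coe_subset.2 (Finset.erase_subset _ _)))
        (fun j hj => h0 j (Finset.mem_of_mem_erase hj))
        (by rw [Finset.card_erase_of_mem hi, hN]; rfl)], ← Finset.sum_mul, h1, hN]
    rw [tFactorial, tFactorial, ← Finset.insert_Icc_right_eq_Icc_add_one (by omega),
      Finset.prod_insert (by simp)]

end Words

/-- The sum over permutations that defines the Hall--Littlewood polynomial is a symmetrized word. -/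
theorem hlSum_eq_hlWord {N : ℕ} (t : ℂ) (f : Fin N → ℂ → ℂ) (x : Fin N → ℂ) :
    ∑ w : Equiv.Perm (Fin N), (∏ i, f i (x (w i))) *
      ∏ i, ∏ j ∈ Finset.Ioi i, (x (w i) - t * x (w j)) / (x (w i) - x (w j)) =
    hlWord t x (List.ofFn f) Finset.univ := by
  induction N with
  | zero => simp [hlWord]
  | succ N ih =>
    rw [← Equiv.Perm.decomposeFin.symm.sum_comp, Fintype.sum_prod_type]
    simp only [List.ofFn_succ, hlWord]
    refine Finset.sum_congr rfl fun p _ => ?_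
    set e : Fin N → Fin (N + 1) := fun j => Equiv.swap 0 p j.succ with he
    have hinj : Function.Injective e := fun a b h =>
      Fin.succ_injective _ ((Equiv.swap 0 p).injective h)
    have himg : Finset.univ.image e = Finset.univ.erase p := by
      refine Finset.eq_of_subset_of_card_le ?_ ?_
      · intro j hj
        obtain ⟨k, -, rfl⟩ := Finset.mem_image.1 hj
        refine Finset.mem_erase.2 ⟨fun h => ?_, Finset.mem_univ _⟩
        have h2 : Equiv.swap 0 p k.succ = Equiv.swap 0 p 0 := by
          rw [Equiv.swap_apply_left]; exact h
        exact Fin.succ_ne_zero k ((Equiv.swap 0 p).injective h2)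
      · rw [Finset.card_image_of_injective _ hinj, Finset.card_erase_of_mem (Finset.mem_univ _)]
        simp
    rw [← himg, ← hlWord_image e hinj, ← ih, Finset.mul_sum, Finset.prod_image hinj.injOn]
    refine Finset.sum_congr rfl fun w _ => ?_
    have hsucc : ∀ j : Fin N, Equiv.Perm.decomposeFin.symm (p, w) j.succ = e (w j) := by
      intro j; simp [he]
    have h0 : Equiv.Perm.decomposeFin.symm (p, w) 0 = p := by simp
    rw [Fin.prod_univ_succ, Fin.prod_univ_succ, h0, Fin.prod_Ioi_zero]
    simp only [hsucc, Fin.prod_Ioi_succ, Function.comp]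
    rw [← Equiv.prod_comp w (fun j => (x p - t * x (e j)) / (x p - x (e j)))]
    ring

/-! ### Averages over circles and tori -/

/-- Lebesgue measure on `[0, 2π]`, normalized to total mass `1`. -/
noncomputable def angleMeasure : Measure ℝ :=
  (ENNReal.ofReal (2 * Real.pi))⁻¹ • volume.restrict (Set.Icc 0 (2 * Real.pi))

theorem ofReal_two_pi_ne_zero : ENNReal.ofReal (2 * Real.pi) ≠ 0 := by
  simpa using Real.pi_pos

instance : IsProbabilityMeasure angleMeasure := by
  constructor
  simp only [angleMeasure, Measure.smul_apply, Measure.restrict_apply_univ, Real.volume_Icc,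
    sub_zero, smul_eq_mul]
  exact ENNReal.inv_mul_cancel ofReal_two_pi_ne_zero ENNReal.ofReal_ne_top

/-- The rotation invariant probability measure on the circle `|z| = r`, as a measure on `ℂ`. -/
noncomputable def circ (r : ℝ) : Measure ℂ := angleMeasure.map (circleMap 0 r)

/-- The mean of the rotation invariant probability measures on the circles of radii `r` and
`r⁻¹`. It is invariant under `z ↦ z⁻¹`, and integration against it is a substitute for a principal
value on the unit circle. -/
noncomputable def circPair (r : ℝ) : Measure ℂ := (2⁻¹ : ENNReal) • (circ r + circ r⁻¹)

instance (r : ℝ) : IsProbabilityMeasure (circ r) :=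
  Measure.isProbabilityMeasure_map (continuous_circleMap 0 r).aemeasurable

instance (r : ℝ) : IsProbabilityMeasure (circPair r) := by
  constructor
  simp only [circPair, Measure.smul_apply, Measure.add_apply, measure_univ, smul_eq_mul]
  rw [one_add_one_eq_two]
  exact ENNReal.inv_mul_cancel two_ne_zero (by simp)

theorem ae_circ (r : ℝ) : ∀ᵐ z ∂circ r, z ∈ sphere (0 : ℂ) |r| := by
  rw [circ, ae_map_iff (p := (· ∈ sphere (0 : ℂ) |r|)) (continuous_circleMap 0 r).aemeasurable
    isClosed_sphere.measurableSet]
  exact Filter.Eventually.of_forall fun θ => circleMap_mem_sphere' 0 r θ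

theorem ae_circPair {r : ℝ} (hr : 0 < r) :
    ∀ᵐ z ∂circPair r, z ∈ sphere (0 : ℂ) r ∪ sphere (0 : ℂ) r⁻¹ := by
  have h : ∀ᵐ z ∂(circ r + circ r⁻¹), z ∈ sphere (0 : ℂ) r ∪ sphere (0 : ℂ) r⁻¹ := by
    rw [ae_add_measure_iff]
    constructor
    · filter_upwards [ae_circ r] with z hz
      rw [abs_of_pos hr] at hz; exact Or.inl hz
    · filter_upwards [ae_circ r⁻¹] with z hz
      rw [abs_of_pos (inv_pos.2 hr)] at hz; exact Or.inr hz
  exact Measure.ae_smul_measure h _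

theorem integrable_of_continuousOn {X : Type*} [TopologicalSpace X] [MeasurableSpace X]
    [OpensMeasurableSpace X] [T2Space X] {π : Measure X} [IsFiniteMeasure π] {C : Set X}
    (hC : IsCompact C) (hae : ∀ᵐ x ∂π, x ∈ C) {F : X → ℂ} (hF : ContinuousOn F C) :
    Integrable F π := by
  have h := hF.integrableOn_of_subset_isCompact hC hC.measurableSet subset_rfl (μ := π)
  rw [IntegrableOn, Measure.restrict_eq_self_of_ae_mem hae] at h
  exact h (measure_ne_top π C)

theorem integral_circ {r : ℝ} {h : ℂ → ℂ} (hh : AEStronglyMeasurable h (circ r)) :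
    ∫ z, h z ∂circ r = Real.circleAverage h 0 r := by
  rw [circ, integral_map (continuous_circleMap 0 r).aemeasurable hh, angleMeasure,
    integral_smul_measure, Real.circleAverage_def,
    intervalIntegral.integral_of_le (by positivity), integral_Icc_eq_integral_Ioc]
  rw [ENNReal.toReal_inv, ENNReal.toReal_ofReal (by positivity)]

theorem integral_circPair {r : ℝ} (hr : 0 < r) {h : ℂ → ℂ}
    (hh : ContinuousOn h (sphere (0 : ℂ) r ∪ sphere (0 : ℂ) r⁻¹)) :
    ∫ z, h z ∂circPair r = (Real.circleAverage h 0 r + Real.circleAverage h 0 r⁻¹) / 2 := by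
  have h1 : Integrable h (circ r) := integrable_of_continuousOn (isCompact_sphere 0 |r|) (ae_circ r)
    (hh.mono (by rw [abs_of_pos hr]; exact Set.subset_union_left))
  have h2 : Integrable h (circ r⁻¹) :=
    integrable_of_continuousOn (isCompact_sphere 0 |r⁻¹|) (ae_circ r⁻¹)
      (hh.mono (by rw [abs_of_pos (inv_pos.2 hr)]; exact Set.subset_union_right))
  rw [circPair, integral_smul_measure, integral_add_measure h1 h2,
    integral_circ h1.aestronglyMeasurable, integral_circ h2.aestronglyMeasurable]
  simp; ring

theorem circleAverage_inv (h : ℂ → ℂ) (r : ℝ) :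
    Real.circleAverage (fun z => h z⁻¹) 0 r = Real.circleAverage h 0 r⁻¹ := by
  rw [Real.circleAverage_eq_circleAverage_zero_one,
    Real.circleAverage_eq_circleAverage_zero_one (R := r⁻¹),
    ← Real.circleAverage_zero_one_congr_inv (f := fun z => h (((r⁻¹ : ℝ) : ℂ) * z + 0))]
  congr 1
  ext z
  simp [mul_comm]

theorem inv_mem_spheres {r : ℝ} {z : ℂ} (hz : z ∈ sphere (0 : ℂ) r ∪ sphere (0 : ℂ) r⁻¹) :
    z⁻¹ ∈ sphere (0 : ℂ) r ∪ sphere (0 : ℂ) r⁻¹ := by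
  simp only [Set.mem_union, mem_sphere_zero_iff_norm, norm_inv] at hz ⊢
  rcases hz with h | h
  · right; rw [h]
  · left; rw [h, inv_inv]

theorem ne_zero_of_mem_spheres {r : ℝ} (hr : 0 < r) {z : ℂ}
    (hz : z ∈ sphere (0 : ℂ) r ∪ sphere (0 : ℂ) r⁻¹) : z ≠ 0 := by
  rintro rfl
  simp only [Set.mem_union, mem_sphere_zero_iff_norm, norm_zero] at hz
  rcases hz with h | h
  · exact hr.ne h
  · exact (inv_pos.2 hr).ne h

theorem sub_inv_ne_zero_of_mem_spheres {r : ℝ} (hr : 0 < r) (hr1 : r < 1) {z : ℂ}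
    (hz : z ∈ sphere (0 : ℂ) r ∪ sphere (0 : ℂ) r⁻¹) : z - z⁻¹ ≠ 0 := by
  have h0 := ne_zero_of_mem_spheres hr hz
  intro h
  have h1 : z * z = 1 := by
    have := congrArg (· * z) (sub_eq_zero.1 h)
    simpa [h0] using this
  have h2 : ‖z‖ * ‖z‖ = 1 := by rw [← norm_mul, h1, norm_one]
  have hi : 1 < r⁻¹ := (one_lt_inv₀ hr).2 hr1
  simp only [Set.mem_union, mem_sphere_zero_iff_norm] at hz
  rcases hz with h | h <;> rw [h] at h2 <;> nlinarith

theorem integral_circPair_inv {r : ℝ} (hr : 0 < r) {h : ℂ → ℂ}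
    (hh : ContinuousOn h (sphere (0 : ℂ) r ∪ sphere (0 : ℂ) r⁻¹)) :
    ∫ z, h z⁻¹ ∂circPair r = ∫ z, h z ∂circPair r := by
  have hinv : ContinuousOn (fun z : ℂ => h z⁻¹) (sphere (0 : ℂ) r ∪ sphere (0 : ℂ) r⁻¹) :=
    hh.comp (continuousOn_inv₀.mono fun z hz => ne_zero_of_mem_spheres hr hz)
      fun z hz => inv_mem_spheres hz
  rw [integral_circPair hr hh, integral_circPair hr hinv, circleAverage_inv, circleAverage_inv,
    inv_inv, add_comm]

/-- With respect to `circPair r`, only the values at `±1` of a function `h` holomorphic on a disc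
of radius larger than `r⁻¹` contribute to the integral of `h z / (z - z⁻¹)`: writing
`h z = a + b z + (z² - 1) g z`, the first two terms are handled by the symmetry `z ↦ z⁻¹` and the
last one by the mean value property of `z g z`. -/
theorem integral_div_sub_inv {r ρ : ℝ} (hr : 0 < r) (hr1 : r < 1) (hρ : r⁻¹ < ρ) {h : ℂ → ℂ}
    (hh : DifferentiableOn ℂ h (ball 0 ρ)) :
    ∫ z, h z / (z - z⁻¹) ∂circPair r = (h 1 - h (-1)) / 4 := by
  have hi : 1 < r⁻¹ := (one_lt_inv₀ hr).2 hr1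
  have m1 : ball (0 : ℂ) ρ ∈ nhds 1 := isOpen_ball.mem_nhds (by simp; linarith)
  have m2 : ball (0 : ℂ) ρ ∈ nhds (-1) := isOpen_ball.mem_nhds (by simp; linarith)
  set h1 := dslope h 1 with hh1
  set g := dslope h1 (-1) with hg
  have hgd : DifferentiableOn ℂ g (ball 0 ρ) :=
    (Complex.differentiableOn_dslope m2).2 ((Complex.differentiableOn_dslope m1).2 hh)
  have e1 : ∀ z, h z = h 1 + (z - 1) * h1 z := fun z => by
    rw [hh1, ← smul_eq_mul, sub_smul_dslope]; ring
  have e2 : ∀ z, h1 z = h1 (-1) + (z + 1) * g z := fun z => by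
    have := sub_smul_dslope h1 (-1) z
    rw [sub_neg_eq_add, smul_eq_mul, ← hg] at this
    rw [this]; ring
  have hb : h1 (-1) = (h 1 - h (-1)) / 2 := by
    have := e1 (-1)
    linear_combination (1 / 2 : ℂ) * this
  set S := sphere (0 : ℂ) r ∪ sphere (0 : ℂ) r⁻¹ with hS
  have hSb : S ⊆ ball 0 ρ := by
    rintro z (hz | hz) <;> rw [mem_sphere_zero_iff_norm] at hz <;>
      rw [mem_ball_zero_iff, hz] <;> linarith
  have hSc : IsCompact S := (isCompact_sphere 0 r).union (isCompact_sphere 0 r⁻¹)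
  have hinvc : ContinuousOn (fun z : ℂ => z⁻¹) S :=
    continuousOn_inv₀.mono fun z hz => ne_zero_of_mem_spheres hr hz
  have hden : ContinuousOn (fun z : ℂ => z - z⁻¹) S := continuousOn_id.sub hinvc
  have hdne : ∀ z ∈ S, z - z⁻¹ ≠ 0 := fun z hz => sub_inv_ne_zero_of_mem_spheres hr hr1 hz
  set F : ℂ → ℂ := fun z => (h 1 + (z - 1) * h1 (-1)) / (z - z⁻¹) with hF
  have hFc : ContinuousOn F S := ContinuousOn.div (by fun_prop) hden hdne
  have hgc : ContinuousOn (fun z => z * g z) S :=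
    continuousOn_id.mul (hgd.continuousOn.mono hSb)
  have hFinvc : ContinuousOn (fun z => F z⁻¹) S := hFc.comp hinvc fun z hz => inv_mem_spheres hz
  have hFi := integrable_of_continuousOn hSc (ae_circPair hr) hFc
  have hgi := integrable_of_continuousOn hSc (ae_circPair hr) hgc
  have hFinvi := integrable_of_continuousOn hSc (ae_circPair hr) hFinvc
  have hsplit : ∫ z, h z / (z - z⁻¹) ∂circPair r =
      ∫ z, (F z + z * g z) ∂circPair r := by
    refine integral_congr_ae ?_
    filter_upwards [ae_circPair hr] with z hz
    have := hdne z hz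
    have h0 := ne_zero_of_mem_spheres hr hz
    have e3 : z * g z * (z - z⁻¹) = (z ^ 2 - 1) * g z := by field_simp
    simp only [hF]
    rw [e1 z, e2 z, div_add' _ _ _ this, e3]
    congr 1
    ring
  have hmean : ∀ R, 0 < R → R < ρ → Real.circleAverage (fun z => z * g z) 0 R = 0 := by
    intro R hR0 hR
    have hsub : closedBall (0 : ℂ) |R| ⊆ ball 0 ρ := by
      rw [abs_of_pos hR0]; exact closedBall_subset_ball hR
    have hd : DifferentiableOn ℂ (fun z => z * g z) (ball 0 ρ) := differentiableOn_id.mul hgd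
    rw [circleAverage_of_differentiable_on_off_countable (s := ∅) Set.countable_empty
      (hd.continuousOn.mono hsub) fun z hz =>
        hd.differentiableAt (isOpen_ball.mem_nhds (hsub (ball_subset_closedBall hz.1)))]
    simp
  have hG : ∫ z, z * g z ∂circPair r = 0 := by
    rw [integral_circPair hr hgc, hmean r hr (by linarith), hmean r⁻¹ (by linarith) hρ]
    simp
  have hFF : ∫ z, F z ∂circPair r + ∫ z, F z ∂circPair r = h1 (-1) := by
    nth_rewrite 2 [← integral_circPair_inv hr hFc]
    rw [← integral_add hFi hFinvi]
    rw [integral_congr_ae (g := fun _ => h1 (-1))]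
    · simp
    · filter_upwards [ae_circPair hr] with z hz
      have := hdne z hz
      have h0 := ne_zero_of_mem_spheres hr hz
      have hz2 : z ^ 2 - 1 ≠ 0 := by
        intro h; apply this; field_simp; rw [h, mul_zero]
      have e3 : z⁻¹ - z⁻¹⁻¹ = -(z - z⁻¹) := by rw [inv_inv]; ring
      simp only [hF]
      rw [e3]
      field_simp
      ring
  rw [hsplit, integral_add hFi hgi, hG, add_zero]
  linear_combination (1 / 2 : ℂ) * hFF + (1 / 2 : ℂ) * hb

/-! ### Product measures -/

theorem map_update_prod_pi {ι : Type*} [Fintype ι] [DecidableEq ι] {μ μ' : ι → Measure ℂ}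
    [∀ i, IsProbabilityMeasure (μ i)] [∀ i, IsProbabilityMeasure (μ' i)] (i : ι)
    (h : ∀ j, j ≠ i → μ j = μ' j) :
    ((μ i).prod (Measure.pi μ')).map (fun p => Function.update p.2 i p.1) = Measure.pi μ := by
  have hm : Measurable (fun p : ℂ × (ι → ℂ) => Function.update p.2 i p.1) := by
    refine measurable_pi_lambda _ fun j => ?_
    rcases eq_or_ne j i with rfl | hj
    · simpa using measurable_fst
    · simpa [hj, Function.comp_def] using (measurable_pi_apply j).comp measurable_snd
  refine (Measure.pi_eq fun s hs => ?_).symm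
  rw [Measure.map_apply hm (MeasurableSet.univ_pi hs)]
  have hpre : (fun p : ℂ × (ι → ℂ) => Function.update p.2 i p.1) ⁻¹' Set.univ.pi s =
      s i ×ˢ Set.univ.pi (Function.update s i Set.univ) := by
    ext ⟨u, x⟩
    simp only [Set.mem_preimage, Set.mem_pi, Set.mem_univ, true_implies, Set.mem_prod]
    constructor
    · intro H
      refine ⟨by simpa using H i, fun j => ?_⟩
      rcases eq_or_ne j i with rfl | hj
      · simp
      · simpa [hj] using H j
    · rintro ⟨H1, H2⟩ j
      rcases eq_or_ne j i with rfl | hj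
      · simpa using H1
      · simpa [hj] using H2 j
  rw [hpre, Measure.prod_prod, Measure.pi_pi, ← Finset.mul_prod_erase _ _ (Finset.mem_univ i),
    ← Finset.mul_prod_erase Finset.univ _ (Finset.mem_univ i)]
  simp only [Function.update_self, measure_univ, one_mul]
  congr 1
  refine Finset.prod_congr rfl fun j hj => ?_
  rw [Function.update_of_ne (Finset.ne_of_mem_erase hj), h j (Finset.ne_of_mem_erase hj)]

/-- The `i`-th coordinate can be integrated first; the outer measure may have any probability
measure as its `i`-th factor. -/
theorem integral_pi_update {ι : Type*} [Fintype ι] [DecidableEq ι] {μ μ' : ι → Measure ℂ}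
    [∀ i, IsProbabilityMeasure (μ i)] [∀ i, IsProbabilityMeasure (μ' i)] (i : ι)
    (h : ∀ j, j ≠ i → μ j = μ' j) {F : (ι → ℂ) → ℂ} (hF : Integrable F (Measure.pi μ)) :
    ∫ x, F x ∂Measure.pi μ = ∫ x, ∫ u, F (Function.update x i u) ∂μ i ∂Measure.pi μ' := by
  have hm : Measurable (fun p : ℂ × (ι → ℂ) => Function.update p.2 i p.1) := by
    refine measurable_pi_lambda _ fun j => ?_
    rcases eq_or_ne j i with rfl | hj
    · simpa using measurable_fst
    · simpa [hj, Function.comp_def] using (measurable_pi_apply j).comp measurable_snd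
  have hmap := map_update_prod_pi i h
  rw [← hmap] at hF ⊢
  rw [integral_map hm.aemeasurable hF.aestronglyMeasurable]
  exact integral_prod_symm _ (hF.comp_measurable hm)

theorem ae_pi_mem {ι : Type*} [Fintype ι] {μ : ι → Measure ℂ} [∀ i, IsProbabilityMeasure (μ i)]
    {S : ι → Set ℂ} (h : ∀ i, ∀ᵐ z ∂μ i, z ∈ S i) :
    ∀ᵐ x ∂Measure.pi μ, x ∈ Set.univ.pi S := by
  have : ∀ᵐ x ∂Measure.pi μ, ∀ i, x i ∈ S i :=
    ae_all_iff.2 fun i => Measure.tendsto_eval_ae_ae.eventually (h i)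
  filter_upwards [this] with x hx i _ using hx i

/-- The open annulus `ρ⁻¹ < |z| < ρ`. -/
def annulus (ρ : ℝ) : Set ℂ := {z | ρ⁻¹ < ‖z‖ ∧ ‖z‖ < ρ}

theorem isOpen_annulus (ρ : ℝ) : IsOpen (annulus ρ) :=
  (isOpen_lt continuous_const continuous_norm).inter (isOpen_lt continuous_norm continuous_const)

theorem circleAverage_eq_of_annulus {ρ r R : ℝ} (hρ : 0 < ρ) (hr : ρ⁻¹ < r) (hle : r ≤ R)
    (hR : R < ρ) {h : ℂ → ℂ} (hh : DifferentiableOn ℂ h (annulus ρ)) :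
    Real.circleAverage h 0 R = Real.circleAverage h 0 r := by
  have h0 : 0 < r := (inv_pos.2 hρ).trans hr
  rw [Real.circleAverage_eq_circleIntegral (h0.trans_le hle).ne',
    Real.circleAverage_eq_circleIntegral h0.ne']
  congr 1
  refine Complex.circleIntegral_sub_center_inv_smul_eq_of_differentiable_on_annulus_off_countable
    h0 hle Set.countable_empty (hh.continuousOn.mono ?_) fun z hz => ?_
  · rintro z ⟨h1, h2⟩
    simp only [mem_closedBall_zero_iff, mem_ball_zero_iff, not_lt] at h1 h2
    exact ⟨by linarith, by linarith⟩
  · obtain ⟨⟨h1, h2⟩, -⟩ := hz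
    simp only [mem_closedBall_zero_iff, mem_ball_zero_iff, not_le] at h1 h2
    exact hh.differentiableAt ((isOpen_annulus ρ).mem_nhds ⟨by linarith, by linarith⟩)

theorem spheres_subset_annulus {ρ r : ℝ} (hρ : 0 < ρ) (hr : ρ⁻¹ < r) (hr1 : r < 1) :
    sphere (0 : ℂ) r ∪ sphere (0 : ℂ) r⁻¹ ⊆ annulus ρ := by
  have h0 : 0 < r := (inv_pos.2 hρ).trans hr
  have h1 : r⁻¹ < ρ := (inv_lt_comm₀ hρ h0).1 hr
  have h2 : 1 < r⁻¹ := (one_lt_inv₀ h0).2 hr1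
  rintro z (hz | hz) <;> rw [mem_sphere_zero_iff_norm] at hz
  · exact ⟨by rw [hz]; exact hr, by rw [hz]; linarith⟩
  · exact ⟨by rw [hz]; linarith, by rw [hz]; exact h1⟩

theorem sphere_one_subset_annulus {ρ : ℝ} (hρ : 1 < ρ) : sphere (0 : ℂ) 1 ⊆ annulus ρ := by
  intro z hz
  rw [mem_sphere_zero_iff_norm] at hz
  exact ⟨by rw [hz]; exact inv_lt_one_of_one_lt₀ hρ, by rw [hz]; exact hρ⟩

theorem integral_circ_one_eq_circPair {ρ r : ℝ} (hr : ρ⁻¹ < r) (hr1 : r < 1) (hρ : 1 < ρ)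
    {h : ℂ → ℂ} (hh : DifferentiableOn ℂ h (annulus ρ)) :
    ∫ z, h z ∂circ 1 = ∫ z, h z ∂circPair r := by
  have hρ0 : 0 < ρ := one_pos.trans hρ
  have h0 : 0 < r := (inv_pos.2 hρ0).trans hr
  have h1 : r⁻¹ < ρ := (inv_lt_comm₀ hρ0 h0).1 hr
  have h2 : 1 < r⁻¹ := (one_lt_inv₀ h0).2 hr1
  have hi : Integrable h (circ 1) := integrable_of_continuousOn (isCompact_sphere 0 |1|) (ae_circ 1)
    (hh.continuousOn.mono (by rw [abs_one]; exact sphere_one_subset_annulus hρ))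
  rw [integral_circ hi.aestronglyMeasurable, integral_circPair h0
    (hh.continuousOn.mono (spheres_subset_annulus hρ0 hr hr1)),
    circleAverage_eq_of_annulus hρ0 hr hr1.le hρ hh,
    circleAverage_eq_of_annulus hρ0 hr (hr1.trans h2).le h1 hh]
  ring

theorem update_mem_pi {ι : Type*} [DecidableEq ι] {S : ι → Set ℂ} {x : ι → ℂ}
    (hx : x ∈ Set.univ.pi S) {i : ι} {u : ℂ} (hu : u ∈ S i) :
    Function.update x i u ∈ Set.univ.pi S := by
  intro j _
  rcases eq_or_ne j i with rfl | hj
  · simpa using hu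
  · simpa [hj] using hx j (Set.mem_univ j)

/-- The contour of integration of a function holomorphic near the unit torus can be moved, one
coordinate at a time. -/
theorem integral_torus_eq_circPair {n : ℕ} {ρ : ℝ} (hρ : 1 < ρ) {r : Fin n → ℝ}
    (hr : ∀ i, ρ⁻¹ < r i) (hr1 : ∀ i, r i < 1) {F : (Fin n → ℂ) → ℂ}
    (hF : DifferentiableOn ℂ F (Set.univ.pi fun _ => annulus ρ)) :
    ∫ x, F x ∂Measure.pi (fun _ : Fin n => circ 1) =
      ∫ x, F x ∂Measure.pi (fun i => circPair (r i)) := by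
  have hρ0 : 0 < ρ := one_pos.trans hρ
  have h0 : ∀ i, 0 < r i := fun i => (inv_pos.2 hρ0).trans (hr i)
  let μ : Finset (Fin n) → Fin n → Measure ℂ := fun S i => if i ∈ S then circPair (r i) else circ 1
  have hμp : ∀ S i, IsProbabilityMeasure (μ S i) := by
    intro S i; by_cases h : i ∈ S <;> simp only [μ, h, if_true, if_false] <;> infer_instance
  let K : Finset (Fin n) → Fin n → Set ℂ := fun S i =>
    if i ∈ S then sphere (0 : ℂ) (r i) ∪ sphere (0 : ℂ) (r i)⁻¹ else sphere 0 1
  have hKc : ∀ S, IsCompact (Set.univ.pi (K S)) := by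
    refine fun S => isCompact_univ_pi fun i => ?_
    by_cases h : i ∈ S <;> simp only [K, h, if_true, if_false]
    · exact (isCompact_sphere _ _).union (isCompact_sphere _ _)
    · exact isCompact_sphere _ _
  have hKa : ∀ S i, K S i ⊆ annulus ρ := by
    intro S i
    by_cases h : i ∈ S <;> simp only [K, h, if_true, if_false]
    · exact spheres_subset_annulus hρ0 (hr i) (hr1 i)
    · exact sphere_one_subset_annulus hρ
  have hKae : ∀ S, ∀ᵐ x ∂Measure.pi (μ S), x ∈ Set.univ.pi (K S) := by
    refine fun S => ae_pi_mem fun i => ?_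
    by_cases h : i ∈ S <;> simp only [μ, K, h, if_true, if_false]
    · exact ae_circPair (h0 i)
    · simpa using ae_circ 1
  have hKsub : ∀ S, Set.univ.pi (K S) ⊆ Set.univ.pi fun _ => annulus ρ :=
    fun S => Set.pi_mono fun i _ => hKa S i
  have hint : ∀ S, Integrable F (Measure.pi (μ S)) := fun S =>
    integrable_of_continuousOn (hKc S) (hKae S) (hF.continuousOn.mono (hKsub S))
  have key : ∀ S, ∫ x, F x ∂Measure.pi (μ S) = ∫ x, F x ∂Measure.pi (μ ∅) := by
    intro S
    induction S using Finset.induction_on with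
    | empty => rfl
    | insert i S hi ih =>
      rw [← ih, integral_pi_update (μ := μ (insert i S)) (μ' := μ S) i
        (fun j hj => by simp [μ, hj]) (hint _), integral_pi_update (μ := μ S) (μ' := μ S) i
        (fun j hj => rfl) (hint _)]
      refine integral_congr_ae ?_
      filter_upwards [hKae S] with x hx
      simp only [μ, Finset.mem_insert_self, if_true, hi, if_false]
      refine (integral_circ_one_eq_circPair (hr i) (hr1 i) hρ ?_).symm
      refine hF.comp (fun u _ => ?_) fun u hu => update_mem_pi (hKsub S hx) hu
      exact ((hasDerivAt_update x i u).differentiableAt).differentiableWithinAt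
  have e1 : μ ∅ = fun _ => circ 1 := by ext1 i; simp [μ]
  have e2 : μ Finset.univ = fun i => circPair (r i) := by ext1 i; simp [μ]
  rw [← e1, ← e2]
  exact (key _).symm

theorem pi_circ_one_eq_map (n : ℕ) : Measure.pi (fun _ : Fin n => circ 1) =
    ((ENNReal.ofReal (2 * Real.pi))⁻¹ ^ n • (volume : Measure (Fin n → ℝ)).restrict
      (Set.Icc 0 fun _ => 2 * Real.pi)).map (torusMap 0 fun _ => 1) := by
  have h1 : Measure.pi (fun _ : Fin n => angleMeasure) =
      (ENNReal.ofReal (2 * Real.pi))⁻¹ ^ n • (volume : Measure (Fin n → ℝ)).restrict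
      (Set.Icc 0 fun _ => 2 * Real.pi) := by
    refine Measure.pi_eq fun s hs => ?_
    rw [← Set.pi_univ_Icc, volume_pi, Measure.restrict_pi_pi, Measure.smul_apply, Measure.pi_pi]
    simp [angleMeasure, Finset.prod_mul_distrib]
  have h2 := Measure.pi_map_pi (μ := fun _ : Fin n => angleMeasure)
    (f := fun _ => circleMap 0 1)
    (hμ := fun _ => inferInstanceAs (SigmaFinite (circ 1)))
    fun _ => (continuous_circleMap 0 1).aemeasurable
  rw [← h1]
  exact h2.symm

theorem continuous_torusMap {n : ℕ} (R : Fin n → ℝ) : Continuous (torusMap 0 R) := by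
  unfold torusMap; fun_prop

theorem intT_eq_integral {n : ℕ} {f F : (Fin n → ℂ) → ℂ}
    (hfF : f =ᵐ[Measure.pi fun _ : Fin n => circ 1] F)
    (hF : Integrable F (Measure.pi fun _ : Fin n => circ 1)) :
    IntegrableT f ∧ intT f = ∫ x, F x ∂Measure.pi (fun _ : Fin n => circ 1) := by
  have hf : Integrable f (Measure.pi fun _ : Fin n => circ 1) := hF.congr hfF.symm
  rw [← integral_congr_ae hfF]
  have hm : Measurable (torusMap (n := n) 0 fun _ => 1) := (continuous_torusMap _).measurable
  have hc : (ENNReal.ofReal (2 * Real.pi))⁻¹ ^ n ≠ 0 :=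
    pow_ne_zero _ (ENNReal.inv_ne_zero.2 ENNReal.ofReal_ne_top)
  have hc' : (ENNReal.ofReal (2 * Real.pi))⁻¹ ^ n ≠ ⊤ :=
    ENNReal.pow_ne_top (ENNReal.inv_ne_top.2 ofReal_two_pi_ne_zero)
  rw [pi_circ_one_eq_map] at hf ⊢
  constructor
  · have := hf.comp_measurable hm
    rwa [integrable_smul_measure hc hc'] at this
  · rw [integral_map hm.aemeasurable hf.aestronglyMeasurable, integral_smul_measure, intT,
      torusIntegral, ← integral_smul]
    refine integral_congr_ae (Filter.Eventually.of_forall fun θ => ?_)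
    simp only [smul_eq_mul, Complex.real_smul]
    rw [← mul_assoc, ← Finset.prod_mul_distrib]
    congr 1
    rw [ENNReal.toReal_pow, ENNReal.toReal_inv, ENNReal.toReal_ofReal (by positivity)]
    rw [Finset.prod_congr rfl (g := fun _ => ((2 * Real.pi : ℂ))⁻¹)]
    · simp
    · intro i _
      have h3 := Complex.exp_ne_zero (θ i * Complex.I)
      have h4 : (Real.pi : ℂ) ≠ 0 := by exact_mod_cast Real.pi_ne_zero
      have h5 := Complex.I_ne_zero
      simp only [torusMap, Pi.zero_apply, zero_add, Complex.ofReal_one, one_mul]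
      field_simp

section WordAnalysis

variable {ι : Type*} [DecidableEq ι] {t : ℂ}

theorem hlWord_congr_val {x y : ι → ℂ} {s : Finset ι} (h : ∀ j ∈ s, x j = y j)
    (L : List (ℂ → ℂ)) : hlWord t x L s = hlWord t y L s := by
  induction L generalizing s with
  | nil => rfl
  | cons f fs ih =>
    simp only [hlWord]
    refine Finset.sum_congr rfl fun i hi => ?_
    rw [h i hi, ih fun j hj => h j (Finset.mem_of_mem_erase hj)]
    congr 2
    exact Finset.prod_congr rfl fun j hj => by rw [h j (Finset.mem_of_mem_erase hj)]

theorem continuousOn_hlWord {X : Type*} [TopologicalSpace X] {C : Set X} {S : Set ℂ}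
    {z : X → ι → ℂ} {s : Finset ι} (hz : ∀ j ∈ s, ContinuousOn (fun x => z x j) C)
    (hS : ∀ j ∈ s, ∀ x ∈ C, z x j ∈ S) (hinj : ∀ x ∈ C, Set.InjOn (z x) s) {L : List (ℂ → ℂ)}
    (hL : ∀ f ∈ L, ContinuousOn f S) : ContinuousOn (fun x => hlWord t (z x) L s) C := by
  induction L generalizing s with
  | nil => exact continuousOn_const
  | cons f fs ih =>
    simp only [hlWord]
    refine continuousOn_finsetSum _ fun i hi => ?_
    refine ContinuousOn.mul (ContinuousOn.mul ?_ (continuousOn_finsetProd _ fun j hj => ?_)) ?_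
    · exact (hL f (by simp)).comp (hz i hi) fun x hx => hS i hi x hx
    · have hj' := Finset.mem_of_mem_erase hj
      refine ContinuousOn.div ((hz i hi).sub (continuousOn_const.mul (hz j hj')))
        ((hz i hi).sub (hz j hj')) fun x hx h => ?_
      exact Finset.ne_of_mem_erase hj (hinj x hx hi hj' (sub_eq_zero.1 h)).symm
    · exact ih (fun j hj => hz j (Finset.mem_of_mem_erase hj))
        (fun j hj => hS j (Finset.mem_of_mem_erase hj))
        (fun x hx => (hinj x hx).mono (Finset.coe_subset.2 (Finset.erase_subset _ _)))
        (fun g hg => hL g (List.mem_cons_of_mem _ hg))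

theorem differentiableOn_hlWord {z : ι → ℂ} {s : Finset ι} {U : Set ℂ} {L : List (ℂ → ℂ → ℂ)}
    (hL : ∀ F ∈ L, ∀ j ∈ s, DifferentiableOn ℂ (fun v => F v (z j)) U) :
    DifferentiableOn ℂ (fun v => hlWord t z (L.map fun F => F v) s) U := by
  induction L generalizing s with
  | nil => exact differentiableOn_const _
  | cons f fs ih =>
    simp only [List.map_cons, hlWord]
    refine DifferentiableOn.fun_sum fun i hi => ?_
    refine DifferentiableOn.mul (DifferentiableOn.mul_const (hL f (by simp) i hi) _) ?_
    exact ih fun F hF j hj => hL F (List.mem_cons_of_mem _ hF) j (Finset.mem_of_mem_erase hj)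

/-- The Blaschke type factor that a variable `v` placed before, and its inverse placed after, a
variable `z` leaves behind once the density has been taken into account. -/
noncomputable def kern (t v z : ℂ) : ℂ := (t - v * z) / (1 - t * v * z)

/-- The letters that remain when the `k`-th one has been paired with an earlier letter: those in
between acquire a factor `kern t v`. -/
noncomputable def unpaired (t v : ℂ) (L : List (ℂ → ℂ)) (k : ℕ) : List (ℂ → ℂ) :=
  (L.take k).map (· * kern t v) ++ L.drop (k + 1)

/-- The contribution of the symbol `z` to the density of a variable `v`. -/
noncomputable def crossDensity (t v z : ℂ) : ℂ :=
  ((1 - z * v⁻¹) * (1 - z * v)) / ((1 - t * (z * v⁻¹)) * (1 - t * (z * v)))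

/-- The terms that begin with the symbol `v`, expanded according to the position `k` of the letter that
receives `v⁻¹`. The factors of `v` and `v⁻¹` with the other symbols cancel against the density, apart
from a factor `kern t v` for the symbols placed between the two. -/
theorem hlWord_first_pair {z : ι → ℂ} {p p' : ι} {s : Finset ι} {v : ℂ} (hv : z p = v)
    (hv' : z p' = v⁻¹) (hv0 : v ≠ 0) (hp' : p' ∉ s) (hs : ∀ q ∈ s, v - z q ≠ 0)
    (hs' : ∀ q ∈ s, v⁻¹ - z q ≠ 0) (ht : ∀ q ∈ s, 1 - t * (z q * v) ≠ 0)
    (ht' : ∀ q ∈ s, 1 - t * (z q * v⁻¹) ≠ 0) {fs : List (ℂ → ℂ)} (hl : fs.length = s.card + 1) :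
    (∏ j ∈ insert p' s, (z p - t * z j) / (z p - z j)) * hlWord t z fs (insert p' s) *
      ∏ q ∈ s, crossDensity t v (z q) =
    (v - t * v⁻¹) / (v - v⁻¹) * ∑ k ∈ Finset.range fs.length, fs.getD k 0 v⁻¹ *
      hlWord t z (unpaired t v fs k) s := by
  rw [Finset.prod_insert hp', hlWord_insert _ _ hp' hl, hv, hv']
  have e : ∀ a b c d : ℂ, a * b * c * d = a * ((b * d) * c) := fun a b c d => by ring
  rw [e, ← Finset.prod_mul_distrib, Finset.mul_sum]
  congr 1
  refine Finset.sum_congr rfl fun k hk => ?_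
  rw [mul_left_comm]
  congr 1
  have hk' : k < fs.length := Finset.mem_range.1 hk
  have h1 := hlWord_map_mul (t := t) (x := z)
    (fun y => (v - t * y) / (v - y) * crossDensity t v y)
    ((fs.take k).map (· * fun y => (y - t * v⁻¹) / (y - v⁻¹)) ++
      (fs.drop (k + 1)).map (· * fun y => (v⁻¹ - t * y) / (v⁻¹ - y))) s
    (by simp; omega)
  rw [← h1, List.map_append, unpaired, List.map_map, List.map_map]
  have k1 : ∀ q ∈ s, (v - t * z q) / (v - z q) * crossDensity t v (z q) =
      (1 - z q * v) / (1 - t * (z q * v)) := by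
    intro q hq
    have a1 : v - z q = v * (1 - z q * v⁻¹) := by field_simp
    have a2 : v - t * z q = v * (1 - t * (z q * v⁻¹)) := by field_simp
    have a3 : 1 - z q * v⁻¹ ≠ 0 := fun h => hs q hq (by rw [a1, h, mul_zero])
    have a4 := ht q hq
    have a5 := ht' q hq
    rw [crossDensity, a1, a2, mul_div_mul_left _ _ hv0, div_mul_div_comm,
      div_eq_div_iff (mul_ne_zero a3 (mul_ne_zero a5 a4)) a4]
    ring
  have a6 : ∀ q ∈ s, v⁻¹ - z q = v⁻¹ * (1 - z q * v) := fun q hq => by field_simp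
  have a7 : ∀ q ∈ s, 1 - z q * v ≠ 0 := fun q hq h => hs' q hq (by rw [a6 q hq, h, mul_zero])
  refine hlWord_congr (List.rel_append ?_ ?_)
  · rw [List.forall₂_map_left_iff, List.forall₂_map_right_iff]
    refine List.forall₂_same.2 fun f _ q hq => ?_
    simp only [Function.comp, Pi.mul_apply]
    rw [k1 q hq, mul_assoc]
    congr 1
    have b1 : z q - v⁻¹ = -(v⁻¹ * (1 - z q * v)) := by rw [← a6 q hq]; ring
    have b2 : z q - t * v⁻¹ = v⁻¹ * (z q * v - t) := by field_simp
    have b3 : 1 - t * v * z q = 1 - t * (z q * v) := by ring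
    rw [kern, b1, b2, b3, ← mul_neg, mul_div_mul_left _ _ (inv_ne_zero hv0), div_neg, neg_mul,
      div_mul_div_cancel₀ (a7 q hq), ← neg_div]
    ring
  · rw [List.forall₂_map_left_iff]
    refine List.forall₂_same.2 fun f _ q hq => ?_
    simp only [Function.comp, Pi.mul_apply]
    rw [k1 q hq, mul_assoc, a6 q hq]
    have b2 : v⁻¹ - t * z q = v⁻¹ * (1 - t * (z q * v)) := by field_simp
    rw [b2, mul_div_mul_left _ _ (inv_ne_zero hv0), div_mul_div_cancel₀ (a7 q hq),
      div_self (ht q hq), mul_one]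

end WordAnalysis

/-! ### Symbols and densities -/

/-- The symbols `x_i`, `x_i⁻¹` (for `inl (i, true)`, `inl (i, false)`) and `1`, `-1` (for
`inr true`, `inr false`). -/
abbrev HLSym (n : ℕ) := (Fin n × Bool) ⊕ Bool

/-- `1` for `true` and `-1` for `false`. -/
def signVal : Bool → ℂ
  | true => 1
  | false => -1

/-- The value of a symbol. -/
noncomputable def symVal {n : ℕ} (x : Fin n → ℂ) : HLSym n → ℂ
  | .inl (i, true) => x i
  | .inl (i, false) => (x i)⁻¹
  | .inr e => signVal e

/-- The symbols `x_i^{±1}`, `i ∈ V`, together with the signs in `E`. -/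
def syms {n : ℕ} (V : Finset (Fin n)) (E : Finset Bool) : Finset (HLSym n) :=
  (V ×ˢ Finset.univ).disjSum E

/-- The factor of the density that belongs to two variables. -/
noncomputable def pairDensity (t x y : ℂ) : ℂ :=
  ((1 - x * y) * (1 - x⁻¹ * y⁻¹) * (1 - x⁻¹ * y) * (1 - x * y⁻¹)) /
    ((1 - t * (x * y)) * (1 - t * (x⁻¹ * y⁻¹)) * (1 - t * (x⁻¹ * y)) * (1 - t * (x * y⁻¹)))

/-- The factor of the density that belongs to one variable; the signs in `E` act like additional
symbols. -/
noncomputable def selfDensity (t : ℂ) (E : Finset Bool) (x : ℂ) : ℂ :=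
  1 / ((1 - t * x ^ 2) * (1 - t * x⁻¹ ^ 2)) * ∏ e ∈ E, crossDensity t x (signVal e)

/-- The density in the variables `x_i`, `i ∈ V`, attached to a set `E` of signs. Up to a constant,
and where the latter has no vanishing denominator, this is the Koornwinder density with parameters
`±√t` and, for each sign `e`, `t e` if `e` belongs to `E` and `e` otherwise. -/
noncomputable def hlDensity {n : ℕ} (t : ℂ) (V : Finset (Fin n)) (E : Finset Bool)
    (x : Fin n → ℂ) : ℂ :=
  (∏ i ∈ V, selfDensity t E (x i)) * ∏ i ∈ V, ∏ j ∈ V with i < j, pairDensity t (x i) (x j)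

theorem crossDensity_mul_inv (t v z : ℂ) :
    crossDensity t v z * crossDensity t v z⁻¹ = pairDensity t v z := by
  rw [crossDensity, crossDensity, pairDensity, div_mul_div_comm]
  congr 1 <;> ring

theorem crossDensity_inv (t v z : ℂ) : crossDensity t v⁻¹ z = crossDensity t v z := by
  rw [crossDensity, crossDensity, inv_inv]
  congr 1 <;> ring

theorem pairDensity_comm (t x y : ℂ) : pairDensity t x y = pairDensity t y x := by
  rw [pairDensity, pairDensity]
  congr 1 <;> ring

section Syms

variable {n : ℕ} {V : Finset (Fin n)} {E : Finset Bool} {t : ℂ}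

theorem inl_mem_syms {i : Fin n} {b : Bool} : (.inl (i, b) : HLSym n) ∈ syms V E ↔ i ∈ V := by
  simp [syms]

theorem inr_mem_syms {e : Bool} : (.inr e : HLSym n) ∈ syms V E ↔ e ∈ E := by
  simp [syms]

theorem card_syms : (syms V E).card = 2 * V.card + E.card := by
  simp [syms, mul_comm]

theorem erase_inl_syms {i : Fin n} (hi : i ∈ V) (b : Bool) :
    (syms V E).erase (.inl (i, b)) = insert (.inl (i, !b)) (syms (V.erase i) E) := by
  ext q
  rcases q with ⟨j, c⟩ | e
  · simp only [Finset.mem_erase, Finset.mem_insert, inl_mem_syms, ne_eq, Sum.inl.injEq,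
      Prod.mk.injEq]
    by_cases hj : j = i
    · subst hj; cases b <;> cases c <;> simp [hi]
    · simp [hj]
  · simp [inr_mem_syms]

theorem erase_inr_syms (e : Bool) :
    (syms V E).erase (.inr e) = syms V (E.erase e) := by
  ext q
  rcases q with ⟨j, c⟩ | e'
  · simp [inl_mem_syms]
  · simp [inr_mem_syms]

theorem sum_syms (g : HLSym n → ℂ) :
    ∑ p ∈ syms V E, g p = ∑ i ∈ V, (g (.inl (i, true)) + g (.inl (i, false))) +
      ∑ e ∈ E, g (.inr e) := by
  rw [syms, Finset.sum_disjSum, Finset.sum_product]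
  simp

theorem prod_syms (g : HLSym n → ℂ) :
    ∏ p ∈ syms V E, g p = (∏ i ∈ V, (g (.inl (i, true)) * g (.inl (i, false)))) *
      ∏ e ∈ E, g (.inr e) := by
  rw [syms, Finset.prod_disjSum, Finset.prod_product]
  simp

theorem prod_lt_erase {g : Fin n → Fin n → ℂ} (hg : ∀ i j, g i j = g j i) {i : Fin n}
    (hi : i ∈ V) : ∏ a ∈ V, ∏ b ∈ V with a < b, g a b =
      (∏ j ∈ V.erase i, g i j) * ∏ a ∈ V.erase i, ∏ b ∈ V.erase i with a < b, g a b := by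
  have h1 : ∀ a ∈ V.erase i, ∏ b ∈ V with a < b, g a b =
      (if a < i then g i a else 1) * ∏ b ∈ V.erase i with a < b, g a b := by
    intro a ha
    rw [Finset.prod_filter, Finset.prod_filter, ← Finset.mul_prod_erase V _ hi, hg i a]
  have h2 : ∏ b ∈ V with i < b, g i b = ∏ a ∈ V.erase i, (if i < a then g i a else 1) := by
    rw [Finset.prod_filter, ← Finset.mul_prod_erase V _ hi]
    simp
  rw [← Finset.mul_prod_erase V _ hi, Finset.prod_congr rfl h1, Finset.prod_mul_distrib, h2,
    ← mul_assoc, ← Finset.prod_mul_distrib]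
  congr 1
  refine Finset.prod_congr rfl fun a ha => ?_
  rcases lt_or_gt_of_ne (Finset.ne_of_mem_erase ha) with h | h
  · simp [h, h.not_gt]
  · simp [h, h.not_gt]

theorem hlDensity_erase_var {x : Fin n → ℂ} {i : Fin n} (hi : i ∈ V) :
    hlDensity t V E x = 1 / ((1 - t * x i ^ 2) * (1 - t * (x i)⁻¹ ^ 2)) *
      (∏ q ∈ syms (V.erase i) E, crossDensity t (x i) (symVal x q)) *
      hlDensity t (V.erase i) E x := by
  rw [hlDensity, hlDensity, prod_lt_erase (fun a b => pairDensity_comm t (x a) (x b)) hi,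
    ← Finset.mul_prod_erase V _ hi, prod_syms]
  simp only [symVal, crossDensity_mul_inv]
  rw [selfDensity]
  ring

theorem hlDensity_erase_sign {x : Fin n → ℂ} {e : Bool} (he : e ∈ E) :
    hlDensity t V E x = (∏ i ∈ V, crossDensity t (x i) (signVal e)) *
      hlDensity t V (E.erase e) x := by
  have h : ∏ i ∈ V, selfDensity t E (x i) = (∏ i ∈ V, crossDensity t (x i) (signVal e)) *
      ∏ i ∈ V, selfDensity t (E.erase e) (x i) := by
    rw [← Finset.prod_mul_distrib]
    refine Finset.prod_congr rfl fun i _ => ?_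
    rw [selfDensity, selfDensity, ← Finset.mul_prod_erase E _ he]
    ring
  rw [hlDensity, hlDensity, h, mul_assoc]

theorem hlDensity_congr {x y : Fin n → ℂ} (h : ∀ i ∈ V, x i = y i) :
    hlDensity t V E x = hlDensity t V E y := by
  rw [hlDensity, hlDensity]
  congr 1
  · exact Finset.prod_congr rfl fun i hi => by rw [h i hi]
  · refine Finset.prod_congr rfl fun i hi => Finset.prod_congr rfl fun j hj => ?_
    rw [h i hi, h j (Finset.mem_filter.1 hj).1]

theorem symVal_congr {x y : Fin n → ℂ} (h : ∀ i ∈ V, x i = y i) :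
    ∀ q ∈ syms V E, symVal x q = symVal y q := by
  rintro (⟨i, _ | _⟩ | e) hq
  · simp only [symVal, h i (inl_mem_syms.1 hq)]
  · simp only [symVal, h i (inl_mem_syms.1 hq)]
  · rfl

end Syms

/-! ### Points off the unit torus -/

theorem annulus_ne_zero {ρ : ℝ} (hρ : 1 < ρ) {z : ℂ} (hz : z ∈ annulus ρ) : z ≠ 0 := by
  rintro rfl
  have := hz.1
  rw [norm_zero] at this
  exact absurd this (not_lt.2 (inv_nonneg.2 (by linarith)))

theorem inv_mem_annulus {ρ : ℝ} (hρ : 1 < ρ) {z : ℂ} (hz : z ∈ annulus ρ) : z⁻¹ ∈ annulus ρ := by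
  have h0 : 0 < ‖z‖ := norm_pos_iff.2 (annulus_ne_zero hρ hz)
  have hρ0 : 0 < ρ := by linarith
  constructor
  · rw [norm_inv]; exact (inv_lt_inv₀ hρ0 h0).2 hz.2
  · rw [norm_inv]; exact (inv_lt_comm₀ hρ0 h0).1 hz.1

theorem one_sub_ne_zero {t : ℂ} {ρ : ℝ} (hρ : 1 < ρ) (ht : ‖t‖ * ρ ^ 2 < 1) {y z : ℂ}
    (hy : ‖y‖ < ρ) (hz : ‖z‖ < ρ) : 1 - t * (y * z) ≠ 0 := by
  intro h
  have h1 : t * (y * z) = 1 := (sub_eq_zero.1 h).symm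
  have h2 : ‖t‖ * (‖y‖ * ‖z‖) = 1 := by rw [← norm_mul, ← norm_mul, h1, norm_one]
  have h3 : ‖y‖ * ‖z‖ ≤ ρ ^ 2 := by
    rw [sq]; exact mul_le_mul hy.le hz.le (norm_nonneg _) (by linarith)
  nlinarith [mul_le_mul_of_nonneg_left h3 (norm_nonneg t)]

theorem norm_signVal (e : Bool) : ‖signVal e‖ = 1 := by cases e <;> simp [signVal]

theorem signVal_mul_self (e : Bool) : signVal e * signVal e = 1 := by cases e <;> simp [signVal]

theorem signVal_injective : Function.Injective signVal := by
  intro a b h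
  cases a <;> cases b <;> simp_all [signVal] <;> norm_num [neg_eq_iff_add_eq_zero, eq_neg_iff_add_eq_zero] at h

theorem signVal_mem_annulus {ρ : ℝ} (hρ : 1 < ρ) (e : Bool) : signVal e ∈ annulus ρ :=
  sphere_one_subset_annulus hρ (by simp [norm_signVal])

/-- The product of the pairs of circles of radii `r i` and `(r i)⁻¹`. -/
def radiusTorus {n : ℕ} (r : Fin n → ℝ) : Set (Fin n → ℂ) :=
  Set.univ.pi fun i => sphere (0 : ℂ) (r i) ∪ sphere (0 : ℂ) (r i)⁻¹

theorem isCompact_radiusTorus {n : ℕ} (r : Fin n → ℝ) : IsCompact (radiusTorus r) :=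
  isCompact_univ_pi fun _ => (isCompact_sphere _ _).union (isCompact_sphere _ _)

theorem symVal_mem_annulus {n : ℕ} {ρ : ℝ} (hρ : 1 < ρ) {x : Fin n → ℂ}
    (hx : x ∈ Set.univ.pi fun _ : Fin n => annulus ρ) (q : HLSym n) : symVal x q ∈ annulus ρ := by
  rcases q with ⟨i, _ | _⟩ | e
  · exact inv_mem_annulus hρ (hx i (Set.mem_univ i))
  · exact hx i (Set.mem_univ i)
  · exact signVal_mem_annulus hρ e

theorem radiusTorus_subset {n : ℕ} {ρ : ℝ} (hρ : 1 < ρ) {r : Fin n → ℝ} (hr : ∀ i, ρ⁻¹ < r i)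
    (hr1 : ∀ i, r i < 1) : radiusTorus r ⊆ Set.univ.pi fun _ : Fin n => annulus ρ :=
  Set.pi_mono fun i _ => spheres_subset_annulus (by linarith) (hr i) (hr1 i)

theorem symVal_injective {n : ℕ} {r : Fin n → ℝ} (h0 : ∀ i, 0 < r i) (hr1 : ∀ i, r i < 1)
    (hinj : Function.Injective r) {x : Fin n → ℂ} (hx : x ∈ radiusTorus r) :
    Function.Injective (symVal x) := by
  have hnorm : ∀ i b, ‖symVal x (.inl (i, b))‖ = r i ∨ ‖symVal x (.inl (i, b))‖ = (r i)⁻¹ := by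
    intro i b
    have h := hx i (Set.mem_univ i)
    cases b
    · have := inv_mem_spheres h
      simpa [symVal] using this
    · simpa [symVal] using h
  have hone : ∀ i, 1 < (r i)⁻¹ := fun i => (one_lt_inv₀ (h0 i)).2 (hr1 i)
  rintro (⟨i, b⟩ | e) (⟨j, c⟩ | e') h
  · have hn := congrArg norm h
    have hij : i = j := by
      apply hinj
      have a1 := hr1 i; have a2 := hr1 j; have a3 := hone i; have a4 := hone j
      rcases hnorm i b with h1 | h1 <;> rcases hnorm j c with h2 | h2 <;> rw [h1, h2] at hn
      · exact hn
      · linarith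
      · linarith
      · exact inv_injective hn
    subst hij
    have hne := sub_inv_ne_zero_of_mem_spheres (h0 i) (hr1 i) (hx i (Set.mem_univ i))
    cases b <;> cases c
    · rfl
    · exact absurd (sub_eq_zero.2 h.symm) hne
    · exact absurd (sub_eq_zero.2 h) hne
    · rfl
  · have hn := congrArg norm h
    have h3 : ‖symVal x (.inr e')‖ = 1 := norm_signVal e'
    have a1 := hr1 i; have a3 := hone i
    rcases hnorm i b with h1 | h1 <;> rw [h1, h3] at hn <;> linarith
  · have hn := congrArg norm h
    have h3 : ‖symVal x (.inr e)‖ = 1 := norm_signVal e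
    have a1 := hr1 j; have a3 := hone j
    rcases hnorm j c with h1 | h1 <;> rw [h1, h3] at hn <;> linarith
  · exact congrArg Sum.inr (signVal_injective h)

theorem differentiableOn_prod {E ι : Type*} [NormedAddCommGroup E] [NormedSpace ℂ E] {s : Finset ι}
    {U : Set E} {f : ι → E → ℂ} (h : ∀ i ∈ s, DifferentiableOn ℂ (f i) U) :
    DifferentiableOn ℂ (fun x => ∏ i ∈ s, f i x) U := by
  classical
  induction s using Finset.induction_on with
  | empty => simp
  | insert i s hi ih =>
    simp only [Finset.prod_insert hi]
    exact (h i (Finset.mem_insert_self i s)).fun_mul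
      (ih fun j hj => h j (Finset.mem_insert_of_mem hj))

theorem differentiableOn_div {E : Type*} [NormedAddCommGroup E] [NormedSpace ℂ E] {U : Set E}
    {f g : E → ℂ} (hf : DifferentiableOn ℂ f U) (hg : DifferentiableOn ℂ g U)
    (h0 : ∀ x ∈ U, g x ≠ 0) : DifferentiableOn ℂ (fun x => f x / g x) U := by
  simp only [div_eq_mul_inv]
  exact hf.fun_mul (hg.inv h0)

theorem differentiableOn_symVal {n : ℕ} {ρ : ℝ} (hρ : 1 < ρ) (q : HLSym n) :
    DifferentiableOn ℂ (fun x : Fin n → ℂ => symVal x q)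
      (Set.univ.pi fun _ : Fin n => annulus ρ) := by
  rcases q with ⟨i, _ | _⟩ | e
  · exact DifferentiableOn.inv (by fun_prop) fun x hx => annulus_ne_zero hρ (hx i (Set.mem_univ i))
  · simp only [symVal]; fun_prop
  · exact differentiableOn_const _

theorem differentiableOn_hlDensity {n : ℕ} {t : ℂ} {ρ : ℝ} (hρ : 1 < ρ) (ht : ‖t‖ * ρ ^ 2 < 1)
    (V : Finset (Fin n)) (E : Finset Bool) :
    DifferentiableOn ℂ (hlDensity (n := n) t V E) (Set.univ.pi fun _ : Fin n => annulus ρ) := by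
  have hd : ∀ i : Fin n, DifferentiableOn ℂ (fun x : Fin n → ℂ => x i)
    (Set.univ.pi fun _ : Fin n => annulus ρ) := fun i => by fun_prop
  have hdi : ∀ i : Fin n, DifferentiableOn ℂ (fun x : Fin n → ℂ => (x i)⁻¹)
    (Set.univ.pi fun _ : Fin n => annulus ρ) := fun i =>
      differentiableOn_symVal hρ (.inl (i, false))
  have hne : ∀ x ∈ Set.univ.pi fun _ : Fin n => annulus ρ, ∀ p q : HLSym n,
      1 - t * (symVal x p * symVal x q) ≠ 0 := fun x hx p q =>
    one_sub_ne_zero hρ ht (symVal_mem_annulus hρ hx p).2 (symVal_mem_annulus hρ hx q).2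
  unfold hlDensity
  refine DifferentiableOn.fun_mul (differentiableOn_prod fun i _ => ?_)
    (differentiableOn_prod fun i _ => differentiableOn_prod fun j _ => ?_)
  · unfold selfDensity
    have h1 := hd i
    have h2 := hdi i
    refine DifferentiableOn.fun_mul ?_ (differentiableOn_prod fun e _ => ?_)
    · refine differentiableOn_div ?_ ?_ fun x hx => mul_ne_zero ?_ ?_
      · fun_prop
      · fun_prop
      · simp only [sq]; exact hne x hx (.inl (i, true)) (.inl (i, true))
      · simp only [sq]; exact hne x hx (.inl (i, false)) (.inl (i, false))
    · unfold crossDensity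
      refine differentiableOn_div ?_ ?_ fun x hx => mul_ne_zero ?_ ?_
      · fun_prop
      · fun_prop
      · exact hne x hx (.inr e) (.inl (i, false))
      · exact hne x hx (.inr e) (.inl (i, true))
  · unfold pairDensity
    have h1 := hd i
    have h2 := hdi i
    have h3 := hd j
    have h4 := hdi j
    refine differentiableOn_div ?_ ?_ fun x hx =>
      mul_ne_zero (mul_ne_zero (mul_ne_zero ?_ ?_) ?_) ?_
    · fun_prop
    · fun_prop
    · exact hne x hx (.inl (i, true)) (.inl (j, true))
    · exact hne x hx (.inl (i, false)) (.inl (j, false))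
    · exact hne x hx (.inl (i, false)) (.inl (j, true))
    · exact hne x hx (.inl (i, true)) (.inl (j, false))

/-! ### Integration of a single variable -/

/-- The condition on two letters `f` (to the left) and `g` (to the right) under which a variable
that is paired with its inverse can be integrated out: `z f(z) g(z⁻¹)` extends holomorphically to
the disc of radius `ρ`. The factor `z` allows a simple pole of `f(z) g(z⁻¹)` at the origin. -/
def PairHol (ρ : ℝ) (f g : ℂ → ℂ) : Prop :=
  ∃ H : ℂ → ℂ, DifferentiableOn ℂ H (ball 0 ρ) ∧ ∀ z ∈ annulus ρ, H z = z * f z * g z⁻¹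

section SingleVariable

variable {ι : Type*} [DecidableEq ι] {t : ℂ} {ρ : ℝ}

theorem differentiableOn_kern_left (hρ : 1 < ρ) (ht : ‖t‖ * ρ ^ 2 < 1) {z : ℂ} (hz : ‖z‖ < ρ) :
    DifferentiableOn ℂ (fun v => kern t v z) (ball 0 ρ) := by
  unfold kern
  refine differentiableOn_div (by fun_prop) (by fun_prop) fun v hv => ?_
  rw [mul_assoc]
  exact one_sub_ne_zero hρ ht (mem_ball_zero_iff.1 hv) hz

theorem differentiableOn_kern_right (hρ : 1 < ρ) (ht : ‖t‖ * ρ ^ 2 < 1) {v : ℂ} (hv : ‖v‖ < ρ) :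
    DifferentiableOn ℂ (kern t v) (ball 0 ρ) := by
  unfold kern
  refine differentiableOn_div (by fun_prop) (by fun_prop) fun z hz => ?_
  rw [mul_assoc]
  exact one_sub_ne_zero hρ ht hv (mem_ball_zero_iff.1 hz)

theorem differentiableOn_hlWord_unpaired (hρ : 1 < ρ) (ht : ‖t‖ * ρ ^ 2 < 1) {z : ι → ℂ}
    {s : Finset ι} (hz : ∀ q ∈ s, ‖z q‖ < ρ) (fs : List (ℂ → ℂ)) (k : ℕ) :
    DifferentiableOn ℂ (fun v => hlWord t z (unpaired t v fs k) s) (ball 0 ρ) := by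
  have e : ∀ v, unpaired t v fs k = ((fs.take k).map (fun (f : ℂ → ℂ) (v : ℂ) => f * kern t v) ++
      (fs.drop (k + 1)).map fun (f : ℂ → ℂ) (_ : ℂ) => f).map fun F => F v := by
    intro v; simp [unpaired, Function.comp_def]
  simp only [e]
  refine differentiableOn_hlWord fun F hF q hq => ?_
  rcases List.mem_append.1 hF with h | h
  · obtain ⟨f, -, rfl⟩ := List.mem_map.1 h
    exact (differentiableOn_kern_left hρ ht (hz q hq)).const_mul (f (z q))
  · obtain ⟨f, -, rfl⟩ := List.mem_map.1 h
    exact differentiableOn_const _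

/-- What the terms with `v` first become once the density is taken into account, as a function of
`v`. -/
noncomputable def pairedTerm (t : ℂ) (z : ι → ℂ) (s : Finset ι) (f : ℂ → ℂ) (fs : List (ℂ → ℂ))
    (v : ℂ) : ℂ :=
  f v * (v / ((v - v⁻¹) * (1 - t * v ^ 2))) * ∑ k ∈ Finset.range fs.length,
    fs.getD k 0 v⁻¹ * hlWord t z (unpaired t v fs k) s

/-- Integrating out `v`: by `PairHol`, `pairedTerm` is `(v - v⁻¹)⁻¹` times a function that is holomorphic
in a disc. -/
theorem pairedTerm_integral (hρ : 1 < ρ) (ht : ‖t‖ * ρ ^ 2 < 1) {r : ℝ} (hr : ρ⁻¹ < r)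
    (hr1 : r < 1) {z : ι → ℂ} {s : Finset ι} (hz : ∀ q ∈ s, ‖z q‖ < ρ) {f : ℂ → ℂ}
    {fs : List (ℂ → ℂ)} (hf : ∀ g ∈ fs, PairHol ρ f g) :
    ContinuousOn (pairedTerm t z s f fs) (sphere (0 : ℂ) r ∪ sphere (0 : ℂ) r⁻¹) ∧
    ∫ u, pairedTerm t z s f fs u ∂circPair r =
      1 / (4 * (1 - t)) * ∑ k ∈ Finset.range fs.length,
        (f 1 * fs.getD k 0 1 * hlWord t z (unpaired t 1 fs k) s +
          f (-1) * fs.getD k 0 (-1) * hlWord t z (unpaired t (-1) fs k) s) := by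
  have hρ0 : 0 < ρ := by linarith
  have h0 : 0 < r := (inv_pos.2 hρ0).trans hr
  have h1 : r⁻¹ < ρ := (inv_lt_comm₀ hρ0 h0).1 hr
  have hex : ∀ k, ∃ H : ℂ → ℂ, k < fs.length → DifferentiableOn ℂ H (ball 0 ρ) ∧
      ∀ z ∈ annulus ρ, H z = z * f z * fs.getD k 0 z⁻¹ := by
    intro k
    by_cases hk : k < fs.length
    · obtain ⟨H, hH⟩ := hf (fs.getD k 0) (by rw [List.getD_eq_getElem _ _ hk]; exact fs.getElem_mem hk)
      exact ⟨H, fun _ => hH⟩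
    · exact ⟨0, fun h => absurd h hk⟩
  choose H hH using hex
  set h : ℂ → ℂ := fun u => ∑ k ∈ Finset.range fs.length,
    H k u / (1 - t * u ^ 2) * hlWord t z (unpaired t u fs k) s with hh
  have hne : ∀ u : ℂ, ‖u‖ < ρ → 1 - t * u ^ 2 ≠ 0 := fun u hu => by
    rw [sq]; exact one_sub_ne_zero hρ ht hu hu
  have hd : DifferentiableOn ℂ h (ball 0 ρ) := by
    refine DifferentiableOn.fun_sum fun k hk => ?_
    refine DifferentiableOn.fun_mul (differentiableOn_div (hH k (Finset.mem_range.1 hk)).1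
      (by fun_prop) fun u hu => hne u (mem_ball_zero_iff.1 hu))
      (differentiableOn_hlWord_unpaired hρ ht hz fs k)
  set S := sphere (0 : ℂ) r ∪ sphere (0 : ℂ) r⁻¹ with hS
  have hSa : S ⊆ annulus ρ := spheres_subset_annulus hρ0 hr hr1
  have hdne : ∀ z ∈ S, z - z⁻¹ ≠ 0 := fun z hz => sub_inv_ne_zero_of_mem_spheres h0 hr1 hz
  have heq : ∀ u ∈ S, pairedTerm t z s f fs u = h u / (u - u⁻¹) := by
    intro u hu
    have a1 := hdne u hu
    have a2 := hne u (hSa hu).2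
    rw [pairedTerm, hh, Finset.mul_sum, Finset.sum_div]
    refine Finset.sum_congr rfl fun k hk => ?_
    rw [(hH k (Finset.mem_range.1 hk)).2 u (hSa hu)]
    generalize u - u⁻¹ = w at a1 ⊢
    field_simp
  have hcont : ContinuousOn (fun u => h u / (u - u⁻¹)) S := by
    refine ContinuousOn.div (hd.continuousOn.mono fun u hu => mem_ball_zero_iff.2 (hSa hu).2)
      (continuousOn_id.sub (continuousOn_inv₀.mono fun u hu => ne_zero_of_mem_spheres h0 hu)) hdne
  refine ⟨hcont.congr heq, ?_⟩
  have hcongr : ∫ u, pairedTerm t z s f fs u ∂circPair r = ∫ u, h u / (u - u⁻¹) ∂circPair r := by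
    refine integral_congr_ae ?_
    filter_upwards [ae_circPair h0] with u hu using heq u hu
  rw [hcongr, integral_div_sub_inv h0 hr1 h1 hd, hh]
  have m1 : (1 : ℂ) ∈ annulus ρ := signVal_mem_annulus hρ true
  have m2 : (-1 : ℂ) ∈ annulus ρ := signVal_mem_annulus hρ false
  have ht1 : 1 - t ≠ 0 := by simpa using hne 1 m1.2
  simp only
  rw [← Finset.sum_sub_distrib, Finset.sum_div, Finset.mul_sum]
  refine Finset.sum_congr rfl fun k hk => ?_
  rw [(hH k (Finset.mem_range.1 hk)).2 1 m1, (hH k (Finset.mem_range.1 hk)).2 (-1) m2, inv_neg,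
    inv_one]
  norm_num
  field_simp
  ring

theorem pairedTerm_congr {z z' : ι → ℂ} {s : Finset ι} (h : ∀ q ∈ s, z q = z' q) (f : ℂ → ℂ)
    (fs : List (ℂ → ℂ)) (v : ℂ) : pairedTerm t z s f fs v = pairedTerm t z' s f fs v := by
  simp only [pairedTerm, hlWord_congr_val h]

end SingleVariable

/-! ### The integral of a word -/

section Torus

variable {n : ℕ} {t : ℂ} {ρ : ℝ} {r : Fin n → ℝ} {V : Finset (Fin n)} {E : Finset Bool}

/-- The part of a symmetrized word, times the density, in which the symbol `p` comes first. -/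
noncomputable def firstTerm (t : ℂ) (V : Finset (Fin n)) (E : Finset Bool) (f : ℂ → ℂ)
    (fs : List (ℂ → ℂ)) (p : HLSym n) (x : Fin n → ℂ) : ℂ :=
  f (symVal x p) * (∏ j ∈ (syms V E).erase p,
    (symVal x p - t * symVal x j) / (symVal x p - symVal x j)) *
    hlWord t (symVal x) fs ((syms V E).erase p) * hlDensity t V E x

theorem firstTerm_inl (hρ : 1 < ρ) (ht : ‖t‖ * ρ ^ 2 < 1) {x : Fin n → ℂ}
    (hx : x ∈ Set.univ.pi fun _ : Fin n => annulus ρ) (hinj : Function.Injective (symVal x))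
    {i : Fin n} (hi : i ∈ V) (b : Bool) (f : ℂ → ℂ) {fs : List (ℂ → ℂ)}
    (hl : fs.length + 1 = 2 * V.card + E.card) :
    firstTerm t V E f fs (.inl (i, b)) x =
      pairedTerm t (symVal x) (syms (V.erase i) E) f fs (symVal x (.inl (i, b))) *
        hlDensity t (V.erase i) E x := by
  set p : HLSym n := .inl (i, b) with hp
  set p' : HLSym n := .inl (i, !b) with hp'
  set s := syms (V.erase i) E with hs
  set v := symVal x p with hv
  have hmem := symVal_mem_annulus hρ hx
  have hv0 : v ≠ 0 := annulus_ne_zero hρ (hmem p)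
  have hv' : symVal x p' = v⁻¹ := by
    cases b <;> simp [hv, hp, hp', symVal]
  have hps : p ∉ s := by simp [hs, hp, inl_mem_syms]
  have hps' : p' ∉ s := by simp [hs, hp', inl_mem_syms]
  have hpp : p ≠ p' := by cases b <;> simp [hp, hp']
  have hvv : v - v⁻¹ ≠ 0 := by
    rw [← hv', hv]; exact sub_ne_zero.2 fun h => hpp (hinj h)
  have key := hlWord_first_pair (t := t) (z := symVal x) (p := p) (p' := p') (s := s) (v := v) rfl
    hv' hv0 hps' (fun q hq => sub_ne_zero.2 fun h => hps (hinj h ▸ hq))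
    (fun q hq => by rw [← hv']; exact sub_ne_zero.2 fun h => hps' (hinj h ▸ hq))
    (fun q _ => one_sub_ne_zero hρ ht (hmem q).2 (hmem p).2)
    (fun q _ => by rw [← hv']; exact one_sub_ne_zero hρ ht (hmem q).2 (hmem p').2)
    (fs := fs) (by
      rw [hs, card_syms, Finset.card_erase_of_mem hi]
      have := Finset.card_pos.2 ⟨i, hi⟩
      omega)
  have hdens : hlDensity t V E x = 1 / ((1 - t * v ^ 2) * (1 - t * v⁻¹ ^ 2)) *
      (∏ q ∈ s, crossDensity t v (symVal x q)) * hlDensity t (V.erase i) E x := by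
    rw [hlDensity_erase_var hi]
    cases b
    · simp only [hv, hp, symVal, crossDensity_inv, inv_inv, hs]
      ring
    · rfl
  rw [firstTerm, erase_inl_syms hi, ← hp', ← hs, ← hv, hdens, pairedTerm]
  have n1 : 1 - t * v ^ 2 ≠ 0 := by
    rw [sq]; exact one_sub_ne_zero hρ ht (hmem p).2 (hmem p).2
  have n2 : 1 - t * v⁻¹ ^ 2 ≠ 0 := by
    rw [sq, ← hv']; exact one_sub_ne_zero hρ ht (hmem p').2 (hmem p').2
  have n3 : (v - t * v⁻¹) / (v - v⁻¹) * (1 / ((1 - t * v ^ 2) * (1 - t * v⁻¹ ^ 2))) =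
      v / ((v - v⁻¹) * (1 - t * v ^ 2)) := by
    have e : v - t * v⁻¹ = v * (1 - t * v⁻¹ ^ 2) := by field_simp
    rw [e, div_mul_div_comm, div_eq_div_iff (mul_ne_zero hvv (mul_ne_zero n1 n2))
      (mul_ne_zero hvv n1)]
    ring
  rw [← n3]
  linear_combination (f v * (1 / ((1 - t * v ^ 2) * (1 - t * v⁻¹ ^ 2))) *
    hlDensity t (V.erase i) E x) * key

theorem firstTerm_inr (hρ : 1 < ρ) (ht : ‖t‖ * ρ ^ 2 < 1) {x : Fin n → ℂ}
    (hx : x ∈ Set.univ.pi fun _ : Fin n => annulus ρ) (hinj : Function.Injective (symVal x))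
    {e : Bool} (he : e ∈ E) (f : ℂ → ℂ) (fs : List (ℂ → ℂ)) :
    firstTerm t V E f fs (.inr e) x = f (signVal e) * (∏ j ∈ E.erase e,
      (signVal e - t * signVal j) / (signVal e - signVal j)) *
      (hlWord t (symVal x) fs (syms V (E.erase e)) * hlDensity t V (E.erase e) x) := by
  have hmem := symVal_mem_annulus hρ hx
  have he2 := signVal_mul_self e
  have he0 : signVal e ≠ 0 := fun h => by simp [h] at he2
  have hcancel : ∀ i b, (signVal e - t * symVal x (.inl (i, b))) /
      (signVal e - symVal x (.inl (i, b))) = (1 - t * (signVal e * symVal x (.inl (i, b)))) /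
      (1 - signVal e * symVal x (.inl (i, b))) := by
    intro i b
    rw [← mul_div_mul_left _ _ he0]
    congr 1 <;> linear_combination he2
  have hi : ∀ i, (signVal e - t * symVal x (.inl (i, true))) /
      (signVal e - symVal x (.inl (i, true))) * ((signVal e - t * symVal x (.inl (i, false))) /
      (signVal e - symVal x (.inl (i, false)))) * crossDensity t (x i) (signVal e) = 1 := by
    intro i
    have m1 := one_sub_ne_zero hρ ht (hmem (.inr e)).2 (hmem (.inl (i, true))).2
    have m2 := one_sub_ne_zero hρ ht (hmem (.inr e)).2 (hmem (.inl (i, false))).2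
    have m3 : ∀ b, 1 - signVal e * symVal x (.inl (i, b)) ≠ 0 := by
      intro b h
      have h1 : symVal x (.inr e) = symVal x (.inl (i, b)) := by
        change signVal e = symVal x (.inl (i, b))
        linear_combination signVal e * h + symVal x (.inl (i, b)) * he2
      exact absurd (hinj h1) (by simp)
    have m4 := m3 true
    have m5 := m3 false
    rw [hcancel, hcancel]
    simp only [symVal] at m1 m2 m4 m5 ⊢
    rw [crossDensity, div_mul_div_comm, div_mul_div_comm]
    rw [div_eq_one_iff_eq (mul_ne_zero (mul_ne_zero m4 m5) (mul_ne_zero m2 m1))]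
    ring
  rw [firstTerm, erase_inr_syms, hlDensity_erase_sign he, prod_syms]
  have hprod : (∏ i ∈ V, ((signVal e - t * symVal x (.inl (i, true))) /
      (signVal e - symVal x (.inl (i, true))) * ((signVal e - t * symVal x (.inl (i, false))) /
      (signVal e - symVal x (.inl (i, false)))))) * ∏ i ∈ V, crossDensity t (x i) (signVal e) =
      1 := by
    rw [← Finset.prod_mul_distrib]
    exact Finset.prod_eq_one fun i _ => hi i
  have hval : ∀ e, symVal x (.inr e) = signVal e := fun _ => rfl
  simp only [hval]
  linear_combination (f (signVal e) * (∏ j ∈ E.erase e,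
    (signVal e - t * signVal j) / (signVal e - signVal j)) *
    hlWord t (symVal x) fs (syms V (E.erase e)) * hlDensity t V (E.erase e) x) * hprod

theorem continuousOn_hlWord_density (hρ : 1 < ρ) (ht : ‖t‖ * ρ ^ 2 < 1) (hr : ∀ i, ρ⁻¹ < r i)
    (hr1 : ∀ i, r i < 1) (hinj : Function.Injective r) (V' : Finset (Fin n)) (E' : Finset Bool)
    (s : Finset (HLSym n)) {L : List (ℂ → ℂ)} (hL : ∀ f ∈ L, ContinuousOn f (annulus ρ)) :
    ContinuousOn (fun x => hlWord t (symVal x) L s * hlDensity t V' E' x)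
      (radiusTorus r) := by
  have hsub := radiusTorus_subset hρ hr hr1
  refine ContinuousOn.mul ?_ ((differentiableOn_hlDensity hρ ht V' E').continuousOn.mono hsub)
  exact continuousOn_hlWord (fun q _ => (differentiableOn_symVal hρ q).continuousOn.mono hsub)
    (fun q _ x hx => symVal_mem_annulus hρ (hsub hx) q)
    (fun x hx => (symVal_injective (fun i => (inv_pos.2 (by linarith)).trans (hr i)) hr1 hinj
      hx).injOn) hL

theorem continuousOn_firstTerm (hρ : 1 < ρ) (ht : ‖t‖ * ρ ^ 2 < 1) (hr : ∀ i, ρ⁻¹ < r i)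
    (hr1 : ∀ i, r i < 1) (hinj : Function.Injective r) (p : HLSym n) {f : ℂ → ℂ}
    (hf : ContinuousOn f (annulus ρ)) {fs : List (ℂ → ℂ)}
    (hfs : ∀ f ∈ fs, ContinuousOn f (annulus ρ)) :
    ContinuousOn (firstTerm t V E f fs p) (radiusTorus r) := by
  have hsub := radiusTorus_subset hρ hr hr1
  have hv : ∀ q : HLSym n, ContinuousOn (fun x : Fin n → ℂ => symVal x q) (radiusTorus r) :=
    fun q => (differentiableOn_symVal hρ q).continuousOn.mono hsub
  have hw := continuousOn_hlWord_density hρ ht hr hr1 hinj V E ((syms V E).erase p) hfs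
  refine (ContinuousOn.mul (ContinuousOn.mul
    (hf.comp (hv p) fun x hx => symVal_mem_annulus hρ (hsub hx) p)
    (continuousOn_finsetProd ((syms V E).erase p)
      (f := fun j x => (symVal x p - t * symVal x j) / (symVal x p - symVal x j))
      fun j hj => ?_)) hw).congr fun x _ => ?_
  · refine ContinuousOn.div ((hv p).sub (continuousOn_const.mul (hv j))) ((hv p).sub (hv j))
      fun x hx h => ?_
    exact Finset.ne_of_mem_erase hj (symVal_injective
      (fun i => (inv_pos.2 (by linarith)).trans (hr i)) hr1 hinj hx (sub_eq_zero.1 h)).symm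
  · exact mul_assoc _ _ _

theorem ae_radiusTorus (h0 : ∀ i, 0 < r i) :
    ∀ᵐ x ∂Measure.pi (fun i => circPair (r i)), x ∈ radiusTorus r :=
  ae_pi_mem fun i => ae_circPair (h0 i)

theorem integrable_radiusTorus (h0 : ∀ i, 0 < r i) {F : (Fin n → ℂ) → ℂ}
    (hF : ContinuousOn F (radiusTorus r)) :
    Integrable F (Measure.pi fun i => circPair (r i)) :=
  integrable_of_continuousOn (isCompact_radiusTorus r) (ae_radiusTorus h0) hF

theorem continuousOn_kern (hρ : 1 < ρ) (ht : ‖t‖ * ρ ^ 2 < 1) {v : ℂ} (hv : ‖v‖ < ρ) :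
    ContinuousOn (kern t v) (annulus ρ) :=
  (differentiableOn_kern_right hρ ht hv).continuousOn.mono fun _ hz => mem_ball_zero_iff.2 hz.2

theorem continuousOn_of_mem_unpaired (hρ : 1 < ρ) (ht : ‖t‖ * ρ ^ 2 < 1) {v : ℂ} (hv : ‖v‖ < ρ)
    {fs : List (ℂ → ℂ)} (hfs : ∀ f ∈ fs, ContinuousOn f (annulus ρ)) (k : ℕ) :
    ∀ f ∈ unpaired t v fs k, ContinuousOn f (annulus ρ) := by
  intro f hf
  rcases List.mem_append.1 hf with h | h
  · obtain ⟨g, hg, rfl⟩ := List.mem_map.1 h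
    exact (hfs g (List.mem_of_mem_take hg)).mul (continuousOn_kern hρ ht hv)
  · exact hfs f (List.mem_of_mem_drop h)

theorem integral_firstTerm_inl (hρ : 1 < ρ) (ht : ‖t‖ * ρ ^ 2 < 1) (hr : ∀ i, ρ⁻¹ < r i)
    (hr1 : ∀ i, r i < 1) (hinj : Function.Injective r) {i : Fin n} (hi : i ∈ V) (b : Bool)
    {f : ℂ → ℂ} (hf : ContinuousOn f (annulus ρ)) {fs : List (ℂ → ℂ)}
    (hfs : ∀ f ∈ fs, ContinuousOn f (annulus ρ)) (hp : ∀ g ∈ fs, PairHol ρ f g)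
    (hl : fs.length + 1 = 2 * V.card + E.card) :
    ∫ x, firstTerm t V E f fs (.inl (i, b)) x ∂Measure.pi (fun i => circPair (r i)) =
      1 / (4 * (1 - t)) * ∑ k ∈ Finset.range fs.length,
        (f 1 * fs.getD k 0 1 * ∫ x, hlWord t (symVal x) (unpaired t 1 fs k)
            (syms (V.erase i) E) * hlDensity t (V.erase i) E x
            ∂Measure.pi (fun i => circPair (r i)) +
          f (-1) * fs.getD k 0 (-1) * ∫ x, hlWord t (symVal x) (unpaired t (-1) fs k)
            (syms (V.erase i) E) * hlDensity t (V.erase i) E x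
            ∂Measure.pi (fun i => circPair (r i))) := by
  have h0 : ∀ i, 0 < r i := fun i => (inv_pos.2 (by linarith)).trans (hr i)
  have hsub := radiusTorus_subset hρ hr hr1
  set s := syms (V.erase i) E with hs
  rw [integral_pi_update (μ' := fun i => circPair (r i)) i (fun _ _ => rfl)
    (integrable_radiusTorus h0 (continuousOn_firstTerm hρ ht hr hr1 hinj _ hf hfs))]
  have hinner : ∀ x ∈ radiusTorus r,
      ∫ u, firstTerm t V E f fs (.inl (i, b)) (Function.update x i u) ∂circPair (r i) =
      1 / (4 * (1 - t)) * ∑ k ∈ Finset.range fs.length,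
        (f 1 * fs.getD k 0 1 * (hlWord t (symVal x) (unpaired t 1 fs k) s *
            hlDensity t (V.erase i) E x) +
          f (-1) * fs.getD k 0 (-1) * (hlWord t (symVal x) (unpaired t (-1) fs k) s *
            hlDensity t (V.erase i) E x)) := by
    intro x hx
    obtain ⟨hc, hi'⟩ := pairedTerm_integral hρ ht (hr i) (hr1 i) (z := symVal x) (s := s)
      (fun q _ => (symVal_mem_annulus hρ (hsub hx) q).2) hp
    have hupd : ∀ u, ∀ j ∈ V.erase i, Function.update x i u j = x j := fun u j hj =>
      Function.update_of_ne (Finset.ne_of_mem_erase hj) _ _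
    have e1 : ∫ u, firstTerm t V E f fs (.inl (i, b)) (Function.update x i u) ∂circPair (r i) =
        ∫ u, pairedTerm t (symVal x) s f fs (if b then u else u⁻¹) *
          hlDensity t (V.erase i) E x ∂circPair (r i) := by
      refine integral_congr_ae ?_
      filter_upwards [ae_circPair (h0 i)] with u hu
      have hxu : Function.update x i u ∈ radiusTorus r := update_mem_pi hx hu
      rw [firstTerm_inl hρ ht (hsub hxu) (symVal_injective h0 hr1 hinj hxu) hi b f hl,
        hlDensity_congr (hupd u), pairedTerm_congr (symVal_congr (hupd u))]
      cases b <;> simp [symVal, hs]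
    have e2 : ∫ u, pairedTerm t (symVal x) s f fs (if b then u else u⁻¹) ∂circPair (r i) =
        ∫ u, pairedTerm t (symVal x) s f fs u ∂circPair (r i) := by
      cases b
      · simpa using integral_circPair_inv (h0 i) hc
      · simp
    rw [e1, integral_mul_const, e2, hi', mul_assoc, Finset.sum_mul]
    congr 1
    exact Finset.sum_congr rfl fun k _ => by ring
  have hv : ‖(1 : ℂ)‖ < ρ := by simpa using hρ
  have hv' : ‖(-1 : ℂ)‖ < ρ := by simpa using hρ
  have hint : ∀ v : ℂ, ‖v‖ < ρ → ∀ k, Integrable (fun x => hlWord t (symVal x)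
      (unpaired t v fs k) s * hlDensity t (V.erase i) E x)
      (Measure.pi fun i => circPair (r i)) := fun v hv k =>
    integrable_radiusTorus h0 (continuousOn_hlWord_density hρ ht hr hr1 hinj _ _ _
      (continuousOn_of_mem_unpaired hρ ht hv hfs k))
  have e3 : ∫ x, ∫ u, firstTerm t V E f fs (.inl (i, b)) (Function.update x i u) ∂circPair (r i)
      ∂Measure.pi (fun i => circPair (r i)) =
      ∫ x, 1 / (4 * (1 - t)) * ∑ k ∈ Finset.range fs.length,
        (f 1 * fs.getD k 0 1 * (hlWord t (symVal x) (unpaired t 1 fs k) s *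
            hlDensity t (V.erase i) E x) +
          f (-1) * fs.getD k 0 (-1) * (hlWord t (symVal x) (unpaired t (-1) fs k) s *
            hlDensity t (V.erase i) E x)) ∂Measure.pi (fun i => circPair (r i)) := by
    refine integral_congr_ae ?_
    filter_upwards [ae_radiusTorus h0] with x hx using hinner x hx
  have hint2 : ∀ k, Integrable (fun x => f 1 * fs.getD k 0 1 * (hlWord t (symVal x)
        (unpaired t 1 fs k) s * hlDensity t (V.erase i) E x) + f (-1) * fs.getD k 0 (-1) *
        (hlWord t (symVal x) (unpaired t (-1) fs k) s * hlDensity t (V.erase i) E x))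
      (Measure.pi fun i => circPair (r i)) := fun k =>
    ((hint 1 hv k).const_mul _).add ((hint (-1) hv' k).const_mul _)
  rw [e3, integral_const_mul, integral_finsetSum _ fun k _ => hint2 k]
  congr 1
  refine Finset.sum_congr rfl fun k _ => ?_
  rw [integral_add ((hint 1 hv k).const_mul _) ((hint (-1) hv' k).const_mul _),
    integral_const_mul, integral_const_mul]

theorem integral_firstTerm_inr (hρ : 1 < ρ) (ht : ‖t‖ * ρ ^ 2 < 1) (hr : ∀ i, ρ⁻¹ < r i)
    (hr1 : ∀ i, r i < 1) (hinj : Function.Injective r) {e : Bool} (he : e ∈ E)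
    (f : ℂ → ℂ) (fs : List (ℂ → ℂ)) :
    ∫ x, firstTerm t V E f fs (.inr e) x ∂Measure.pi (fun i => circPair (r i)) =
      f (signVal e) * (∏ j ∈ E.erase e, (signVal e - t * signVal j) / (signVal e - signVal j)) *
      ∫ x, hlWord t (symVal x) fs (syms V (E.erase e)) * hlDensity t V (E.erase e) x
        ∂Measure.pi (fun i => circPair (r i)) := by
  have h0 : ∀ i, 0 < r i := fun i => (inv_pos.2 (by linarith)).trans (hr i)
  rw [← integral_const_mul]
  refine integral_congr_ae ?_
  filter_upwards [ae_radiusTorus h0] with x hx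
  exact firstTerm_inr hρ ht (radiusTorus_subset hρ hr hr1 hx) (symVal_injective h0 hr1 hinj hx) he
    f fs

/-! ### Evaluation -/

/-- A discrete product rule: the letters of `L` change from `p` to `q` one by one. -/
theorem sum_telescope {α : Type*} (d : α) (p q : α → ℂ) (L : List α) :
    ∑ k ∈ Finset.range L.length, (p (L.getD k d) - q (L.getD k d)) *
      (((L.take k).map q).prod * ((L.drop (k + 1)).map p).prod) =
    (L.map p).prod - (L.map q).prod := by
  induction L with
  | nil => simp
  | cons a L ih =>
    rw [List.length_cons, Finset.sum_range_succ']
    simp only [List.getD_cons_zero, List.take_zero, List.map_nil, List.prod_nil, zero_add,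
      List.drop_succ_cons, List.drop_zero, List.getD_cons_succ, List.take_succ_cons, List.map_cons,
      List.prod_cons]
    have : ∀ k, (p (L.getD k d) - q (L.getD k d)) *
        (q a * ((L.take k).map q).prod * ((L.drop (k + 1)).map p).prod) =
        q a * ((p (L.getD k d) - q (L.getD k d)) *
      (((L.take k).map q).prod * ((L.drop (k + 1)).map p).prod)) := fun k => by ring
    simp only [this]
    rw [← Finset.mul_sum, ih]
    ring

/-- The product of `f(1) + f(-1)` over the letters of a word. -/
def plusProd (L : List (ℂ → ℂ)) : ℂ := (L.map fun f => f 1 + f (-1)).prod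

/-- The product of `f(1) - f(-1)` over the letters of a word. -/
def minusProd (L : List (ℂ → ℂ)) : ℂ := (L.map fun f => f 1 - f (-1)).prod

/-- The factor `(1 + t) / 2` that the two signs `1` and `-1` contribute when both are present. -/
noncomputable def endConst (t : ℂ) (E : Finset Bool) : ℂ := if E.card = 2 then (1 + t) / 2 else 1

/-- The determinant of the component of the orthogonal group: `-1` if `-1` is an eigenvalue forced
by `E`. -/
def endSign (E : Finset Bool) : ℂ := if false ∈ E then -1 else 1

/-- The value of the integral of a symmetrized word against the density with `m` variables. -/
noncomputable def wordValue (t : ℂ) (m : ℕ) (E : Finset Bool) (L : List (ℂ → ℂ)) : ℂ :=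
  (m.factorial : ℂ) / (2 * (1 - t)) ^ m * endConst t E *
    ((plusProd L + endSign E * minusProd L) / 2)

theorem neg_map_prod {α : Type*} (L : List α) (p : α → ℂ) :
    (L.map fun a => -p a).prod = (-1) ^ L.length * (L.map p).prod := by
  induction L with
  | nil => simp
  | cons a L ih => simp only [List.map_cons, List.prod_cons, ih, List.length_cons, pow_succ]; ring

/-- As `kern t 1` is `-1` at `1` and `1` at `-1`, while `kern t (-1)` is `1` at `1` and `-1` at `-1`, the
letters between the two members of a pair interchange, up to a sign, their factors in `plusProd` and
`minusProd`. Both sums over `k` therefore telescope. -/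
theorem sum_wordValue_unpaired (h1 : 1 - t ≠ 0) (h2 : 1 + t ≠ 0) (a b σ : ℂ)
    (fs : List (ℂ → ℂ)) :
    ∑ k ∈ Finset.range fs.length,
      (a * fs.getD k 0 1 * ((plusProd (unpaired t 1 fs k) +
          σ * minusProd (unpaired t 1 fs k)) / 2) +
        b * fs.getD k 0 (-1) * ((plusProd (unpaired t (-1) fs k) +
          σ * minusProd (unpaired t (-1) fs k)) / 2)) =
    a / 4 * ((plusProd fs - (-1) ^ fs.length * minusProd fs) +
        σ * (minusProd fs - (-1) ^ fs.length * plusProd fs)) +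
      b / 4 * (1 + σ) * (plusProd fs - minusProd fs) := by
  have k11 : kern t 1 1 = -1 := by
    rw [kern, div_eq_iff (by simpa using h1)]; ring
  have k12 : kern t 1 (-1) = 1 := by
    rw [kern, div_eq_iff (by simpa using h2)]; ring
  have k21 : kern t (-1) 1 = 1 := by
    rw [kern, div_eq_iff (by simpa using h2)]; ring
  have k22 : kern t (-1) (-1) = -1 := by
    rw [kern, div_eq_iff (by simpa using h1)]; ring
  set P : (ℂ → ℂ) → ℂ := fun f => f 1 + f (-1) with hP
  set Q : (ℂ → ℂ) → ℂ := fun f => f 1 - f (-1) with hQ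
  have u1 : ∀ k, plusProd (unpaired t 1 fs k) =
      ((fs.take k).map fun f => -Q f).prod * ((fs.drop (k + 1)).map P).prod := by
    intro k
    simp only [plusProd, unpaired, List.map_append, List.map_map, List.prod_append]
    congr 3
    ext f; simp [hQ, k11, k12]; ring
  have u2 : ∀ k, minusProd (unpaired t 1 fs k) =
      ((fs.take k).map fun f => -P f).prod * ((fs.drop (k + 1)).map Q).prod := by
    intro k
    simp only [minusProd, unpaired, List.map_append, List.map_map, List.prod_append]
    congr 3
    ext f; simp [hP, k11, k12]; ring
  have u3 : ∀ k, plusProd (unpaired t (-1) fs k) =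
      ((fs.take k).map Q).prod * ((fs.drop (k + 1)).map P).prod := by
    intro k
    simp only [plusProd, unpaired, List.map_append, List.map_map, List.prod_append]
    congr 3
    ext f; simp [hQ, k21, k22]; ring
  have u4 : ∀ k, minusProd (unpaired t (-1) fs k) =
      ((fs.take k).map P).prod * ((fs.drop (k + 1)).map Q).prod := by
    intro k
    simp only [minusProd, unpaired, List.map_append, List.map_map, List.prod_append]
    congr 3
    ext f; simp [hP, k21, k22]
  have s1 := sum_telescope 0 P (fun f => -Q f) fs
  have s2 := sum_telescope 0 Q (fun f => -P f) fs
  have s3 := sum_telescope 0 P Q fs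
  have s4 := sum_telescope 0 Q P fs
  rw [neg_map_prod] at s1 s2
  have f1 : plusProd fs = (fs.map P).prod := rfl
  have f2 : minusProd fs = (fs.map Q).prod := rfl
  rw [f1, f2]
  have e : a / 4 * (((fs.map P).prod - (-1) ^ fs.length * (fs.map Q).prod) +
        σ * ((fs.map Q).prod - (-1) ^ fs.length * (fs.map P).prod)) +
      b / 4 * (1 + σ) * ((fs.map P).prod - (fs.map Q).prod) =
      a / 4 * (((fs.map P).prod - (-1) ^ fs.length * (fs.map Q).prod)) +
        a / 4 * σ * ((fs.map Q).prod - (-1) ^ fs.length * (fs.map P).prod) +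
      b / 4 * ((fs.map P).prod - (fs.map Q).prod) +
      -(b / 4 * σ) * ((fs.map Q).prod - (fs.map P).prod) := by ring
  rw [e, ← s1, ← s2, ← s3, ← s4]
  simp only [Finset.mul_sum]
  rw [← Finset.sum_add_distrib, ← Finset.sum_add_distrib, ← Finset.sum_add_distrib]
  refine Finset.sum_congr rfl fun k _ => ?_
  rw [u1, u2, u3, u4]
  simp only [hP, hQ]
  ring

/-- The recursion satisfied by the values of the integrals. -/
theorem wordValue_cons (m : ℕ) (E : Finset Bool) (f : ℂ → ℂ) (fs : List (ℂ → ℂ))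
    (hl : fs.length + 1 = 2 * m + E.card) :
    (if m = 0 then 0 else (m.factorial : ℂ) / (2 * (1 - t)) ^ m) * (endConst t E *
      (f 1 / 4 * ((plusProd fs - (-1) ^ fs.length * minusProd fs) +
        endSign E * (minusProd fs - (-1) ^ fs.length * plusProd fs)) +
      f (-1) / 4 * (1 + endSign E) * (plusProd fs - minusProd fs))) +
      ∑ e ∈ E, f (signVal e) * (∏ j ∈ E.erase e,
          (signVal e - t * signVal j) / (signVal e - signVal j)) *
          wordValue t m (E.erase e) fs = wordValue t m E (f :: fs) := by
  have hcons1 : plusProd (f :: fs) = (f 1 + f (-1)) * plusProd fs := by simp [plusProd]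
  have hcons2 : minusProd (f :: fs) = (f 1 - f (-1)) * minusProd fs := by simp [minusProd]
  have hE : ∀ E : Finset Bool, E = ∅ ∨ E = {true} ∨ E = {false} ∨ E = {true, false} := by decide
  have er1 : ({true, false} : Finset Bool).erase true = {false} := by decide
  have er2 : ({true, false} : Finset Bool).erase false = {true} := by decide
  have c0 : endConst t ∅ = 1 := by simp [endConst]
  have c1 : endConst t {true} = 1 := by simp [endConst]
  have c2 : endConst t {false} = 1 := by simp [endConst]
  have c3 : endConst t {true, false} = (1 + t) / 2 := by simp [endConst]
  have d0 : endSign ∅ = 1 := by simp [endSign]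
  have d1 : endSign {true} = 1 := by simp [endSign]
  have d2 : endSign {false} = -1 := by simp [endSign]
  have d3 : endSign {true, false} = -1 := by simp [endSign]
  have v1 : signVal true = 1 := rfl
  have v2 : signVal false = -1 := rfl
  have hnil : m = 0 → E.card = 1 → fs = [] := fun h h' =>
    List.length_eq_zero_iff.1 (by omega)
  simp only [wordValue, hcons1, hcons2]
  generalize hK : (m.factorial : ℂ) / (2 * (1 - t)) ^ m = K
  rcases hE E with rfl | rfl | rfl | rfl
  · have hm : m ≠ 0 := by rintro rfl; simp at hl
    have hodd : (-1 : ℂ) ^ fs.length = -1 := Odd.neg_one_pow ⟨m - 1, by simp at hl; omega⟩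
    rw [if_neg hm, Finset.sum_empty, hodd, c0, d0]
    ring
  · have heven : (-1 : ℂ) ^ fs.length = 1 := Even.neg_one_pow ⟨m, by simp at hl; omega⟩
    rw [Finset.sum_singleton, Finset.erase_singleton, Finset.prod_empty, heven, c0, c1, d0, d1, v1]
    split_ifs with hm
    · rw [hnil hm rfl]
      simp only [plusProd, minusProd, List.map_nil, List.prod_nil]
      ring
    · ring
  · have heven : (-1 : ℂ) ^ fs.length = 1 := Even.neg_one_pow ⟨m, by simp at hl; omega⟩
    rw [Finset.sum_singleton, Finset.erase_singleton, Finset.prod_empty, heven, c0, c2, d0, d2, v2]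
    split_ifs with hm
    · rw [hnil hm rfl]
      simp only [plusProd, minusProd, List.map_nil, List.prod_nil]
      ring
    · ring
  · have hodd : (-1 : ℂ) ^ fs.length = -1 := Odd.neg_one_pow ⟨m, by simp at hl; omega⟩
    rw [Finset.sum_pair (by decide), er1, er2, Finset.prod_singleton, Finset.prod_singleton, hodd,
      c1, c2, c3, d1, d2, d3, v1, v2]
    ring

/-- At `v = ±1` the factors `kern t v` are inverse to each other at inverse points, so `PairHol` is
preserved by `unpaired`. -/
theorem kern_mul_kern_inv {ρ : ℝ} (hρ : 1 < ρ) (ht : ‖t‖ * ρ ^ 2 < 1) {e : ℂ} (he : e * e = 1)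
    (hn : ‖e‖ < ρ) {z : ℂ} (hz : z ∈ annulus ρ) : kern t e z * kern t e z⁻¹ = 1 := by
  have h0 := annulus_ne_zero hρ hz
  have h1 := one_sub_ne_zero hρ ht hn hz.2
  have h2 := one_sub_ne_zero hρ ht hn (inv_mem_annulus hρ hz).2
  rw [kern, kern, div_mul_div_comm, div_eq_one_iff_eq
    (by rw [mul_assoc, mul_assoc]; exact mul_ne_zero h1 h2)]
  have h3 : z * z⁻¹ = 1 := mul_inv_cancel₀ h0
  linear_combination (1 - t ^ 2) * (z * z⁻¹) * he + (1 - t ^ 2) * h3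

theorem pairwise_unpaired {ρ : ℝ} (hρ : 1 < ρ) (ht : ‖t‖ * ρ ^ 2 < 1) {e : ℂ} (he : e * e = 1)
    (hn : ‖e‖ < ρ) {fs : List (ℂ → ℂ)} (h : fs.Pairwise (PairHol ρ)) (k : ℕ) :
    (unpaired t e fs k).Pairwise (PairHol ρ) := by
  rw [unpaired, List.pairwise_append]
  refine ⟨?_, h.sublist (List.drop_sublist _ _), ?_⟩
  · rw [List.pairwise_map]
    refine (h.sublist (List.take_sublist k fs)).imp ?_
    rintro f g ⟨H, hd, hH⟩
    refine ⟨H, hd, fun z hz => ?_⟩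
    have := kern_mul_kern_inv hρ ht he hn hz
    rw [hH z hz]
    simp only [Pi.mul_apply]
    linear_combination (-(z * f z * g z⁻¹)) * this
  · intro f hf g hg
    obtain ⟨f', hf', rfl⟩ := List.mem_map.1 hf
    have hsplit : fs = fs.take k ++ fs.drop k := (List.take_append_drop k fs).symm
    rw [hsplit, List.pairwise_append] at h
    have hg' : g ∈ fs.drop k := by
      rw [← List.drop_drop] at hg; exact List.mem_of_mem_drop hg
    obtain ⟨H, hd, hH⟩ := h.2.2 f' hf' g hg'
    refine ⟨fun z => H z * kern t e z, hd.mul (differentiableOn_kern_right hρ ht hn), ?_⟩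
    intro z hz
    simp only [hH z hz, Pi.mul_apply]
    ring

/-- The integral of a symmetrized word whose letters satisfy `PairHol`. The induction removes the
first letter together with its symbol: a sign, or a variable, which is then integrated out and
evaluated at `±1`. -/
theorem integral_hlWord (hρ : 1 < ρ) (ht : ‖t‖ * ρ ^ 2 < 1) (hr : ∀ i, ρ⁻¹ < r i)
    (hr1 : ∀ i, r i < 1) (hinj : Function.Injective r) (V : Finset (Fin n)) (E : Finset Bool)
    (L : List (ℂ → ℂ)) (hl : L.length = 2 * V.card + E.card)
    (hL : ∀ f ∈ L, ContinuousOn f (annulus ρ)) (hp : L.Pairwise (PairHol ρ)) :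
    ∫ x, hlWord t (symVal x) L (syms V E) * hlDensity t V E x
      ∂Measure.pi (fun i => circPair (r i)) = wordValue t V.card E L := by
  have h0 : ∀ i, 0 < r i := fun i => (inv_pos.2 (by linarith)).trans (hr i)
  have hv : ‖(1 : ℂ)‖ < ρ := by simpa using hρ
  have hv' : ‖(-1 : ℂ)‖ < ρ := by simpa using hρ
  have ht1 : 1 - t ≠ 0 := by simpa using one_sub_ne_zero hρ ht hv hv
  have ht2 : 1 + t ≠ 0 := by simpa using one_sub_ne_zero hρ ht hv hv'
  induction hN : L.length using Nat.strong_induction_on generalizing L V E with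
  | _ N ih =>
  cases L with
  | nil =>
    have hV : V = ∅ := Finset.card_eq_zero.1 (by simp at hl; omega)
    have hE : E = ∅ := Finset.card_eq_zero.1 (by simp at hl; omega)
    subst hV hE
    simp [hlWord, hlDensity, wordValue, plusProd, minusProd, endConst, endSign]
  | cons f fs =>
    rw [List.length_cons] at hl hN
    rw [List.pairwise_cons] at hp
    have hf := hL f (by simp)
    have hfs : ∀ g ∈ fs, ContinuousOn g (annulus ρ) := fun g hg => hL g (by simp [hg])
    have hsum : ∀ x, hlWord t (symVal x) (f :: fs) (syms V E) * hlDensity t V E x =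
        ∑ i ∈ V, (firstTerm t V E f fs (.inl (i, true)) x +
          firstTerm t V E f fs (.inl (i, false)) x) +
        ∑ e ∈ E, firstTerm t V E f fs (.inr e) x := by
      intro x
      rw [← sum_syms (fun p => firstTerm t V E f fs p x), hlWord, Finset.sum_mul]
      rfl
    have hint : ∀ p, Integrable (firstTerm t V E f fs p) (Measure.pi fun i => circPair (r i)) :=
      fun p => integrable_radiusTorus h0 (continuousOn_firstTerm hρ ht hr hr1 hinj p hf hfs)
    simp only [hsum]
    have hint2 : ∀ i, Integrable (fun x => firstTerm t V E f fs (.inl (i, true)) x +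
        firstTerm t V E f fs (.inl (i, false)) x) (Measure.pi fun i => circPair (r i)) :=
      fun i => (hint _).add (hint _)
    rw [integral_add (integrable_finsetSum _ fun i _ => hint2 i)
      (integrable_finsetSum _ fun e _ => hint _), integral_finsetSum _ fun i _ => hint2 i,
      integral_finsetSum _ fun e _ => hint _]
    have hlen : ∀ v k, k < fs.length → (unpaired t v fs k).length = fs.length - 1 := by
      intro v k hk
      simp [unpaired]; omega
    have hvar : ∀ i ∈ V, ∫ x, (firstTerm t V E f fs (.inl (i, true)) x +
        firstTerm t V E f fs (.inl (i, false)) x) ∂Measure.pi (fun i => circPair (r i)) =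
        1 / (2 * (1 - t)) * (((V.card - 1).factorial : ℂ) / (2 * (1 - t)) ^ (V.card - 1) *
          endConst t E) * (f 1 / 4 * ((plusProd fs - (-1) ^ fs.length * minusProd fs) +
        endSign E * (minusProd fs - (-1) ^ fs.length * plusProd fs)) +
      f (-1) / 4 * (1 + endSign E) * (plusProd fs - minusProd fs)) := by
      intro i hi
      have hcard := Finset.card_pos.2 ⟨i, hi⟩
      have hW : ∀ v : ℂ, v * v = 1 → ‖v‖ < ρ → ∀ k ∈ Finset.range fs.length,
          ∫ x, hlWord t (symVal x) (unpaired t v fs k) (syms (V.erase i) E) *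
            hlDensity t (V.erase i) E x ∂Measure.pi (fun i => circPair (r i)) =
          wordValue t (V.card - 1) E (unpaired t v fs k) := by
        intro v hvv hvn k hk
        have hlk := hlen v k (Finset.mem_range.1 hk)
        rw [← Finset.card_erase_of_mem hi]
        refine ih (fs.length - 1) (by omega) (V.erase i) E (unpaired t v fs k) ?_
          (continuousOn_of_mem_unpaired hρ ht hvn hfs k)
          (pairwise_unpaired hρ ht hvv hvn hp.2 k) hlk
        rw [hlk, Finset.card_erase_of_mem hi]; omega
      rw [integral_add (hint _) (hint _),
        integral_firstTerm_inl hρ ht hr hr1 hinj hi true hf hfs hp.1 hl,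
        integral_firstTerm_inl hρ ht hr hr1 hinj hi false hf hfs hp.1 hl,
        ← sum_wordValue_unpaired ht1 ht2 (f 1) (f (-1)) (endSign E) fs, ← mul_add,
        ← Finset.sum_add_distrib, Finset.mul_sum, Finset.mul_sum]
      refine Finset.sum_congr rfl fun k hk => ?_
      rw [hW 1 (by norm_num) hv k hk, hW (-1) (by norm_num) hv' k hk, wordValue, wordValue]
      field_simp
      ring
    have hsign : ∀ e ∈ E, ∫ x, firstTerm t V E f fs (.inr e) x
        ∂Measure.pi (fun i => circPair (r i)) = f (signVal e) * (∏ j ∈ E.erase e,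
          (signVal e - t * signVal j) / (signVal e - signVal j)) *
          wordValue t V.card (E.erase e) fs := by
      intro e he
      have hcard := Finset.card_pos.2 ⟨e, he⟩
      rw [integral_firstTerm_inr hρ ht hr hr1 hinj he, ih fs.length (by omega) V (E.erase e) fs
        (by rw [Finset.card_erase_of_mem he]; omega) hfs hp.2 rfl]
    rw [Finset.sum_congr rfl hvar, Finset.sum_congr rfl hsign, Finset.sum_const, nsmul_eq_mul]
    have hK : (V.card : ℂ) * (1 / (2 * (1 - t)) * (((V.card - 1).factorial : ℂ) /
        (2 * (1 - t)) ^ (V.card - 1))) =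
        if V.card = 0 then 0 else (V.card.factorial : ℂ) / (2 * (1 - t)) ^ V.card := by
      rcases hm : V.card with _ | m
      · simp
      · simp only [Nat.add_sub_cancel, Nat.factorial_succ, Nat.succ_ne_zero, if_false]
        push_cast
        field_simp
        ring
    have hX : ∀ A B C : ℂ, (V.card : ℂ) * (1 / (2 * (1 - t)) * (A * B) * C) =
        (V.card : ℂ) * (1 / (2 * (1 - t)) * A) * (B * C) := fun A B C => by ring
    rw [hX, hK]
    exact wordValue_cons V.card E f fs hl

end Torus

/-! ### Raising letters and Rogers--Szegő polynomials -/

theorem one_sub_pow_ne_zero {t : ℂ} (ht : ‖t‖ < 1) {j : ℕ} (hj : j ≠ 0) : 1 - t ^ j ≠ 0 := by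
  intro h
  have h1 : ‖t‖ ^ j = 1 := by rw [← norm_pow, ← sub_eq_zero.1 h, norm_one]
  exact (pow_lt_one₀ (norm_nonneg t) ht hj).ne h1

theorem tFactorial_succ (t : ℂ) (m : ℕ) :
    tFactorial t (m + 1) = (1 - t ^ (m + 1)) / (1 - t) * tFactorial t m := by
  rw [tFactorial, tFactorial, ← Finset.insert_Icc_right_eq_Icc_add_one (by omega),
      Finset.prod_insert (by simp)]

theorem tFactorial_ne_zero {t : ℂ} (ht : ‖t‖ < 1) (m : ℕ) : tFactorial t m ≠ 0 := by
  refine Finset.prod_ne_zero_iff.2 fun j hj => div_ne_zero ?_ ?_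
  · exact one_sub_pow_ne_zero ht (by have := (Finset.mem_Icc.1 hj).1; omega)
  · simpa using one_sub_pow_ne_zero ht one_ne_zero

theorem tBinomial_zero_right {t : ℂ} (ht : ‖t‖ < 1) (m : ℕ) : tBinomial t m 0 = 1 := by
  have := tFactorial_ne_zero ht m
  have h0 : tFactorial t 0 = 1 := by simp [tFactorial]
  simp [tBinomial, h0, this]

theorem tBinomial_self {t : ℂ} (ht : ‖t‖ < 1) (m : ℕ) : tBinomial t m m = 1 := by
  have := tFactorial_ne_zero ht m
  have h0 : tFactorial t 0 = 1 := by simp [tFactorial]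
  simp [tBinomial, h0, this]

theorem tBinomial_succ_succ {t : ℂ} (ht : ‖t‖ < 1) (m k : ℕ) :
    tBinomial t (m + 1) (k + 1) = t ^ (k + 1) * tBinomial t m (k + 1) + tBinomial t m k := by
  rcases lt_trichotomy k m with h | rfl | h
  · obtain ⟨d, rfl⟩ := Nat.exists_eq_add_of_lt h
    have e1 : k + d + 1 + 1 - (k + 1) = d + 1 := by omega
    have e2 : k + d + 1 - (k + 1) = d := by omega
    have e3 : k + d + 1 - k = d + 1 := by omega
    have f1 := tFactorial_ne_zero ht k
    have f2 := tFactorial_ne_zero ht d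
    have h1 : (1 : ℂ) - t ≠ 0 := by simpa using one_sub_pow_ne_zero ht one_ne_zero
    have h2 := one_sub_pow_ne_zero ht (Nat.succ_ne_zero k)
    have h3 := one_sub_pow_ne_zero ht (Nat.succ_ne_zero d)
    rw [tBinomial, tBinomial, tBinomial, if_pos (by omega), if_pos (by omega), if_pos (by omega),
      e1, e2, e3, tFactorial_succ t (k + d + 1), tFactorial_succ t k, tFactorial_succ t d]
    generalize tFactorial t (k + d + 1) = A
    simp only [Nat.succ_eq_add_one] at h2 h3
    field_simp
    ring
  · rw [tBinomial_self ht, tBinomial_self ht]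
    simp [tBinomial]
  · rw [tBinomial, tBinomial, tBinomial, if_neg (by omega), if_neg (by omega), if_neg (by omega)]
    ring

/-- The homogeneous Rogers--Szegő polynomial `∑_k [m choose k]_t y^k w^(m - k)`. -/
noncomputable def rsHom (t : ℂ) (m : ℕ) (y w : ℂ) : ℂ :=
  ∑ k ∈ Finset.range (m + 1), tBinomial t m k * (y ^ k * w ^ (m - k))

theorem rsHom_zero {t : ℂ} (ht : ‖t‖ < 1) (y w : ℂ) : rsHom t 0 y w = 1 := by
  simp [rsHom, tBinomial_self ht]

/-- The recursion in the form in which it arises when one more letter is prefixed to a word. -/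
theorem rsHom_succ {t : ℂ} (ht : ‖t‖ < 1) (m : ℕ) (y w : ℂ) :
    rsHom t (m + 1) y w = w * rsHom t m (t * y) w + y * rsHom t m y w := by
  have h1 : w * rsHom t m (t * y) w = ∑ k ∈ Finset.range (m + 2),
      tBinomial t m k * (t ^ k * (y ^ k * w ^ (m + 1 - k))) := by
    rw [Finset.sum_range_succ, rsHom, Finset.mul_sum]
    have : tBinomial t m (m + 1) = 0 := by simp [tBinomial]
    rw [this, zero_mul, add_zero]
    refine Finset.sum_congr rfl fun k hk => ?_
    have hk' : k ≤ m := by have := Finset.mem_range.1 hk; omega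
    rw [Nat.succ_sub hk', pow_succ, mul_pow]
    ring
  rw [h1, Finset.sum_range_succ', rsHom, Finset.sum_range_succ', rsHom, Finset.mul_sum,
    tBinomial_zero_right ht, tBinomial_zero_right ht]
  simp only [tBinomial_succ_succ ht, Nat.succ_sub_succ]
  rw [add_right_comm, ← Finset.sum_add_distrib]
  congr 1
  · exact Finset.sum_congr rfl fun k _ => by ring
  · ring

theorem rsHom_mul (t : ℂ) (m : ℕ) (c y w : ℂ) :
    rsHom t m (c * y) (c * w) = c ^ m * rsHom t m y w := by
  rw [rsHom, rsHom, Finset.mul_sum]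
  refine Finset.sum_congr rfl fun k hk => ?_
  have hk' : k + (m - k) = m := by have := Finset.mem_range.1 hk; omega
  have e : c ^ m = c ^ k * c ^ (m - k) := by rw [← pow_add, hk']
  rw [mul_pow, mul_pow, e]
  ring

theorem rsHom_one (t : ℂ) (m : ℕ) (z : ℂ) : rsHom t m z 1 = rogersSzego m z t := by
  rw [rsHom, rogersSzego]
  exact Finset.sum_congr rfl fun k _ => by ring

theorem rsHom_eq {t : ℂ} (m : ℕ) (y : ℂ) {w : ℂ} (hw : w ≠ 0) :
    rsHom t m y w = w ^ m * rogersSzego m (y / w) t := by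
  rw [← rsHom_one, ← rsHom_mul, mul_one, mul_div_cancel₀ _ hw]

theorem rsHom_zero_right {t : ℂ} (ht : ‖t‖ < 1) (m : ℕ) (y : ℂ) : rsHom t m y 0 = y ^ m := by
  rw [rsHom, Finset.sum_eq_single m]
  · simp [tBinomial_self ht]
  · intro k hk hkm
    have : m - k ≠ 0 := by have := Finset.mem_range.1 hk; omega
    rw [zero_pow this]; ring
  · intro h; simp at h

/-- The signed sum of `Φ` over all words obtained from a word of exponents by raising some of its
letters by one; each raise contributes a factor `-β`. -/
def raiseSum (β : ℂ) : (List ℕ → ℂ) → List ℕ → ℂ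
  | Φ, [] => Φ []
  | Φ, a :: l => raiseSum β (fun w => Φ (a :: w)) l - β * raiseSum β (fun w => Φ ((a + 1) :: w)) l

theorem straighten_replicate {t : ℂ} {Φ : List ℕ → ℂ}
    (h : ∀ pre post a, Φ (pre ++ a :: (a + 1) :: post) = t * Φ (pre ++ (a + 1) :: a :: post))
    (a k : ℕ) (pre post : List ℕ) :
    Φ (pre ++ a :: (List.replicate k (a + 1) ++ post)) =
      t ^ k * Φ (pre ++ (List.replicate k (a + 1) ++ a :: post)) := by
  induction k generalizing pre with
  | zero => simp
  | succ k ih =>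
    rw [List.replicate_succ, List.cons_append, h]
    have := ih (pre ++ [a + 1])
    simp only [List.append_assoc, List.cons_append, List.nil_append] at this ⊢
    rw [this, pow_succ]
    ring

theorem exists_replicate_append {a : ℕ} {w : List ℕ} (hw : w.Pairwise (· ≥ ·))
    (h : ∀ e ∈ w, e ≤ a + 1) : ∃ k w', w = List.replicate k (a + 1) ++ w' ∧ (∀ e ∈ w', e ≤ a) ∧
      w'.Pairwise (· ≥ ·) := by
  induction w with
  | nil => exact ⟨0, [], by simp, by simp, List.Pairwise.nil⟩
  | cons b w ih =>
    rw [List.pairwise_cons] at hw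
    rcases Nat.lt_or_ge b (a + 1) with hb | hb
    · refine ⟨0, b :: w, by simp, ?_, List.pairwise_cons.2 hw⟩
      intro e he
      rcases List.mem_cons.1 he with rfl | he
      · omega
      · have := hw.1 e he; omega
    · obtain ⟨k, w', rfl, h1, h2⟩ := ih hw.2 fun e he => h e (List.mem_cons_of_mem _ he)
      have : b = a + 1 := le_antisymm (h b (by simp)) hb
      exact ⟨k + 1, w', by rw [this, List.replicate_succ, List.cons_append], h1, h2⟩

/-- The product of homogeneous Rogers--Szegő polynomials that results from raising the letters of
a word when letters have the weights `χ`. -/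
noncomputable def rsProd (t β : ℂ) (B : ℕ) (χ : ℕ → ℂ) (l : List ℕ) : ℂ :=
  ∏ i ∈ Finset.range B, rsHom t (l.count i) (-β * χ (i + 1)) (χ i)

theorem rsProd_cons {t β : ℂ} (ht : ‖t‖ < 1) {B a : ℕ} (ha : a < B) (χ : ℕ → ℂ) {l : List ℕ}
    (hl : ∀ e ∈ l, e ≤ a) :
    χ a * rsProd t β B (Function.update χ (a + 1) (t * χ (a + 1))) l -
      β * (χ (a + 1) * rsProd t β B χ l) = rsProd t β B χ (a :: l) := by
  have ha' := Finset.mem_range.2 ha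
  have hc : l.count (a + 1) = 0 := List.count_eq_zero.2 fun h => by have := hl _ h; omega
  have h1 : ∏ i ∈ (Finset.range B).erase a, rsHom t (l.count i)
      (-β * Function.update χ (a + 1) (t * χ (a + 1)) (i + 1))
      (Function.update χ (a + 1) (t * χ (a + 1)) i) =
      ∏ i ∈ (Finset.range B).erase a, rsHom t (l.count i) (-β * χ (i + 1)) (χ i) := by
    refine Finset.prod_congr rfl fun i hi => ?_
    have hia := Finset.ne_of_mem_erase hi
    rw [Function.update_of_ne (by omega)]
    rcases eq_or_ne i (a + 1) with rfl | h
    · rw [hc, rsHom_zero ht, rsHom_zero ht]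
    · rw [Function.update_of_ne h]
  have h2 : ∏ i ∈ (Finset.range B).erase a, rsHom t ((a :: l).count i) (-β * χ (i + 1)) (χ i) =
      ∏ i ∈ (Finset.range B).erase a, rsHom t (l.count i) (-β * χ (i + 1)) (χ i) := by
    refine Finset.prod_congr rfl fun i hi => ?_
    rw [List.count_cons_of_ne (Finset.ne_of_mem_erase hi).symm]
  rw [rsProd, rsProd, rsProd, ← Finset.mul_prod_erase _ _ ha', ← Finset.mul_prod_erase _ _ ha',
    ← Finset.mul_prod_erase _ _ ha', h1, h2, List.count_cons_self, rsHom_succ ht,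
    Function.update_self, Function.update_of_ne (by omega)]
  have e : -β * (t * χ (a + 1)) = t * (-β * χ (a + 1)) := by ring
  rw [e]
  ring

/-- Raising the letters of a weakly decreasing word, for a functional that obeys the straightening
rule and is a combination of two multiplicative functionals on weakly decreasing words. Prefixing a
letter `a` preserves these assumptions: by straightening, only the weights of the letter `a + 1` are
multiplied by `t`. -/
theorem raiseSum_eq {t β : ℂ} (ht : ‖t‖ < 1) {B : ℕ} {l : List ℕ} (hl : l.Pairwise (· ≥ ·))
    {M : ℕ} (hM : ∀ e ∈ l, e ≤ M) (hB : M < B) {Φ : List ℕ → ℂ}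
    (hΦ : ∀ pre post a, Φ (pre ++ a :: (a + 1) :: post) = t * Φ (pre ++ (a + 1) :: a :: post))
    {c d : ℂ} {χ ψ : ℕ → ℂ} (h : ∀ w : List ℕ, w.length = l.length → w.Pairwise (· ≥ ·) →
      (∀ e ∈ w, e ≤ M + 1) → Φ w = c * (w.map χ).prod + d * (w.map ψ).prod) :
    raiseSum β Φ l = c * rsProd t β B χ l + d * rsProd t β B ψ l := by
  induction l generalizing M Φ c d χ ψ with
  | nil =>
    rw [raiseSum, h [] rfl List.Pairwise.nil (by simp)]
    simp [rsProd, rsHom_zero ht]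
  | cons a l ih =>
    rw [List.pairwise_cons] at hl
    have haM : a ≤ M := hM a (by simp)
    have hprod : ∀ (χ : ℕ → ℂ) (w' : List ℕ), (∀ e ∈ w', e ≤ a) →
        (w'.map (Function.update χ (a + 1) (t * χ (a + 1)))).prod = (w'.map χ).prod := by
      intro χ w' hw'
      congr 1
      refine List.map_congr_left fun e he => ?_
      rw [Function.update_of_ne (by have := hw' e he; omega)]
    have h1 : ∀ w : List ℕ, w.length = l.length → w.Pairwise (· ≥ ·) → (∀ e ∈ w, e ≤ a + 1) →
        Φ (a :: w) = (c * χ a) * (w.map (Function.update χ (a + 1) (t * χ (a + 1)))).prod +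
          (d * ψ a) * (w.map (Function.update ψ (a + 1) (t * ψ (a + 1)))).prod := by
      intro w hwl hw hwa
      -- Only letters `a + 1` can be larger than `a`; each of them costs a factor `t`.
      obtain ⟨k, w', rfl, hw1, hw2⟩ := exists_replicate_append hw hwa
      have hs := straighten_replicate hΦ a k [] w'
      simp only [List.nil_append] at hs
      rw [hs, h]
      · simp only [List.map_append, List.map_cons, List.prod_append, List.prod_cons, hprod _ w' hw1,
          List.map_replicate, List.prod_replicate, Function.update_self, mul_pow]
        ring
      · simp only [List.length_append, List.length_replicate, List.length_cons] at hwl ⊢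
        omega
      · rw [List.pairwise_append] at hw ⊢
        refine ⟨hw.1, List.pairwise_cons.2 ⟨hw1, hw2⟩, fun x hx y hy => ?_⟩
        rw [List.eq_of_mem_replicate hx]
        rcases List.mem_cons.1 hy with rfl | hy
        · omega
        · have := hw1 y hy; omega
      · intro e he
        simp only [List.mem_append, List.mem_cons] at he
        rcases he with he | rfl | he
        · rw [List.eq_of_mem_replicate he]; omega
        · omega
        · have := hw1 e he; omega
    have h2 : ∀ w : List ℕ, w.length = l.length → w.Pairwise (· ≥ ·) → (∀ e ∈ w, e ≤ a + 1) →
        Φ ((a + 1) :: w) = (c * χ (a + 1)) * (w.map χ).prod +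
          (d * ψ (a + 1)) * (w.map ψ).prod := by
      intro w hwl hw hwa
      rw [h _ (by simp [hwl]) (List.pairwise_cons.2 ⟨hwa, hw⟩)]
      · simp only [List.map_cons, List.prod_cons]; ring
      · intro e he
        rcases List.mem_cons.1 he with rfl | he
        · omega
        · have := hwa e he; omega
    rw [raiseSum, ih hl.2 hl.1 (by omega) (fun pre post b => hΦ (a :: pre) post b) h1,
      ih hl.2 hl.1 (by omega) (fun pre post b => hΦ ((a + 1) :: pre) post b) h2,
      ← rsProd_cons ht (by omega) χ hl.1, ← rsProd_cons ht (by omega) ψ hl.1]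
    ring

/-! ### Products over the parts of a partition -/

theorem count_ofFn {N : ℕ} (lam : Fin N → ℕ) (k : ℕ) :
    (List.ofFn lam).count k = partMult lam k := by
  induction N with
  | zero => simp [partMult]
  | succ N ih =>
    rw [List.ofFn_succ, List.count_cons, ih, partMult, partMult, Fin.card_filter_univ_succ]
    by_cases h : lam 0 = k <;> simp [h]

theorem prod_range_two_mul (g : ℕ → ℂ) (B : ℕ) : ∏ i ∈ Finset.range (2 * B), g i =
    (∏ i ∈ Finset.range B, g (2 * i)) * ∏ i ∈ Finset.range B, g (2 * i + 1) := by
  induction B with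
  | zero => simp
  | succ B ih =>
    rw [mul_add, mul_one, Finset.prod_range_succ, Finset.prod_range_succ, ih,
      Finset.prod_range_succ, Finset.prod_range_succ]
    ring

theorem finprod_eq_prod_range {B : ℕ} {g : ℕ → ℂ} (h : ∀ i, B ≤ i → g i = 1) :
    ∏ᶠ i, g i = ∏ i ∈ Finset.range B, g i := by
  refine finprod_eq_prod_of_mulSupport_subset _ fun i hi => ?_
  rw [Finset.coe_range, Set.mem_Iio]
  by_contra hB
  exact hi (h i (not_lt.1 hB))

theorem partMult_eq_zero {N : ℕ} {lam : Fin N → ℕ} {k : ℕ} (h : ∀ j, lam j < k) :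
    ∀ i, k ≤ i → partMult lam i = 0 := by
  intro i hi
  rw [partMult, Finset.card_eq_zero, Finset.filter_eq_empty_iff]
  intro j _ hj
  have := h j
  omega

theorem sum_partMult {N B : ℕ} {lam : Fin N → ℕ} (h : ∀ j, lam j < 2 * B) :
    ∑ i ∈ Finset.range (2 * B), partMult lam i = N := by
  have := Finset.card_eq_sum_card_fiberwise (f := lam) (s := Finset.univ)
    (t := Finset.range (2 * B)) fun j _ => by simpa using h j
  rw [Finset.card_univ, Fintype.card_fin] at this
  exact this.symm

theorem oddParts_eq {N B : ℕ} {lam : Fin N → ℕ} (h : ∀ j, lam j < 2 * B) :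
    oddParts lam = ∑ i ∈ Finset.range B, partMult lam (2 * i + 1) := by
  rw [oddParts, Finset.card_eq_sum_card_fiberwise (f := fun j => lam j / 2)
    (t := Finset.range B) fun j _ => by
      have := h j
      simp only [Finset.coe_range, Set.mem_Iio]; omega]
  refine Finset.sum_congr rfl fun i _ => ?_
  rw [partMult, Finset.filter_filter]
  congr 1
  refine Finset.filter_congr fun j _ => ?_
  rw [Nat.odd_iff]
  omega

theorem evenParts_eq {N B : ℕ} {lam : Fin N → ℕ} (h : ∀ j, lam j < 2 * B) :
    evenParts lam = ∑ i ∈ Finset.range B, partMult lam (2 * i) := by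
  rw [evenParts, Finset.card_eq_sum_card_fiberwise (f := fun j => lam j / 2)
    (t := Finset.range B) fun j _ => by
      have := h j
      simp only [Finset.coe_range, Set.mem_Iio]; omega]
  refine Finset.sum_congr rfl fun i _ => ?_
  rw [partMult, Finset.filter_filter]
  congr 1
  refine Finset.filter_congr fun j _ => ?_
  rw [Nat.even_iff]
  omega

/-- The values at `±1` of `z^a (1 - α z)`: their sum. -/
noncomputable def plusWeight (α : ℂ) (a : ℕ) : ℂ := (1 - α) + (-1) ^ a * (1 + α)

/-- The values at `±1` of `z^a (1 - α z)`: their difference. -/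
noncomputable def minusWeight (α : ℂ) (a : ℕ) : ℂ := (1 - α) - (-1) ^ a * (1 + α)

theorem plusWeight_even (α : ℂ) (i : ℕ) : plusWeight α (2 * i) = 2 := by
  rw [plusWeight, pow_mul]; norm_num

theorem plusWeight_odd (α : ℂ) (i : ℕ) : plusWeight α (2 * i + 1) = 2 * -α := by
  rw [plusWeight, pow_succ, pow_mul]; norm_num; ring

theorem minusWeight_even (α : ℂ) (i : ℕ) : minusWeight α (2 * i) = 2 * -α := by
  rw [minusWeight, pow_mul]; norm_num; ring

theorem minusWeight_odd (α : ℂ) (i : ℕ) : minusWeight α (2 * i + 1) = 2 := by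
  rw [minusWeight, pow_succ, pow_mul]; norm_num; ring

/-- The polynomial in `α` that `oddTerm` agrees with for `α ≠ 0`. -/
noncomputable def oddPoly {N : ℕ} (α β t : ℂ) (B : ℕ) (lam : Fin N → ℕ) : ℂ :=
  (∏ i ∈ Finset.range B, rogersSzego (partMult lam (2 * i)) (α * β) t) *
    ∏ i ∈ Finset.range B, rsHom t (partMult lam (2 * i + 1)) (-β) (-α)

/-- The polynomial in `α` that `evenTerm` agrees with for `α ≠ 0`. -/
noncomputable def evenPoly {N : ℕ} (α β t : ℂ) (B : ℕ) (lam : Fin N → ℕ) : ℂ :=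
  (∏ i ∈ Finset.range B, rogersSzego (partMult lam (2 * i + 1)) (α * β) t) *
    ∏ i ∈ Finset.range B, rsHom t (partMult lam (2 * i)) (-β) (-α)

section Parts

variable {N B : ℕ} {lam : Fin N → ℕ} {α β t : ℂ}

theorem two_pow_eq (h : ∀ j, lam j < 2 * B) :
    (2 : ℂ) ^ N = (∏ i ∈ Finset.range B, 2 ^ partMult lam (2 * i)) *
      ∏ i ∈ Finset.range B, 2 ^ partMult lam (2 * i + 1) := by
  rw [← prod_range_two_mul fun i => (2 : ℂ) ^ partMult lam i, Finset.prod_pow_eq_pow_sum,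
    sum_partMult h]

theorem rsProd_plusWeight (h : ∀ j, lam j < 2 * B) :
    rsProd t β (2 * B) (plusWeight α) (List.ofFn lam) = 2 ^ N * oddPoly α β t B lam := by
  have h1 : ∏ i ∈ Finset.range B, rsHom t ((List.ofFn lam).count (2 * i))
      (-β * plusWeight α (2 * i + 1)) (plusWeight α (2 * i)) =
      (∏ i ∈ Finset.range B, (2 : ℂ) ^ partMult lam (2 * i)) *
        ∏ i ∈ Finset.range B, rogersSzego (partMult lam (2 * i)) (α * β) t := by
    rw [← Finset.prod_mul_distrib]
    refine Finset.prod_congr rfl fun i _ => ?_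
    have e : -β * (2 * -α) = 2 * (α * β) := by ring
    rw [plusWeight_even, plusWeight_odd, count_ofFn, ← rsHom_one, ← rsHom_mul, e, mul_one]
  have h2 : ∏ i ∈ Finset.range B, rsHom t ((List.ofFn lam).count (2 * i + 1))
      (-β * plusWeight α (2 * i + 1 + 1)) (plusWeight α (2 * i + 1)) =
      (∏ i ∈ Finset.range B, (2 : ℂ) ^ partMult lam (2 * i + 1)) *
        ∏ i ∈ Finset.range B, rsHom t (partMult lam (2 * i + 1)) (-β) (-α) := by
    rw [← Finset.prod_mul_distrib]
    refine Finset.prod_congr rfl fun i _ => ?_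
    have e : 2 * i + 1 + 1 = 2 * (i + 1) := by ring
    rw [e, plusWeight_even, plusWeight_odd, count_ofFn, ← rsHom_mul, mul_comm (-β)]
  rw [two_pow_eq h, rsProd, oddPoly, prod_range_two_mul, h1, h2]
  ring

theorem rsProd_minusWeight (h : ∀ j, lam j < 2 * B) :
    rsProd t β (2 * B) (minusWeight α) (List.ofFn lam) = 2 ^ N * evenPoly α β t B lam := by
  have h1 : ∏ i ∈ Finset.range B, rsHom t ((List.ofFn lam).count (2 * i))
      (-β * minusWeight α (2 * i + 1)) (minusWeight α (2 * i)) =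
      (∏ i ∈ Finset.range B, (2 : ℂ) ^ partMult lam (2 * i)) *
        ∏ i ∈ Finset.range B, rsHom t (partMult lam (2 * i)) (-β) (-α) := by
    rw [← Finset.prod_mul_distrib]
    refine Finset.prod_congr rfl fun i _ => ?_
    rw [minusWeight_even, minusWeight_odd, count_ofFn, ← rsHom_mul, mul_comm (-β)]
  have h2 : ∏ i ∈ Finset.range B, rsHom t ((List.ofFn lam).count (2 * i + 1))
      (-β * minusWeight α (2 * i + 1 + 1)) (minusWeight α (2 * i + 1)) =
      (∏ i ∈ Finset.range B, (2 : ℂ) ^ partMult lam (2 * i + 1)) *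
        ∏ i ∈ Finset.range B, rogersSzego (partMult lam (2 * i + 1)) (α * β) t := by
    rw [← Finset.prod_mul_distrib]
    refine Finset.prod_congr rfl fun i _ => ?_
    have e : 2 * i + 1 + 1 = 2 * (i + 1) := by ring
    have e' : -β * (2 * -α) = 2 * (α * β) := by ring
    rw [e, minusWeight_even, minusWeight_odd, count_ofFn, ← rsHom_one, ← rsHom_mul, e', mul_one]
  rw [two_pow_eq h, rsProd, evenPoly, prod_range_two_mul, h1, h2]
  ring

theorem oddPoly_eq_oddTerm (ht : ‖t‖ < 1) (hα : α ≠ 0) (h : ∀ j, lam j < 2 * B) :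
    oddPoly α β t B lam = oddTerm α β t lam := by
  have hz := partMult_eq_zero h
  have hr : ∀ z, rogersSzego 0 z t = 1 := fun z => by rw [← rsHom_one, rsHom_zero ht]
  have h1 : ∏ i ∈ Finset.range B, rsHom t (partMult lam (2 * i + 1)) (-β) (-α) =
      (∏ i ∈ Finset.range B, rogersSzego (partMult lam (2 * i + 1)) (β / α) t) *
        (-α) ^ oddParts lam := by
    rw [oddParts_eq h, ← Finset.prod_pow_eq_pow_sum, ← Finset.prod_mul_distrib]
    refine Finset.prod_congr rfl fun i _ => ?_
    rw [rsHom_eq _ _ (neg_ne_zero.2 hα), neg_div_neg_eq, mul_comm]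
  rw [oddPoly, oddTerm, finprod_eq_prod_range (B := B) fun i hi => by
    rw [hz _ (by omega), hr], finprod_eq_prod_range (B := B) fun i hi => by
    rw [hz _ (by omega), hr], h1]
  ring

theorem evenPoly_eq_evenTerm (ht : ‖t‖ < 1) (hα : α ≠ 0) (h : ∀ j, lam j < 2 * B) :
    evenPoly α β t B lam = evenTerm α β t lam := by
  have hz := partMult_eq_zero h
  have hr : ∀ z, rogersSzego 0 z t = 1 := fun z => by rw [← rsHom_one, rsHom_zero ht]
  have h1 : ∏ i ∈ Finset.range B, rsHom t (partMult lam (2 * i)) (-β) (-α) =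
      (∏ i ∈ Finset.range B, rogersSzego (partMult lam (2 * i)) (β / α) t) *
        (-α) ^ evenParts lam := by
    rw [evenParts_eq h, ← Finset.prod_pow_eq_pow_sum, ← Finset.prod_mul_distrib]
    refine Finset.prod_congr rfl fun i _ => ?_
    rw [rsHom_eq _ _ (neg_ne_zero.2 hα), neg_div_neg_eq, mul_comm]
  rw [evenPoly, evenTerm, finprod_eq_prod_range (B := B) fun i hi => by
    rw [hz _ (by omega), hr], finprod_eq_prod_range (B := B) fun i hi => by
    rw [hz _ (by omega), hr], h1]
  ring

theorem rogersSzego_zero_left (ht : ‖t‖ < 1) (m : ℕ) : rogersSzego m 0 t = 1 := by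
  rw [rogersSzego, Finset.sum_range_succ', Finset.sum_eq_zero fun k _ => by
    rw [zero_pow (Nat.succ_ne_zero k), zero_mul]]
  simp [tBinomial_zero_right ht]

theorem oddPoly_zero (ht : ‖t‖ < 1) (h : ∀ j, lam j < 2 * B) :
    oddPoly 0 β t B lam = (-β) ^ oddParts lam := by
  simp only [oddPoly, zero_mul, rogersSzego_zero_left ht, neg_zero, rsHom_zero_right ht,
    Finset.prod_const_one, one_mul]
  rw [oddParts_eq h, ← Finset.prod_pow_eq_pow_sum]

theorem evenPoly_zero (ht : ‖t‖ < 1) (h : ∀ j, lam j < 2 * B) :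
    evenPoly 0 β t B lam = (-β) ^ evenParts lam := by
  simp only [evenPoly, zero_mul, rogersSzego_zero_left ht, neg_zero, rsHom_zero_right ht,
    Finset.prod_const_one, one_mul]
  rw [evenParts_eq h, ← Finset.prod_pow_eq_pow_sum]

end Parts

/-! ### The average of a word in the letters `z^a (1 - α z)(1 - β z)` -/

/-- The letter `z^a (1 - α z)`. -/
noncomputable def expLetter (α : ℂ) (a : ℕ) : ℂ → ℂ := fun z => z ^ a * (1 - α * z)

theorem expLetter_succ (α : ℂ) (a : ℕ) :
    expLetter α (a + 1) = fun z => z * expLetter α a z := by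
  funext z
  simp only [expLetter, pow_succ]
  ring

theorem continuous_expLetter (α : ℂ) (a : ℕ) : Continuous (expLetter α a) := by
  unfold expLetter; fun_prop

theorem pairHol_expLetter {ρ : ℝ} (hρ : 1 < ρ) (α : ℂ) {a b : ℕ} (hab : b ≤ a) :
    PairHol ρ (expLetter α a) (expLetter α b) := by
  refine ⟨fun z => z ^ (a - b) * (1 - α * z) * (z - α), by fun_prop, fun z hz => ?_⟩
  have h0 := annulus_ne_zero hρ hz
  obtain ⟨d, rfl⟩ := Nat.exists_eq_add_of_le hab
  simp only [expLetter, Nat.add_sub_cancel_left, pow_add, inv_pow]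
  field_simp

/-- The average of a symmetrized word in all variables and the signs in `E`, over circles of radii
`r i` and `(r i)⁻¹`. -/
noncomputable def wordAverage {n : ℕ} (t : ℂ) (r : Fin n → ℝ) (E : Finset Bool)
    (L : List (ℂ → ℂ)) : ℂ :=
  ∫ x, hlWord t (symVal x) L (syms Finset.univ E) * hlDensity t Finset.univ E x
    ∂Measure.pi (fun i => circPair (r i))

section Average

variable {n : ℕ} {t α β : ℂ} {ρ : ℝ} {r : Fin n → ℝ} {E : Finset Bool}

theorem wordAverage_linear (hρ : 1 < ρ) (ht : ‖t‖ * ρ ^ 2 < 1) (hr : ∀ i, ρ⁻¹ < r i)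
    (hr1 : ∀ i, r i < 1) (hinj : Function.Injective r) (pre post : List (ℂ → ℂ)) (f g : ℂ → ℂ)
    (c : ℂ) (hpre : ∀ h ∈ pre, Continuous h) (hpost : ∀ h ∈ post, Continuous h)
    (hf : Continuous f) (hg : Continuous g) :
    wordAverage t r E (pre ++ (fun z => f z + c * g z) :: post) =
      wordAverage t r E (pre ++ f :: post) + c * wordAverage t r E (pre ++ g :: post) := by
  have h0 : ∀ i, 0 < r i := fun i => (inv_pos.2 (by linarith)).trans (hr i)
  have hint : ∀ h : ℂ → ℂ, Continuous h → Integrable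
      (fun x => hlWord t (symVal x) (pre ++ h :: post) (syms Finset.univ E) *
        hlDensity t Finset.univ E x) (Measure.pi fun i => circPair (r i)) := by
    intro h hh
    refine integrable_radiusTorus h0 (continuousOn_hlWord_density hρ ht hr hr1 hinj _ _ _ ?_)
    intro k hk
    simp only [List.mem_append, List.mem_cons] at hk
    rcases hk with hk | rfl | hk
    · exact (hpre k hk).continuousOn
    · exact hh.continuousOn
    · exact (hpost k hk).continuousOn
  simp only [wordAverage, hlWord_linear, add_mul, mul_assoc]
  rw [integral_add (hint f hf) ((hint g hg).const_mul c), integral_const_mul]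

theorem wordAverage_straighten (hr : ∀ i, 0 < r i) (hr1 : ∀ i, r i < 1)
    (hinj : Function.Injective r) (pre post : List (ℂ → ℂ)) (g : ℂ → ℂ) :
    wordAverage t r E (pre ++ g :: (fun z => z * g z) :: post) =
      t * wordAverage t r E (pre ++ (fun z => z * g z) :: g :: post) := by
  rw [wordAverage, wordAverage, ← integral_const_mul]
  refine integral_congr_ae ?_
  filter_upwards [ae_radiusTorus hr] with x hx
  rw [hlWord_straighten _ _ _ _ (symVal_injective hr hr1 hinj hx).injOn, mul_assoc]

/-- Expanding the factors `1 - β z`. -/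
theorem wordAverage_eq_raiseSum (hρ : 1 < ρ) (ht : ‖t‖ * ρ ^ 2 < 1) (hr : ∀ i, ρ⁻¹ < r i)
    (hr1 : ∀ i, r i < 1) (hinj : Function.Injective r) (l : List ℕ) (pre : List (ℂ → ℂ))
    (hpre : ∀ h ∈ pre, Continuous h) :
    wordAverage t r E (pre ++ l.map fun a z => expLetter α a z * (1 - β * z)) =
      raiseSum β (fun w => wordAverage t r E (pre ++ w.map (expLetter α))) l := by
  induction l generalizing pre with
  | nil => simp [raiseSum]
  | cons a l ih =>
    have e : (fun z => expLetter α a z * (1 - β * z)) =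
        fun z => expLetter α a z + -β * expLetter α (a + 1) z := by
      funext z
      rw [expLetter_succ]
      ring
    have hpre' : ∀ b, ∀ h ∈ pre ++ [expLetter α b], Continuous h := by
      intro b h hh
      rcases List.mem_append.1 hh with hh | hh
      · exact hpre h hh
      · rw [List.mem_singleton.1 hh]
        exact continuous_expLetter α b
    have hl : ∀ h ∈ l.map (fun a z => expLetter α a z * (1 - β * z)), Continuous h := by
      intro h hh
      obtain ⟨b, -, rfl⟩ := List.mem_map.1 hh
      exact (continuous_expLetter α b).mul (by fun_prop)
    have h1 := ih _ (hpre' a)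
    have h2 := ih _ (hpre' (a + 1))
    simp only [List.append_assoc, List.cons_append, List.nil_append] at h1 h2
    rw [List.map_cons, e, wordAverage_linear hρ ht hr hr1 hinj _ _ _ _ _ hpre hl
      (continuous_expLetter α a) (continuous_expLetter α (a + 1)), h1, h2, raiseSum]
    simp only [List.map_cons]
    ring

theorem wordAverage_letters (hρ : 1 < ρ) (ht : ‖t‖ * ρ ^ 2 < 1) (hr : ∀ i, ρ⁻¹ < r i)
    (hr1 : ∀ i, r i < 1) (hinj : Function.Injective r) {N B : ℕ} (hN : N = 2 * n + E.card)
    {lam : Fin N → ℕ} (hlam : Antitone lam) (hB : 0 < B) (h : ∀ j, lam j < 2 * B) :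
    wordAverage t r E ((List.ofFn lam).map fun a z => expLetter α a z * (1 - β * z)) =
      (n.factorial : ℂ) / (2 * (1 - t)) ^ n * endConst t E * (2 ^ N / 2) *
        (oddPoly α β t B lam + endSign E * evenPoly α β t B lam) := by
  have h0 : ∀ i, 0 < r i := fun i => (inv_pos.2 (by linarith)).trans (hr i)
  have ht1 : ‖t‖ < 1 := by nlinarith [norm_nonneg t]
  have hsort : (List.ofFn lam).Pairwise (· ≥ ·) :=
    List.pairwise_ofFn.2 fun i j hij => hlam hij.le
  have hM : ∀ e ∈ List.ofFn lam, e ≤ 2 * B - 1 := by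
    intro e he
    obtain ⟨j, rfl⟩ := List.mem_ofFn.1 he
    have := h j
    omega
  have hexp := wordAverage_eq_raiseSum (α := α) (β := β) (E := E) hρ ht hr hr1 hinj
    (List.ofFn lam) [] (by simp)
  simp only [List.nil_append] at hexp
  rw [hexp, raiseSum_eq ht1 hsort hM (B := 2 * B) (by omega)
    (c := (n.factorial : ℂ) / (2 * (1 - t)) ^ n * endConst t E / 2)
    (d := (n.factorial : ℂ) / (2 * (1 - t)) ^ n * endConst t E / 2 * endSign E)
    (χ := plusWeight α) (ψ := minusWeight α), rsProd_plusWeight h, rsProd_minusWeight h]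
  · ring
  · intro pre post a
    simp only [List.map_append, List.map_cons, expLetter_succ]
    exact wordAverage_straighten h0 hr1 hinj _ _ _
  · intro w hw hws _
    rw [wordAverage, integral_hlWord hρ ht hr hr1 hinj]
    · have e1 : ((w.map (expLetter α)).map fun f => f 1 + f (-1)) = w.map (plusWeight α) := by
        rw [List.map_map]
        refine List.map_congr_left fun a _ => ?_
        simp only [Function.comp, expLetter, plusWeight]
        ring
      have e2 : ((w.map (expLetter α)).map fun f => f 1 - f (-1)) = w.map (minusWeight α) := by
        rw [List.map_map]
        refine List.map_congr_left fun a _ => ?_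
        simp only [Function.comp, expLetter, minusWeight]
        ring
      rw [wordValue, plusProd, minusProd, e1, e2, Finset.card_univ, Fintype.card_fin]
      ring
    · rw [List.length_map, hw, List.length_ofFn, Finset.card_univ, Fintype.card_fin, hN]
    · intro f hf
      obtain ⟨a, -, rfl⟩ := List.mem_map.1 hf
      exact (continuous_expLetter α a).continuousOn
    · exact List.pairwise_map.2 (hws.imp fun hab => pairHol_expLetter hρ α hab)

/-- The normalization, by the identity `∑_w w (∏_{i<j} (x_i - t x_j) / (x_i - x_j)) = [N]!`. -/
theorem tFactorial_mul_integral_hlDensity (hρ : 1 < ρ) (ht : ‖t‖ * ρ ^ 2 < 1)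
    (hr : ∀ i, ρ⁻¹ < r i) (hr1 : ∀ i, r i < 1) (hinj : Function.Injective r) {N : ℕ}
    (hN : N = 2 * n + E.card) (hN0 : N ≠ 0) :
    tFactorial t N * ∫ x, hlDensity t Finset.univ E x ∂Measure.pi (fun i => circPair (r i)) =
      (n.factorial : ℂ) / (2 * (1 - t)) ^ n * endConst t E * (2 ^ N / 2) := by
  have h0 : ∀ i, 0 < r i := fun i => (inv_pos.2 (by linarith)).trans (hr i)
  have ht1 : ‖t‖ < 1 := by nlinarith [norm_nonneg t]
  have ht' : t ≠ 1 := by rintro rfl; simp at ht1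
  have hcard : (syms (Finset.univ : Finset (Fin n)) E).card = N := by
    rw [card_syms, Finset.card_univ, Fintype.card_fin, hN]
  have h1 := integral_hlWord hρ ht hr hr1 hinj Finset.univ E (List.replicate N fun _ => 1)
    (by rw [List.length_replicate, Finset.card_univ, Fintype.card_fin, hN])
    (fun f hf => by rw [List.eq_of_mem_replicate hf]; exact continuousOn_const)
    (List.pairwise_replicate.2 (Or.inr ⟨id, differentiable_id.differentiableOn, by simp⟩))
  rw [← integral_const_mul]
  rw [integral_congr_ae (g := fun x => tFactorial t N * hlDensity t Finset.univ E x)] at h1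
  · rw [h1, wordValue, plusProd, minusProd, Finset.card_univ, Fintype.card_fin]
    simp only [List.map_replicate, List.prod_replicate, sub_self, zero_pow hN0]
    norm_num
  · filter_upwards [ae_radiusTorus h0] with x hx
    rw [← hcard, hlWord_one ht' _ (symVal_injective h0 hr1 hinj hx).injOn]
    exact fun q _ => annulus_ne_zero hρ (symVal_mem_annulus hρ
      (radiusTorus_subset hρ hr hr1 hx) q)

end Average

/-! ### One component of the orthogonal group -/

theorem prefactor_eq {N : ℕ} (t : ℂ) (lam : Fin N → ℕ) :
    prefactor t lam = tFactorial t N / vT t lam := by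
  rw [prefactor, tFactorial, phiT, Finset.prod_div_distrib, Finset.prod_const, Nat.card_Icc,
    Nat.add_sub_cancel, div_div, mul_comm (vT t lam)]

theorem ae_circ_one_ne (a : ℂ) : ∀ᵐ z ∂circ 1, z ≠ a := by
  rw [circ, ae_map_iff (p := (· ≠ a)) (continuous_circleMap 0 1).aemeasurable
    (measurableSet_singleton a).compl]
  refine Measure.ae_smul_measure (ae_restrict_of_ae ?_) _
  have h := ((Set.countable_singleton a).preimage_circleMap 0 one_ne_zero).ae_notMem
    (volume : Measure ℝ)
  filter_upwards [h] with θ hθ using hθ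

theorem differentiableOn_eval {E : Type*} [NormedAddCommGroup E] [NormedSpace ℂ E] {U : Set E}
    {ι : Type*} {f : E → ι → ℂ} (hf : ∀ i, DifferentiableOn ℂ (fun x => f x i) U)
    (p : MvPolynomial ι ℂ) : DifferentiableOn ℂ (fun x => MvPolynomial.eval (f x) p) U := by
  induction p using MvPolynomial.induction_on with
  | C a => simp only [MvPolynomial.eval_C]; exact differentiableOn_const _
  | add p q hp hq => simp only [map_add]; exact hp.add hq
  | mul_X p i hp => simp only [map_mul, MvPolynomial.eval_X]; exact hp.fun_mul (hf i)

/-- The radii are chosen pairwise distinct, so that all symbols have distinct values, and so close to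
`1` that no denominator `1 - t y z` of the density vanishes. -/
theorem exists_radii {t : ℂ} (ht : ‖t‖ < 1) (n : ℕ) : ∃ ρ : ℝ, 1 < ρ ∧ ‖t‖ * ρ ^ 2 < 1 ∧
    ∃ r : Fin n → ℝ, (∀ i, ρ⁻¹ < r i) ∧ (∀ i, r i < 1) ∧ Function.Injective r := by
  have hc : Filter.Tendsto (fun ρ : ℝ => ‖t‖ * ρ ^ 2) (nhdsWithin 1 (Set.Ioi 1))
      (nhds (‖t‖ * 1 ^ 2)) :=
    ((by fun_prop : Continuous fun ρ : ℝ => ‖t‖ * ρ ^ 2).tendsto 1).mono_left nhdsWithin_le_nhds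
  obtain ⟨ρ, h1, h2⟩ := ((hc.eventually_lt_const (by simpa using ht)).and
    self_mem_nhdsWithin).exists
  have hρ : ρ⁻¹ < 1 := inv_lt_one_of_one_lt₀ h2
  have hinf : Infinite (Set.Ioo ρ⁻¹ 1) := (Set.Ioo_infinite hρ).to_subtype
  refine ⟨ρ, h2, h1, fun i => Infinite.natEmbedding (Set.Ioo ρ⁻¹ 1) i, fun i => ?_, fun i => ?_,
    fun i j hij => ?_⟩
  · exact (Infinite.natEmbedding (Set.Ioo ρ⁻¹ 1) i).2.1
  · exact (Infinite.natEmbedding (Set.Ioo ρ⁻¹ 1) i).2.2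
  · exact Fin.ext ((Infinite.natEmbedding (Set.Ioo ρ⁻¹ 1)).injective (Subtype.ext hij))

section Component

variable {n N : ℕ} {t α β : ℂ} {E : Finset Bool}

theorem one_add_ne_zero {t : ℂ} (ht : ‖t‖ < 1) : 1 + t ≠ 0 := by
  have := one_sub_pow_ne_zero (t := -t) (by rwa [norm_neg]) one_ne_zero
  simpa using this

theorem endConst_ne_zero (ht : ‖t‖ < 1) (E : Finset Bool) : endConst t E ≠ 0 := by
  rw [endConst]
  split_ifs
  · exact div_ne_zero (one_add_ne_zero ht) two_ne_zero
  · exact one_ne_zero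

/-- The Hall--Littlewood polynomial times `∏ (1 - α z)(1 - β z)`, over all symbols `z`, as a
symmetrized word. -/
theorem eval_hallLittlewood_mul (hN : N = 2 * n + E.card) {e : Fin N → HLSym n}
    (he : Function.Injective e) (heE : ∀ i, e i ∈ syms Finset.univ E) (lam : Fin N → ℕ)
    {x : Fin n → ℂ} (hx : Function.Injective (symVal x)) :
    MvPolynomial.eval (symVal x ∘ e) (hallLittlewood t lam) * (alphaBeta α β x *
        ∏ b ∈ E, (1 - α * signVal b) * (1 - β * signVal b)) =
      1 / vT t lam * hlWord t (symVal x)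
        ((List.ofFn lam).map fun a z => expLetter α a z * (1 - β * z)) (syms Finset.univ E) := by
  have hcard : (syms (Finset.univ : Finset (Fin n)) E).card = N := by
    rw [card_syms, Finset.card_univ, Fintype.card_fin, hN]
  have himg : Finset.univ.image e = syms Finset.univ E := by
    refine Finset.eq_of_subset_of_card_le (fun q hq => ?_) ?_
    · obtain ⟨i, -, rfl⟩ := Finset.mem_image.1 hq
      exact heE i
    · rw [Finset.card_image_of_injective _ he, hcard, Finset.card_univ, Fintype.card_fin]
  have hlet : ((List.ofFn lam).map fun a z => expLetter α a z * (1 - β * z)) =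
      (List.ofFn fun i z => z ^ lam i).map (· * fun z => (1 - α * z) * (1 - β * z)) := by
    rw [List.map_ofFn, List.map_ofFn]
    congr 1
    funext i z
    simp only [Function.comp, expLetter, Pi.mul_apply]
    ring
  have hab : ∏ q ∈ syms Finset.univ E, (1 - α * symVal x q) * (1 - β * symVal x q) =
      alphaBeta α β x * ∏ b ∈ E, (1 - α * signVal b) * (1 - β * signVal b) := by
    rw [prod_syms, alphaBeta]
    congr 1
    refine Finset.prod_congr rfl fun i _ => ?_
    simp only [symVal]
    ring
  rw [hlet, hlWord_map_mul _ _ _ (by rw [List.length_ofFn, hcard]), hab, ← himg,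
    ← hlWord_image e he, ← hlSum_eq_hlWord, hallLittlewood, map_mul, MvPolynomial.eval_C,
    eval_hallLittlewoodR _ _ _ (hx.comp he), hlSum]
  ring

/-- The integral formula for one component: `E` is the set of eigenvalues `±1` that all elements of
the component share, `w` is the density up to a constant and a null set. -/
theorem component_integral (ht : ‖t‖ < 1) (hN : N = 2 * n + E.card) (hN0 : N ≠ 0)
    {e : Fin N → HLSym n} (he : Function.Injective e) (heE : ∀ i, e i ∈ syms Finset.univ E)
    {pt : (Fin n → ℂ) → Fin N → ℂ} (hpt : ∀ x, pt x = symVal x ∘ e) {w : (Fin n → ℂ) → ℂ} {κ : ℂ}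
    (hκ : κ ≠ 0) (hw : ∀ x, (∀ i, x i ≠ 1 ∧ x i ≠ -1) →
      w x = κ * hlDensity t Finset.univ E x) {lam : Fin N → ℕ} (hlam : Antitone lam) :
    IntegrableT (integrand pt w α β t lam) ∧ intT w ≠ 0 ∧
      ∀ B, 0 < B → (∀ j, lam j < 2 * B) →
        (∏ b ∈ E, (1 - α * signVal b) * (1 - β * signVal b)) / intT w *
          intT (integrand pt w α β t lam) =
        prefactor t lam * (oddPoly α β t B lam + endSign E * evenPoly α β t B lam) := by
  obtain ⟨ρ, hρ, htρ, r, hr, hr1, hinj⟩ := exists_radii ht n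
  have h0 : ∀ i, 0 < r i := fun i => (inv_pos.2 (by linarith)).trans (hr i)
  have hsphere : ∀ᵐ x ∂Measure.pi (fun _ : Fin n => circ 1),
      x ∈ Set.univ.pi fun _ : Fin n => sphere (0 : ℂ) 1 :=
    ae_pi_mem fun _ => by simpa only [abs_one] using ae_circ 1
  have hae : w =ᵐ[Measure.pi fun _ : Fin n => circ 1]
      fun x => κ * hlDensity t Finset.univ E x := by
    have h1 := ae_pi_mem (μ := fun _ : Fin n => circ 1) fun _ => ae_circ_one_ne 1
    have h2 := ae_pi_mem (μ := fun _ : Fin n => circ 1) fun _ => ae_circ_one_ne (-1)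
    filter_upwards [h1, h2] with x k1 k2
    exact hw x fun i => ⟨k1 i (Set.mem_univ i), k2 i (Set.mem_univ i)⟩
  have hint : ∀ F : (Fin n → ℂ) → ℂ, DifferentiableOn ℂ F (Set.univ.pi fun _ => annulus ρ) →
      Integrable F (Measure.pi fun _ : Fin n => circ 1) := fun F hF =>
    integrable_of_continuousOn (isCompact_univ_pi fun _ => isCompact_sphere _ _) hsphere
      (hF.continuousOn.mono (Set.pi_mono fun _ _ => sphere_one_subset_annulus hρ))
  have hD := differentiableOn_hlDensity (n := n) hρ htρ Finset.univ E
  have hd1 : DifferentiableOn ℂ (fun x => κ * hlDensity t Finset.univ E x)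
      (Set.univ.pi fun _ : Fin n => annulus ρ) := hD.const_mul κ
  have hd2 : DifferentiableOn ℂ
      (integrand pt (fun x => κ * hlDensity t Finset.univ E x) α β t lam)
      (Set.univ.pi fun _ : Fin n => annulus ρ) := by
    unfold integrand alphaBeta
    refine DifferentiableOn.fun_mul (DifferentiableOn.fun_mul (differentiableOn_eval (fun i => ?_) _)
      hd1) (differentiableOn_prod fun i _ => ?_)
    · simp only [hpt, Function.comp]
      exact differentiableOn_symVal hρ _
    · have h1 := differentiableOn_symVal hρ (.inl (i, true))
      have h2 := differentiableOn_symVal hρ (.inl (i, false))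
      simp only [symVal] at h1 h2
      fun_prop
  have hae2 : integrand pt w α β t lam =ᵐ[Measure.pi fun _ : Fin n => circ 1]
      integrand pt (fun x => κ * hlDensity t Finset.univ E x) α β t lam := by
    filter_upwards [hae] with x hx
    rw [integrand, integrand, hx]
  obtain ⟨-, hZ⟩ := intT_eq_integral hae (hint _ hd1)
  obtain ⟨hI, hI'⟩ := intT_eq_integral hae2 (hint _ hd2)
  rw [integral_torus_eq_circPair hρ hr hr1 hd1, integral_const_mul] at hZ
  rw [integral_torus_eq_circPair hρ hr hr1 hd2] at hI'
  have hnorm := tFactorial_mul_integral_hlDensity (E := E) hρ htρ hr hr1 hinj hN hN0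
  set I := ∫ x, hlDensity t Finset.univ E x ∂Measure.pi (fun i => circPair (r i))
  have ht1 : 1 - t ≠ 0 := by simpa using one_sub_pow_ne_zero ht one_ne_zero
  have hI0 : I ≠ 0 := by
    intro h
    rw [h, mul_zero] at hnorm
    refine (mul_ne_zero (mul_ne_zero (div_ne_zero ?_ (pow_ne_zero _ (mul_ne_zero two_ne_zero ht1)))
      (endConst_ne_zero ht E)) (div_ne_zero (pow_ne_zero _ two_ne_zero) two_ne_zero)) hnorm.symm
    exact_mod_cast n.factorial_ne_zero
  refine ⟨hI, by rw [hZ]; exact mul_ne_zero hκ hI0, fun B hB h => ?_⟩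
  have hword := wordAverage_letters (α := α) (β := β) hρ htρ hr hr1 hinj hN hlam hB h
  rw [← hnorm] at hword
  have hmain : (∏ b ∈ E, (1 - α * signVal b) * (1 - β * signVal b)) *
      intT (integrand pt w α β t lam) = κ * (1 / vT t lam) * (tFactorial t N * I *
        (oddPoly α β t B lam + endSign E * evenPoly α β t B lam)) := by
    rw [hI', ← hword, wordAverage, ← integral_const_mul, ← integral_const_mul]
    refine integral_congr_ae ?_
    -- Off the unit torus the symbols are distinct, so the polynomial is given by the symmetrization.
    filter_upwards [ae_radiusTorus h0] with x hx
    have hx' := symVal_injective h0 hr1 hinj hx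
    have := eval_hallLittlewood_mul (t := t) (α := α) (β := β) hN he heE lam hx'
    rw [integrand, hpt]
    linear_combination (κ * hlDensity t Finset.univ E x) * this
  rw [div_mul_eq_mul_div, hmain, hZ, prefactor_eq]
  field_simp

/-- The polynomials in `α` are replaced by the expressions of the theorem, separately for `α ≠ 0` and
`α = 0`. -/
theorem component_formula (ht : ‖t‖ < 1) (hN : N = 2 * n + E.card) (hN0 : N ≠ 0)
    {e : Fin N → HLSym n} (he : Function.Injective e) (heE : ∀ i, e i ∈ syms Finset.univ E)
    {pt : (Fin n → ℂ) → Fin N → ℂ} (hpt : ∀ x, pt x = symVal x ∘ e) {w : (Fin n → ℂ) → ℂ} {κ : ℂ}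
    (hκ : κ ≠ 0) (hw : ∀ x, (∀ i, x i ≠ 1 ∧ x i ≠ -1) → w x = κ * hlDensity t Finset.univ E x)
    {lam : Fin N → ℕ} (hlam : Antitone lam) {p : ℂ}
    (hp : ∏ b ∈ E, (1 - α * signVal b) * (1 - β * signVal b) = p) :
    IntegrableT (integrand pt w α β t lam) ∧ intT w ≠ 0 ∧
      (α ≠ 0 → p / intT w * intT (integrand pt w α β t lam) =
        prefactor t lam * (oddTerm α β t lam + endSign E * evenTerm α β t lam)) ∧
      (α = 0 → p / intT w * intT (integrand pt w α β t lam) =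
        prefactor t lam * ((-β) ^ oddParts lam + endSign E * (-β) ^ evenParts lam)) := by
  obtain ⟨h1, h2, h3⟩ :=
    component_integral (α := α) (β := β) ht hN hN0 he heE hpt hκ hw hlam
  -- Any `B` with `lam j < 2 * B` will do: all multiplicities beyond are zero.
  set B := ∑ j, lam j + 1
  have hB : ∀ j, lam j < 2 * B := by
    intro j
    have := Finset.single_le_sum (fun i _ => Nat.zero_le (lam i)) (Finset.mem_univ j)
    omega
  have h := h3 B (Nat.succ_pos _) hB
  rw [hp] at h
  refine ⟨h1, h2, fun hα => ?_, ?_⟩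
  · rw [h, oddPoly_eq_oddTerm ht hα hB, evenPoly_eq_evenTerm ht hα hB]
  · rintro rfl
    rw [h, oddPoly_zero ht hB, evenPoly_zero ht hB]

end Component

/-! ### The Koornwinder densities -/

/-- Comparison of the densities; only the factors of the individual variables depend on the parameters.
The factors at parameters `1` and `-1` cancel against `1 - x_i^{±2}` only where `x_i ≠ ±1`, which holds
almost everywhere. -/
theorem koornwinder_eq {n : ℕ} {a b c d t : ℂ} {E : Finset Bool} {x : Fin n → ℂ}
    (h : ∀ i, ((1 - x i ^ 2) * (1 - (x i)⁻¹ ^ 2)) /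
      (((1 - a * x i) * (1 - a * (x i)⁻¹)) * ((1 - b * x i) * (1 - b * (x i)⁻¹)) *
        ((1 - c * x i) * (1 - c * (x i)⁻¹)) * ((1 - d * x i) * (1 - d * (x i)⁻¹))) =
      selfDensity t E (x i)) :
    koornwinder a b c d t x = 1 / (2 ^ n * (n.factorial : ℂ)) * hlDensity t Finset.univ E x := by
  rw [koornwinder, hlDensity, mul_assoc, Finset.prod_congr rfl fun i _ => h i]
  congr 2
  refine Finset.prod_congr rfl fun i _ => Finset.prod_congr ?_ fun j _ => rfl
  ext j
  simp

theorem selfDensity_eq {a b s x : ℂ} {E : Finset Bool}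
    (h : ((1 - x) * (1 - x⁻¹)) / ((1 - a * x) * (1 - a * x⁻¹)) *
      (((1 + x) * (1 + x⁻¹)) / ((1 - b * x) * (1 - b * x⁻¹))) =
      ∏ e ∈ E, crossDensity (s ^ 2) x (signVal e)) :
    ((1 - x ^ 2) * (1 - x⁻¹ ^ 2)) /
      (((1 - a * x) * (1 - a * x⁻¹)) * ((1 - b * x) * (1 - b * x⁻¹)) *
        ((1 - s * x) * (1 - s * x⁻¹)) * ((1 - -s * x) * (1 - -s * x⁻¹))) =
      selfDensity (s ^ 2) E x := by
  rw [selfDensity, ← h, div_mul_div_comm, div_mul_div_comm]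
  congr 1 <;> ring

theorem crossDensity_one (t x : ℂ) : crossDensity t x (signVal true) =
    ((1 - x) * (1 - x⁻¹)) / ((1 - t * x) * (1 - t * x⁻¹)) := by
  rw [crossDensity, signVal]
  congr 1 <;> ring

theorem crossDensity_neg_one (t x : ℂ) : crossDensity t x (signVal false) =
    ((1 + x) * (1 + x⁻¹)) / ((1 - -t * x) * (1 - -t * x⁻¹)) := by
  rw [crossDensity, signVal]
  congr 1 <;> ring

theorem one_sub_div_self {x : ℂ} (h1 : x ≠ 1) :
    ((1 - x) * (1 - x⁻¹)) / ((1 - 1 * x) * (1 - 1 * x⁻¹)) = 1 := by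
  rw [one_mul, one_mul]
  refine div_self (mul_ne_zero (sub_ne_zero.2 h1.symm) (sub_ne_zero.2 fun h => h1 ?_))
  rw [← inv_inv x, ← h, inv_one]

theorem one_add_div_self {x : ℂ} (h1 : x ≠ -1) :
    ((1 + x) * (1 + x⁻¹)) / ((1 - -1 * x) * (1 - -1 * x⁻¹)) = 1 := by
  have h := one_sub_div_self (x := -x) fun h => h1 (by rw [← h, neg_neg])
  rw [one_mul, one_mul, inv_neg, sub_neg_eq_add, sub_neg_eq_add] at h
  rw [neg_one_mul, neg_one_mul, sub_neg_eq_add, sub_neg_eq_add]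
  exact h

/-! ### The four components -/

/-- The symbols `x_1, …, x_n, x_1⁻¹, …, x_n⁻¹`, in this order. -/
def pairSyms (n : ℕ) : Fin (n + n) → HLSym n :=
  Fin.append (fun i => .inl (i, true)) (fun i => .inl (i, false))

theorem pairSyms_injective (n : ℕ) : Function.Injective (pairSyms n) := by
  refine Fin.append_injective_iff.2 ⟨fun i j h => ?_, fun i j h => ?_, fun i j h => ?_⟩
  · simpa using h
  · simpa using h
  · simp at h

theorem pairSyms_left {n : ℕ} (i : Fin n) : pairSyms n (Fin.castAdd n i) = .inl (i, true) :=
  Fin.append_left _ _ i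

theorem pairSyms_right {n : ℕ} (i : Fin n) : pairSyms n (Fin.natAdd n i) = .inl (i, false) :=
  Fin.append_right _ _ i

theorem pairSyms_ne_inr {n : ℕ} (i : Fin (n + n)) (e : Bool) : pairSyms n i ≠ .inr e := by
  refine Fin.addCases (fun i => ?_) (fun i => ?_) i
  · rw [pairSyms_left]
    exact Sum.inl_ne_inr
  · rw [pairSyms_right]
    exact Sum.inl_ne_inr

theorem pairSyms_mem {n : ℕ} (E : Finset Bool) (i : Fin (n + n)) :
    pairSyms n i ∈ syms Finset.univ E := by
  refine Fin.addCases (fun i => ?_) (fun i => ?_) i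
  · rw [pairSyms_left]
    exact inl_mem_syms.2 (Finset.mem_univ i)
  · rw [pairSyms_right]
    exact inl_mem_syms.2 (Finset.mem_univ i)

theorem append_inv_eq {n : ℕ} (x : Fin n → ℂ) : Fin.append x x⁻¹ = symVal x ∘ pairSyms n := by
  funext i
  refine Fin.addCases (fun i => ?_) (fun i => ?_) i
  · rw [Fin.append_left, Function.comp_apply, pairSyms_left, symVal]
  · rw [Fin.append_right, Function.comp_apply, pairSyms_right, symVal, Pi.inv_apply]

theorem append_pairSyms_injective {n k : ℕ} {v : Fin k → Bool} (hv : Function.Injective v) :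
    Function.Injective (Fin.append (pairSyms n) fun i => .inr (v i)) :=
  Fin.append_injective_iff.2 ⟨pairSyms_injective n, fun _ _ h => hv (Sum.inr_injective h),
    fun i _ => pairSyms_ne_inr i _⟩

theorem append_pairSyms_mem {n k : ℕ} {v : Fin k → Bool} {E : Finset Bool} (hv : ∀ i, v i ∈ E)
    (i : Fin (n + n + k)) :
    Fin.append (pairSyms n) (fun i => .inr (v i)) i ∈ syms Finset.univ E := by
  refine Fin.addCases (fun i => ?_) (fun i => ?_) i
  · rw [Fin.append_left]
    exact pairSyms_mem E i
  · rw [Fin.append_right]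
    exact inr_mem_syms.2 (hv i)

theorem append_append_eq {n k : ℕ} (x : Fin n → ℂ) (v : Fin k → Bool) :
    Fin.append (Fin.append x x⁻¹) (fun i => signVal (v i)) =
      symVal x ∘ Fin.append (pairSyms n) fun i => .inr (v i) := by
  funext i
  refine Fin.addCases (fun i => ?_) (fun i => ?_) i
  · rw [Fin.append_left, Function.comp_apply, Fin.append_left, append_inv_eq, Function.comp_apply]
  · rw [Fin.append_right, Function.comp_apply, Fin.append_right, symVal]

theorem theorem5p2 (n : ℕ) (t s α β : ℂ) (ht : ‖t‖ < 1) (hs : s ^ 2 = t) :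
    -- the component `O⁺(2n)`, `n ≥ 1`
    (1 ≤ n → ∀ lam : Fin (n + n) → ℕ, Antitone lam →
      IntegrableT (integrand (n := n) ptEvenPlus (koornwinder 1 (-1) s (-s) t) α β t lam) ∧
      intT (n := n) (koornwinder 1 (-1) s (-s) t) ≠ 0 ∧
      (α ≠ 0 →
        1 / intT (n := n) (koornwinder 1 (-1) s (-s) t) *
          intT (n := n) (integrand ptEvenPlus (koornwinder 1 (-1) s (-s) t) α β t lam) =
        prefactor t lam * (oddTerm α β t lam + evenTerm α β t lam)) ∧
      (α = 0 →
        1 / intT (n := n) (koornwinder 1 (-1) s (-s) t) *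
          intT (n := n) (integrand ptEvenPlus (koornwinder 1 (-1) s (-s) t) α β t lam) =
        prefactor t lam * ((-β) ^ oddParts lam + (-β) ^ evenParts lam))) ∧
    -- the component `O⁻(2(n+1))`, with `n` integration variables
    (∀ lam : Fin (n + n + 2) → ℕ, Antitone lam →
      IntegrableT (integrand (n := n) ptEvenMinus (koornwinder t (-t) s (-s) t) α β t lam) ∧
      intT (n := n) (koornwinder t (-t) s (-s) t) ≠ 0 ∧
      (α ≠ 0 →
        (1 - α ^ 2) * (1 - β ^ 2) / intT (n := n) (koornwinder t (-t) s (-s) t) *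
          intT (n := n) (integrand ptEvenMinus (koornwinder t (-t) s (-s) t) α β t lam) =
        prefactor t lam * (oddTerm α β t lam - evenTerm α β t lam)) ∧
      (α = 0 →
        (1 - α ^ 2) * (1 - β ^ 2) / intT (n := n) (koornwinder t (-t) s (-s) t) *
          intT (n := n) (integrand ptEvenMinus (koornwinder t (-t) s (-s) t) α β t lam) =
        prefactor t lam * ((-β) ^ oddParts lam - (-β) ^ evenParts lam))) ∧
    -- the component `O⁺(2n+1)`
    (∀ lam : Fin (n + n + 1) → ℕ, Antitone lam →
      IntegrableT (integrand (n := n) (ptOdd 1) (koornwinder t (-1) s (-s) t) α β t lam) ∧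
      intT (n := n) (koornwinder t (-1) s (-s) t) ≠ 0 ∧
      (α ≠ 0 →
        (1 - α) * (1 - β) / intT (n := n) (koornwinder t (-1) s (-s) t) *
          intT (n := n) (integrand (ptOdd 1) (koornwinder t (-1) s (-s) t) α β t lam) =
        prefactor t lam * (oddTerm α β t lam + evenTerm α β t lam)) ∧
      (α = 0 →
        (1 - α) * (1 - β) / intT (n := n) (koornwinder t (-1) s (-s) t) *
          intT (n := n) (integrand (ptOdd 1) (koornwinder t (-1) s (-s) t) α β t lam) =
        prefactor t lam * ((-β) ^ oddParts lam + (-β) ^ evenParts lam))) ∧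
    -- the component `O⁻(2n+1)`
    (∀ lam : Fin (n + n + 1) → ℕ, Antitone lam →
      IntegrableT (integrand (n := n) (ptOdd (-1)) (koornwinder 1 (-t) s (-s) t) α β t lam) ∧
      intT (n := n) (koornwinder 1 (-t) s (-s) t) ≠ 0 ∧
      (α ≠ 0 →
        (1 + α) * (1 + β) / intT (n := n) (koornwinder 1 (-t) s (-s) t) *
          intT (n := n) (integrand (ptOdd (-1)) (koornwinder 1 (-t) s (-s) t) α β t lam) =
        prefactor t lam * (oddTerm α β t lam - evenTerm α β t lam)) ∧
      (α = 0 →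
        (1 + α) * (1 + β) / intT (n := n) (koornwinder 1 (-t) s (-s) t) *
          intT (n := n) (integrand (ptOdd (-1)) (koornwinder 1 (-t) s (-s) t) α β t lam) =
        prefactor t lam * ((-β) ^ oddParts lam - (-β) ^ evenParts lam))) := by
  subst hs
  have hκ : 1 / (2 ^ n * (n.factorial : ℂ)) ≠ 0 :=
    one_div_ne_zero (mul_ne_zero (pow_ne_zero _ two_ne_zero)
      (by exact_mod_cast n.factorial_ne_zero))
  refine ⟨fun hn lam hlam => ?_, fun lam hlam => ?_, fun lam hlam => ?_, fun lam hlam => ?_⟩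
  · have h := component_formula (E := ∅) (α := α) (β := β) ht
      (by rw [Finset.card_empty]; ring) (by omega) (pairSyms_injective n) (pairSyms_mem ∅)
      append_inv_eq hκ (fun x hx => koornwinder_eq (a := 1) (b := -1) (c := s) (d := -s)
        fun i => selfDensity_eq (by
          rw [one_sub_div_self (hx i).1, one_add_div_self (hx i).2, Finset.prod_empty, one_mul]))
      hlam rfl
    simp only [endSign, Finset.notMem_empty, if_false, one_mul, Finset.prod_empty] at h
    exact h
  · have h := component_formula (E := Finset.univ) (α := α) (β := β) ht
      (by rw [Finset.card_univ, Fintype.card_bool]; ring) (by omega)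
      (append_pairSyms_injective (v := ![true, false]) (by decide))
      (append_pairSyms_mem fun i => Finset.mem_univ _) (pt := ptEvenMinus)
      (p := (1 - α ^ 2) * (1 - β ^ 2))
      (fun x => by
        rw [← append_append_eq, ptEvenMinus]
        congr 1
        funext i
        fin_cases i <;> rfl)
      hκ (fun x hx => koornwinder_eq (a := s ^ 2) (b := -s ^ 2) (c := s) (d := -s)
        fun i => selfDensity_eq (by
          rw [Fintype.prod_bool, crossDensity_one, crossDensity_neg_one]))
      hlam (by rw [Fintype.prod_bool]; simp only [signVal]; ring)
    simp only [endSign, Finset.mem_univ, if_true, neg_one_mul, ← sub_eq_add_neg] at h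
    exact h
  · have h := component_formula (E := {true}) (α := α) (β := β) ht
      (by rw [Finset.card_singleton]; ring) (by omega)
      (append_pairSyms_injective (v := ![true]) (by decide))
      (append_pairSyms_mem fun i => by fin_cases i; decide) (pt := ptOdd 1)
      (p := (1 - α) * (1 - β))
      (fun x => by
        rw [← append_append_eq, ptOdd]
        congr 1
        funext i
        fin_cases i; rfl)
      hκ (fun x hx => koornwinder_eq (a := s ^ 2) (b := -1) (c := s) (d := -s)
        fun i => selfDensity_eq (by
          rw [Finset.prod_singleton, crossDensity_one, one_add_div_self (hx i).2, mul_one]))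
      hlam (by rw [Finset.prod_singleton]; simp only [signVal]; ring)
    simp only [endSign, Finset.mem_singleton, Bool.false_eq_true, if_false, one_mul] at h
    exact h
  · have h := component_formula (E := {false}) (α := α) (β := β) ht
      (by rw [Finset.card_singleton]; ring) (by omega)
      (append_pairSyms_injective (v := ![false]) (by decide))
      (append_pairSyms_mem fun i => by fin_cases i; decide) (pt := ptOdd (-1))
      (p := (1 + α) * (1 + β))
      (fun x => by
        rw [← append_append_eq, ptOdd]
        congr 1
        funext i
        fin_cases i; rfl)
      hκ (fun x hx => koornwinder_eq (a := 1) (b := -s ^ 2) (c := s) (d := -s)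
        fun i => selfDensity_eq (by
          rw [Finset.prod_singleton, crossDensity_neg_one, one_sub_div_self (hx i).1, one_mul]))
      hlam (by rw [Finset.prod_singleton]; simp only [signVal]; ring)
    simp only [endSign, Finset.mem_singleton, if_true, neg_one_mul, ← sub_eq_add_neg] at h
    exact h
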